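/- Let $K$ be a field of characteristic $0$ and $(X,\mathcal O)$ a ringed space whose structure sheaf is a sheaf of commutative $K$-algebras. A Lie algebroid $\mathcal L$ over $(X,\mathcal O)$ is a sheaf of $\mathcal O$-modules such that each $(\mathcal O(V),\mathcal L(V))$ is a Lie--Rinehart pair over $K$ and the restriction maps are morphisms of Lie--Rinehart pairs. Let $\mathcal L$ be such a Lie algebroid, locally free of constant finite rank $r$ as an $\mathcal O$-module, and let $\nabla$ be an $\mathcal L$-connection on $\mathcal L$ (with no condition on torsion or curvature). Let $\mathcal U(\mathcal L)$ be the sheaf associated with $V\mapsto \mathcal U(\mathcal L(V),\mathcal O(V))$ (universal enveloping algebras of Lie--Rinehart pairs), considered as a left $\mathcal O$-module, with the comonoid structure determined by $\Delta(1)=1\otimes 1$, $\Delta(XD)=(X\otimes 1+1\otimes X)\Delta(D)$ for $X\in\mathcal L$, and $\varepsilon(D)=D(1)$, and with the filtration in which $F_p\,\mathcal U(\mathcal L)$ is locally the $\mathcal O$-span of the products of at most $p$ sections of $\mathcal L$. Let $\operatorname{Sym}(\mathcal L)$ be the sheaf of symmetric $\mathcal O$-algebras of $\mathcal L$, with the coproduct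 for which the sections of $\mathcal L$ are primitive, the augmentation as counit, and the filtration by degree. Let $\mathcal J(\mathcal L)=\mathcal Hom_{\mathcal O}(\mathcal U(\mathcal L),\mathcal O)$ be the sheaf of jets, with its second $\mathcal O$-module structure $(a\phi)(D)=\phi(Da)$ and the flat connection $(\nabla^{(2)}_X\phi)(D)=\phi(DX)$, and let $\widehat{\operatorname{Sym}}(\mathcal L^\vee)=\mathcal Hom_{\mathcal O}(\operatorname{Sym}(\mathcal L),\mathcal O)$ be the completed symmetric algebra of the dual $\mathcal L^\vee$, paired with $\operatorname{Sym}(\mathcal L)$ by evaluation $\langle\ ,\ \rangle$. Extend $\nabla$ to derivations $\nabla_X$ of $\operatorname{Sym}(\mathcal L)$ over the action of $X$ on $\mathcal O$. On the completed tensor product over the second module structure $\mathcal J(\mathcal L)\,\widehat\otimes\,\widehat{\operatorname{Sym}}(\mathcal L^\vee)=\mathcal Hom_{\mathcal O}(\operatorname{Sym}(\mathcal L),\mathcal J(\mathcal L))$ consider the symmetrized connection \[ (D\beta)(X_1\cdots X_n)=\sum_{i=1}^n\Big(\nabla^{(2)}_{X_i}\big(\beta(X_1\cdots\widehat{X_i}\cdots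 X_n)\big)-\beta\big(\nabla_{X_i}(X_1\cdots\widehat{X_i}\cdots X_n)\big)\Big), \] and define $j_\nabla:\mathcal J(\mathcal L)\to\widehat{\operatorname{Sym}}(\mathcal L^\vee)$ by \[ j_\nabla(\phi)=\sum_{n\ge 0}\frac{1}{n!}\,\mathrm{ev}_1\big(D^n(\phi\otimes 1)\big), \] where $\mathrm{ev}_1$ is evaluation of jets at $1\in\mathcal U(\mathcal L)$ (the sum is finite on each element of a symmetric algebra $\operatorname{Sym}_{\mathcal O(V)}(\mathcal L(V))$). Then there is exactly one morphism of $\mathcal O$-modules $j_\nabla^*:\operatorname{Sym}(\mathcal L)\to\mathcal U(\mathcal L)$ such that \[ \phi(j_\nabla^*(\alpha))=\langle\alpha,j_\nabla(\phi)\rangle \] for all local sections $\alpha$ of $\operatorname{Sym}(\mathcal L)$ and $\phi$ of $\mathcal J(\mathcal L)$. It is an isomorphism of filtered comonoids in the category of $\mathcal O$-modules: it is an isomorphism of $\mathcal O$-modules, it is compatible with the coproducts and the counits, and both it and its inverse preserve the filtrations. The map it induces on graded quotients is the symmetrization map: for all $p\ge 0$ and all sections $X_1,\dots,X_p$ of $\mathcal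 L$ over an open set $V$, \[ j_\nabla^*(X_1\cdots X_p)\equiv\frac1{p!}\sum_{\sigma\in S_p}X_{\sigma(1)}\cdots X_{\sigma(p)}\quad\text{in } F_p\,\mathcal U(\mathcal L)(V)/F_{p-1}\,\mathcal U(\mathcal L)(V),\qquad F_{-1}=0. \] -/

import Mathlib

open CategoryTheory TopologicalSpace AlgebraicGeometry
open scoped TensorProduct

universe u

set_option linter.unusedSectionVars false

noncomputable section

namespace LieRinehart

section Algebra

variable (K A L : Type u) [CommRing K] [CommRing A] [Algebra K A] [LieRing L] [LieAlgebra K L]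
  [Module A L] [LieRingModule L A] [LieRinehartRing A L] [LieRinehartAlgebra K A L]

/-- The defining relations of the universal enveloping algebra of the Lie--Rinehart pair `(A, L)`,
imposed on the free `K`-algebra on the symbols `i(a)`, `a ∈ A`, and `i(X)`, `X ∈ L`. -/
inductive EnvRel : FreeAlgebra K (A ⊕ L) → FreeAlgebra K (A ⊕ L) → Prop
  | algebraMap (c : K) :
      EnvRel (FreeAlgebra.ι K (Sum.inl (algebraMap K A c))) (algebraMap K _ c)
  | add_left (a b : A) : EnvRel (FreeAlgebra.ι K (Sum.inl (a + b)))
      (FreeAlgebra.ι K (Sum.inl a) + FreeAlgebra.ι K (Sum.inl b))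
  | mul_left (a b : A) : EnvRel (FreeAlgebra.ι K (Sum.inl (a * b)))
      (FreeAlgebra.ι K (Sum.inl a) * FreeAlgebra.ι K (Sum.inl b))
  | add_right (x y : L) : EnvRel (FreeAlgebra.ι K (Sum.inr (x + y)))
      (FreeAlgebra.ι K (Sum.inr x) + FreeAlgebra.ι K (Sum.inr y))
  | lie (x y : L) : EnvRel
      (FreeAlgebra.ι K (Sum.inr ⁅x, y⁆) + FreeAlgebra.ι K (Sum.inr y) * FreeAlgebra.ι K (Sum.inr x))
      (FreeAlgebra.ι K (Sum.inr x) * FreeAlgebra.ι K (Sum.inr y))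
  | smul (a : A) (x : L) : EnvRel (FreeAlgebra.ι K (Sum.inr (a • x)))
      (FreeAlgebra.ι K (Sum.inl a) * FreeAlgebra.ι K (Sum.inr x))
  | anchor (a : A) (x : L) : EnvRel
      (FreeAlgebra.ι K (Sum.inl ⁅x, a⁆) + FreeAlgebra.ι K (Sum.inl a) * FreeAlgebra.ι K (Sum.inr x))
      (FreeAlgebra.ι K (Sum.inr x) * FreeAlgebra.ι K (Sum.inl a))

/-- The universal enveloping algebra `U(L, A)` of the Lie--Rinehart pair `(A, L)`. -/
def Env : Type u := RingQuot (EnvRel K A L)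

instance : Ring (Env K A L) := inferInstanceAs (Ring (RingQuot (EnvRel K A L)))

instance : Algebra K (Env K A L) := inferInstanceAs (Algebra K (RingQuot (EnvRel K A L)))

namespace Env

/-- The quotient map from the free algebra. -/
def mk : FreeAlgebra K (A ⊕ L) →ₐ[K] Env K A L := RingQuot.mkAlgHom K (EnvRel K A L)

variable {K A L} in
theorem mk_rel {s t : FreeAlgebra K (A ⊕ L)} (h : EnvRel K A L s t) : mk K A L s = mk K A L t :=
  RingQuot.mkAlgHom_rel K h

/-- The canonical map `i_A : A → U(L, A)`. -/
def ofA : A →ₐ[K] Env K A L where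
  toFun a := mk K A L (FreeAlgebra.ι K (Sum.inl a))
  map_one' := by
    have := mk_rel (EnvRel.algebraMap (K := K) (A := A) (L := L) 1)
    rwa [map_one, map_one, map_one] at this
  map_mul' a b := by
    rw [← map_mul]; exact mk_rel (EnvRel.mul_left a b)
  map_zero' := by
    have := mk_rel (EnvRel.algebraMap (K := K) (A := A) (L := L) 0)
    rwa [map_zero, map_zero, map_zero] at this
  map_add' a b := by
    rw [← map_add]; exact mk_rel (EnvRel.add_left a b)
  commutes' c := by
    rw [mk_rel (EnvRel.algebraMap (K := K) (A := A) (L := L) c)]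
    exact AlgHom.commutes _ c

/-- The canonical map `i_L : L → U(L, A)`. -/
def ofL : L →+ Env K A L :=
  AddMonoidHom.mk' (fun x ↦ mk K A L (FreeAlgebra.ι K (Sum.inr x)))
    (fun x y ↦ by rw [← map_add]; exact mk_rel (EnvRel.add_right x y))

variable {K A L}

theorem ofL_lie (x y : L) :
    ofL K A L ⁅x, y⁆ = ofL K A L x * ofL K A L y - ofL K A L y * ofL K A L x := by
  have := mk_rel (EnvRel.lie (K := K) (A := A) x y)
  rw [map_add, map_mul, map_mul] at this
  exact eq_sub_of_add_eq this

theorem ofL_smul (a : A) (x : L) : ofL K A L (a • x) = ofA K A L a * ofL K A L x := by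
  have := mk_rel (EnvRel.smul (K := K) a x)
  rwa [map_mul] at this

theorem ofL_mul_ofA (x : L) (a : A) :
    ofL K A L x * ofA K A L a = ofA K A L ⁅x, a⁆ + ofA K A L a * ofL K A L x := by
  have := mk_rel (EnvRel.anchor (K := K) a x)
  rw [map_add, map_mul, map_mul] at this
  exact this.symm

variable {B : Type*} [Ring B] [Algebra K B]

/-- The universal property of `U(L, A)`: existence. -/
def lift (f : A →ₐ[K] B) (g : L →+ B) (hlie : ∀ x y, g ⁅x, y⁆ = g x * g y - g y * g x)
    (hsmul : ∀ (a : A) (x : L), g (a • x) = f a * g x)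
    (hanchor : ∀ (a : A) (x : L), g x * f a = f ⁅x, a⁆ + f a * g x) : Env K A L →ₐ[K] B :=
  RingQuot.liftAlgHom K ⟨FreeAlgebra.lift K (Sum.elim f g), by
    intro p q h
    induction h <;> simp [hlie, hsmul, hanchor]⟩

section
variable (f : A →ₐ[K] B) (g : L →+ B) (hlie : ∀ x y, g ⁅x, y⁆ = g x * g y - g y * g x)
    (hsmul : ∀ (a : A) (x : L), g (a • x) = f a * g x)
    (hanchor : ∀ (a : A) (x : L), g x * f a = f ⁅x, a⁆ + f a * g x)

@[simp] theorem lift_ofA (a : A) : lift f g hlie hsmul hanchor (ofA K A L a) = f a := by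
  change RingQuot.liftAlgHom K _ (RingQuot.mkAlgHom K (EnvRel K A L) _) = _
  rw [RingQuot.liftAlgHom_mkAlgHom_apply]; simp

@[simp] theorem lift_ofL (x : L) : lift f g hlie hsmul hanchor (ofL K A L x) = g x := by
  change RingQuot.liftAlgHom K _ (RingQuot.mkAlgHom K (EnvRel K A L) _) = _
  rw [RingQuot.liftAlgHom_mkAlgHom_apply]; simp
end

/-- The universal property of `U(L, A)`: uniqueness. -/
theorem algHom_ext {f g : Env K A L →ₐ[K] B} (hA : ∀ a, f (ofA K A L a) = g (ofA K A L a))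
    (hL : ∀ x, f (ofL K A L x) = g (ofL K A L x)) : f = g := by
  apply RingQuot.ringQuot_ext'
  apply FreeAlgebra.hom_ext
  funext s
  rcases s with a | x
  · exact hA a
  · exact hL x

instance : Module A (Env K A L) := Module.compHom _ (ofA K A L).toRingHom

theorem smul_def (a : A) (D : Env K A L) : a • D = ofA K A L a * D := rfl

instance : IsScalarTower K A (Env K A L) where
  smul_assoc c a D := by
    rw [smul_def, smul_def, map_smul, smul_mul_assoc]

instance : SMulCommClass A K (Env K A L) where
  smul_comm a c D := by rw [smul_def, smul_def, mul_smul_comm]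

instance : IsScalarTower A (Env K A L) (Env K A L) where
  smul_assoc a D E := by simp only [smul_def, smul_eq_mul, mul_assoc]

/-- `U(L, A)` is generated by `A` and `L` acting from the left on `1`. -/
theorem induction_left {p : Env K A L → Prop} (one : p 1) (add : ∀ D E, p D → p E → p (D + E))
    (smul : ∀ (a : A) D, p D → p (a • D)) (mul : ∀ (x : L) D, p D → p (ofL K A L x * D))
    (D : Env K A L) : p D := by
  obtain ⟨t, rfl⟩ := RingQuot.mkAlgHom_surjective K (EnvRel K A L) D
  change p (mk K A L t)
  suffices H : ∀ (E : Env K A L), p E → p (mk K A L t * E) by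
    simpa using H 1 one
  induction t using FreeAlgebra.induction with
  | grade0 c =>
    intro E hE
    have := smul (algebraMap K A c) E hE
    rw [smul_def, AlgHom.commutes] at this
    rwa [AlgHom.commutes]
  | grade1 s =>
    rcases s with a | x
    · exact fun E hE ↦ smul a E hE
    · exact fun E hE ↦ mul x E hE
  | mul s t hs ht => intro E hE; rw [map_mul, mul_assoc]; exact hs _ (ht _ hE)
  | add s t hs ht => intro E hE; rw [map_add, add_mul]; exact add _ _ (hs _ hE) (ht _ hE)

/-- The left action of `U(L, A)` on `A`: `A` acts by multiplication and `L` via the anchor. -/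
def act : Env K A L →ₐ[K] Module.End K A :=
  lift (Algebra.lmul K A) (LieModule.toEnd K L A : L →+ Module.End K A)
    (fun x y ↦ by ext b; simp)
    (fun a x ↦ by ext b; simp)
    (fun a x ↦ by
      ext b
      simp [add_comm])

@[simp] theorem act_ofA (a b : A) : act (ofA K A L a) b = a * b := by simp [act]

@[simp] theorem act_ofL (x : L) (b : A) : act (ofL K A L x) b = ⁅x, b⁆ := by simp [act]

/-- The counit `ε(D) = D(1)`. -/
def counit : Env K A L →ₗ[A] A where
  toFun D := act D 1
  map_add' D E := by simp
  map_smul' a D := by simp [smul_def]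

section Tensor

variable {M N : Type*} [AddCommGroup M] [Module K M] [Module A M] [IsScalarTower K A M]
  [AddCommGroup N] [Module K N] [Module A N] [IsScalarTower K A N]

/-- The operator `f ⊗ 1 + 1 ⊗ g` on `M ⊗[A] N`, for operators `f` on `M` and `g` on `N` that satisfy
the Leibniz identity with respect to the same `x ∈ L`. -/
def tensorOp (x : L) (f : M →ₗ[K] M) (g : N →ₗ[K] N)
    (hf : ∀ (a : A) m, f (a • m) = a • f m + ⁅x, a⁆ • m)
    (hg : ∀ (a : A) n, g (a • n) = a • g n + ⁅x, a⁆ • n) : M ⊗[A] N →ₗ[K] M ⊗[A] N where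
  toFun := TensorProduct.liftAddHom
    (AddMonoidHom.mk' (fun m ↦ AddMonoidHom.mk' (fun n ↦ f m ⊗ₜ[A] n + m ⊗ₜ[A] g n) (fun n n' ↦ by
        simp only [map_add, TensorProduct.tmul_add]; abel)) (fun m m' ↦ by
        ext n
        simp only [map_add, TensorProduct.add_tmul, AddMonoidHom.mk'_apply, AddMonoidHom.add_apply]
        abel))
    (fun a m n ↦ by
      simp only [AddMonoidHom.mk'_apply, hf, hg, TensorProduct.add_tmul, TensorProduct.tmul_add,
        TensorProduct.smul_tmul]
      abel)
  map_add' s t := map_add _ s t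
  map_smul' c t := by
    induction t with
    | zero => simp
    | tmul m n =>
      simp [TensorProduct.smul_tmul', TensorProduct.liftAddHom_tmul, smul_add]
    | add s t hs ht => simp only [smul_add, map_add, hs, ht]

@[simp] theorem tensorOp_tmul (x : L) (f : M →ₗ[K] M) (g : N →ₗ[K] N)
    (hf : ∀ (a : A) m, f (a • m) = a • f m + ⁅x, a⁆ • m)
    (hg : ∀ (a : A) n, g (a • n) = a • g n + ⁅x, a⁆ • n) (m : M) (n : N) :
    tensorOp x f g hf hg (m ⊗ₜ n) = f m ⊗ₜ n + m ⊗ₜ g n := rfl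

end Tensor

/-- Left multiplication by `x ∈ L` on `U(L, A)`. -/
def mulL (x : L) : Env K A L →ₗ[K] Env K A L := LinearMap.mulLeft K (ofL K A L x)

@[simp] theorem mulL_apply (x : L) (D : Env K A L) : mulL x D = ofL K A L x * D := rfl

theorem mulL_smul (x : L) (a : A) (D : Env K A L) :
    mulL x (a • D) = a • mulL x D + ⁅x, a⁆ • D := by
  simp only [mulL_apply, smul_def, ← mul_assoc, ofL_mul_ofA, add_mul]
  exact add_comm _ _

/-- `x ∈ L` acts on `U(L, A) ⊗ U(L, A)` by `x ⊗ 1 + 1 ⊗ x`. -/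
def mulL₂ (x : L) : Env K A L ⊗[A] Env K A L →ₗ[K] Env K A L ⊗[A] Env K A L :=
  tensorOp x (mulL x) (mulL x) (mulL_smul x) (mulL_smul x)

@[simp] theorem mulL₂_tmul (x : L) (D E : Env K A L) :
    mulL₂ x (D ⊗ₜ[A] E) = (ofL K A L x * D) ⊗ₜ E + D ⊗ₜ (ofL K A L x * E) := rfl

theorem mulL₂_smul (x : L) (a : A) (t : Env K A L ⊗[A] Env K A L) :
    mulL₂ x (a • t) = a • mulL₂ x t + ⁅x, a⁆ • t := by
  induction t with
  | zero => simp
  | tmul D E =>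
    rw [TensorProduct.smul_tmul', mulL₂_tmul, ← mulL_apply, mulL_smul]
    simp [TensorProduct.add_tmul, TensorProduct.smul_tmul']
    abel
  | add s t hs ht => simp only [smul_add, map_add, hs, ht]; abel

theorem mulL₂_left_smul (a : A) (x : L) (t : Env K A L ⊗[A] Env K A L) :
    mulL₂ (a • x) t = a • mulL₂ x t := by
  induction t with
  | zero => simp
  | tmul D E =>
    rw [mulL₂_tmul, mulL₂_tmul, ofL_smul, mul_assoc, mul_assoc, ← smul_def, ← smul_def, smul_add,
      TensorProduct.smul_tmul', TensorProduct.tmul_smul]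
  | add s t hs ht => rw [map_add, map_add, hs, ht, smul_add]

/-- The left action of `U(L, A)` on `U(L, A) ⊗ U(L, A)`. -/
def act₂ : Env K A L →ₐ[K] Module.End K (Env K A L ⊗[A] Env K A L) :=
  lift (Algebra.lsmul K K (Env K A L ⊗[A] Env K A L))
    (AddMonoidHom.mk' mulL₂ (fun x y ↦ by
      ext t
      induction t with
      | zero => simp
      | tmul D E => simp [add_mul, TensorProduct.add_tmul, TensorProduct.tmul_add]; abel
      | add s t hs ht => rw [map_add, map_add, hs, ht]))
    (fun x y ↦ by
      ext t
      induction t with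
      | zero => simp
      | tmul D E =>
        simp [ofL_lie, sub_mul, TensorProduct.sub_tmul, TensorProduct.tmul_sub, mul_assoc]
        abel
      | add s t hs ht => rw [map_add, map_add, hs, ht])
    (fun a x ↦ LinearMap.ext fun t ↦ by simpa using mulL₂_left_smul a x t)
    (fun a x ↦ LinearMap.ext fun t ↦ by simpa [add_comm] using mulL₂_smul x a t)

/-- The coproduct `Δ(D) = D · (1 ⊗ 1)`. -/
def comul : Env K A L →ₗ[A] Env K A L ⊗[A] Env K A L where
  toFun D := act₂ D (1 ⊗ₜ 1)
  map_add' D E := by simp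
  map_smul' a D := by simp [smul_def, act₂]

theorem comul_one : comul (1 : Env K A L) = 1 ⊗ₜ 1 := by
  change act₂ (1 : Env K A L) _ = _
  rw [map_one]; rfl

theorem comul_ofL_mul (x : L) (D : Env K A L) : comul (ofL K A L x * D) = mulL₂ x (comul D) := by
  simp [comul, act₂]

theorem counit_one : counit (1 : Env K A L) = 1 := by simp [counit]

theorem counit_ofL_mul (x : L) (D : Env K A L) : counit (ofL K A L x * D) = ⁅x, counit D⁆ := by
  simp [counit]

instance : Coalgebra A (Env K A L) where
  comul := comul
  counit := counit
  coassoc := by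
    have h₁ (x : L) (t : Env K A L ⊗[A] Env K A L) : comul.rTensor (Env K A L) (mulL₂ x t) =
        tensorOp x (mulL₂ x) (mulL x) (mulL₂_smul x) (mulL_smul x)
          (comul.rTensor (Env K A L) t) := by
      induction t with
      | zero => simp
      | tmul D E => simp [comul_ofL_mul]
      | add s t hs ht => simp only [map_add, hs, ht]
    have h₂ (x : L) (t : Env K A L ⊗[A] Env K A L) : comul.lTensor (Env K A L) (mulL₂ x t) =
        tensorOp x (mulL x) (mulL₂ x) (mulL_smul x) (mulL₂_smul x)
          (comul.lTensor (Env K A L) t) := by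
      induction t with
      | zero => simp
      | tmul D E => simp [comul_ofL_mul]
      | add s t hs ht => simp only [map_add, hs, ht]
    have h₃ (x : L) (t : (Env K A L ⊗[A] Env K A L) ⊗[A] Env K A L) :
        TensorProduct.assoc A _ _ _
          (tensorOp x (mulL₂ x) (mulL x) (mulL₂_smul x) (mulL_smul x) t) =
        tensorOp x (mulL x) (mulL₂ x) (mulL_smul x) (mulL₂_smul x)
          (TensorProduct.assoc A _ _ _ t) := by
      induction t with
      | zero => simp
      | tmul s F =>
        induction s with
        | zero => simp
        | tmul D E => simp [TensorProduct.add_tmul, TensorProduct.tmul_add, add_assoc]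
        | add s t hs ht => simp only [map_add, TensorProduct.add_tmul, hs, ht]
      | add s t hs ht => simp only [map_add, hs, ht]
    ext D
    simp only [LinearMap.comp_apply, LinearEquiv.coe_coe]
    induction D using induction_left with
    | one => simp [comul_one]
    | add D E hD hE => simp only [map_add, hD, hE]
    | smul a D hD => simp only [map_smul, hD]
    | mul x D hD => rw [comul_ofL_mul, h₁, h₂, h₃, hD]
  rTensor_counit_comp_comul := by
    have h (x : L) (t : Env K A L ⊗[A] Env K A L) :
        TensorProduct.lid A _ (counit.rTensor (Env K A L) (mulL₂ x t)) =
        ofL K A L x * TensorProduct.lid A _ (counit.rTensor (Env K A L) t) := by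
      induction t with
      | zero => simp
      | tmul D E =>
        simp only [mulL₂_tmul, map_add, LinearMap.rTensor_tmul, TensorProduct.lid_tmul,
          counit_ofL_mul]
        rw [← mulL_apply x (_ • E), mulL_smul, mulL_apply]
        exact add_comm _ _
      | add s t hs ht => simp only [map_add, hs, ht, mul_add]
    ext D
    apply (TensorProduct.lid A _).injective
    simp only [LinearMap.comp_apply, TensorProduct.mk_apply, TensorProduct.lid_tmul, one_smul]
    induction D using induction_left with
    | one => simp [comul_one, counit_one]
    | add D E hD hE => simp only [map_add, hD, hE]
    | smul a D hD => simp only [map_smul, hD]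
    | mul x D hD => rw [comul_ofL_mul, h, hD]
  lTensor_counit_comp_comul := by
    have h (x : L) (t : Env K A L ⊗[A] Env K A L) :
        TensorProduct.rid A _ (counit.lTensor (Env K A L) (mulL₂ x t)) =
        ofL K A L x * TensorProduct.rid A _ (counit.lTensor (Env K A L) t) := by
      induction t with
      | zero => simp
      | tmul D E =>
        simp only [mulL₂_tmul, map_add, LinearMap.lTensor_tmul, TensorProduct.rid_tmul,
          counit_ofL_mul]
        rw [← mulL_apply x (_ • D), mulL_smul, mulL_apply]
      | add s t hs ht => simp only [map_add, hs, ht, mul_add]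
    ext D
    apply (TensorProduct.rid A _).injective
    simp only [LinearMap.comp_apply, LinearMap.flip_apply, TensorProduct.mk_apply,
      TensorProduct.rid_tmul, one_smul]
    induction D using induction_left with
    | one => simp [comul_one, counit_one]
    | add D E hD hE => simp only [map_add, hD, hE]
    | smul a D hD => simp only [map_smul, hD]
    | mul x D hD => rw [comul_ofL_mul, h, hD]

end Env

end Algebra

section Functoriality

variable {K A L A' L' : Type u} [CommRing K]
  [CommRing A] [Algebra K A] [LieRing L] [LieAlgebra K L]
  [Module A L] [LieRingModule L A] [LieRinehartRing A L] [LieRinehartAlgebra K A L]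
  [CommRing A'] [Algebra K A'] [LieRing L'] [LieAlgebra K L']
  [Module A' L'] [LieRingModule L' A'] [LieRinehartRing A' L'] [LieRinehartAlgebra K A' L']
  (σ : A →ₐ[K] A') (F : LieRinehartAlgebra.Hom σ L L')

/-- The map `U(L, A) → U(L', A')` induced by a morphism of Lie--Rinehart pairs. -/
def Env.map : Env K A L →ₐ[K] Env K A' L' :=
  Env.lift ((Env.ofA K A' L').comp σ) ((Env.ofL K A' L').comp F.toLieHom.toLinearMap.toAddMonoidHom)
    (fun x y ↦ by
      change Env.ofL K A' L' (F.toLieHom ⁅x, y⁆) = _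
      rw [LieHom.map_lie, Env.ofL_lie]; rfl)
    (fun a x ↦ by
      change Env.ofL K A' L' (F (a • x)) = _
      rw [F.map_smul_apply, Env.ofL_smul]; rfl)
    (fun a x ↦ by
      change Env.ofL K A' L' (F x) * Env.ofA K A' L' (σ a) = Env.ofA K A' L' (σ ⁅x, a⁆) + _
      rw [F.apply_lie, Env.ofL_mul_ofA]; rfl)

@[simp] theorem Env.map_ofA (a : A) :
    Env.map σ F (Env.ofA K A L a) = Env.ofA K A' L' (σ a) := by simp [Env.map]

@[simp] theorem Env.map_ofL (x : L) :
    Env.map σ F (Env.ofL K A L x) = Env.ofL K A' L' (F x) := by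
  rw [Env.map, Env.lift_ofL]; rfl

theorem Env.map_smul (a : A) (D : Env K A L) : Env.map σ F (a • D) = σ a • Env.map σ F D := by
  simp [Env.smul_def]

theorem Env.map_comul (T : Env K A L ⊗[A] Env K A L →+ Env K A' L' ⊗[A'] Env K A' L')
    (hT : ∀ D E, T (D ⊗ₜ E) = Env.map σ F D ⊗ₜ Env.map σ F E) (D : Env K A L) :
    T (Coalgebra.comul (R := A) D) = Coalgebra.comul (R := A') (Env.map σ F D) := by
  change T (Env.comul D) = Env.comul (Env.map σ F D)
  have h₁ (a : A) (t : Env K A L ⊗[A] Env K A L) : T (a • t) = σ a • T t := by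
    induction t with
    | zero => simp
    | tmul D E => rw [TensorProduct.smul_tmul', hT, hT, Env.map_smul, TensorProduct.smul_tmul']
    | add s t hs ht => simp only [smul_add, map_add, hs, ht]
  have h₂ (x : L) (t : Env K A L ⊗[A] Env K A L) :
      T (Env.mulL₂ x t) = Env.mulL₂ (F x) (T t) := by
    induction t with
    | zero => simp
    | tmul D E => simp [hT]
    | add s t hs ht => simp only [map_add, hs, ht]
  induction D using Env.induction_left with
  | one => rw [Env.comul_one, hT, map_one, Env.comul_one]
  | add D E hD hE => simp only [map_add, hD, hE]
  | smul a D hD => rw [_root_.map_smul, h₁, hD, Env.map_smul, _root_.map_smul]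
  | mul x D hD => rw [Env.comul_ofL_mul, h₂, hD, map_mul, Env.map_ofL, Env.comul_ofL_mul]

theorem Env.map_counit (D : Env K A L) :
    Coalgebra.counit (R := A') (Env.map σ F D) = σ (Coalgebra.counit (R := A) D) := by
  change Env.counit (Env.map σ F D) = σ (Env.counit D)
  induction D using Env.induction_left with
  | one => rw [map_one, Env.counit_one, Env.counit_one, map_one]
  | add D E hD hE => simp only [map_add, hD, hE]
  | smul a D hD => rw [Env.map_smul, _root_.map_smul, _root_.map_smul, hD, smul_eq_mul, smul_eq_mul,
      map_mul]
  | mul x D hD => rw [map_mul, Env.map_ofL, Env.counit_ofL_mul, hD, Env.counit_ofL_mul, F.apply_lie]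

/-- The map `Sym_A(L) → Sym_{A'}(L')` induced by a morphism of Lie--Rinehart pairs. -/
def symMap : SymmetricAlgebra A L →+* SymmetricAlgebra A' L' :=
  letI : Algebra A (SymmetricAlgebra A' L') :=
    ((algebraMap A' (SymmetricAlgebra A' L')).comp σ.toRingHom).toAlgebra
  (SymmetricAlgebra.lift (R := A) (A := SymmetricAlgebra A' L')
    { toFun := fun x ↦ SymmetricAlgebra.ι A' L' (F x)
      map_add' := fun x y ↦ by rw [← map_add]; exact congrArg _ (map_add F.toLieHom x y)
      map_smul' := fun a x ↦ by
        rw [F.map_smul_apply, map_smul, Algebra.smul_def]; exact (Algebra.smul_def _ _).symm }).toRingHom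

@[simp] theorem symMap_algebraMap (a : A) :
    symMap σ F (algebraMap A _ a) = algebraMap A' _ (σ a) := by
  let : Algebra A (SymmetricAlgebra A' L') :=
    ((algebraMap A' (SymmetricAlgebra A' L')).comp σ.toRingHom).toAlgebra
  exact AlgHom.commutes _ a

@[simp] theorem symMap_ι (x : L) :
    symMap σ F (SymmetricAlgebra.ι A L x) = SymmetricAlgebra.ι A' L' (F x) := by
  let : Algebra A (SymmetricAlgebra A' L') :=
    ((algebraMap A' (SymmetricAlgebra A' L')).comp σ.toRingHom).toAlgebra
  exact SymmetricAlgebra.lift_ι_apply _ x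

theorem symMap_smul (a : A) (s : SymmetricAlgebra A L) : symMap σ F (a • s) = σ a • symMap σ F s := by
  rw [Algebra.smul_def, map_mul, symMap_algebraMap, ← Algebra.smul_def]

theorem symMap_comul
    (T : SymmetricAlgebra A L ⊗[A] SymmetricAlgebra A L →+
      SymmetricAlgebra A' L' ⊗[A'] SymmetricAlgebra A' L')
    (hT : ∀ s t, T (s ⊗ₜ t) = symMap σ F s ⊗ₜ symMap σ F t) (s : SymmetricAlgebra A L) :
    T (Coalgebra.comul (R := A) s) = Coalgebra.comul (R := A') (symMap σ F s) := by
  have h₁ (a : A) (t : SymmetricAlgebra A L ⊗[A] SymmetricAlgebra A L) : T (a • t) = σ a • T t := by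
    induction t with
    | zero => simp
    | tmul D E => rw [TensorProduct.smul_tmul', hT, hT, symMap_smul, TensorProduct.smul_tmul']
    | add s t hs ht => simp only [smul_add, map_add, hs, ht]
  have h₂ (s t : SymmetricAlgebra A L ⊗[A] SymmetricAlgebra A L) : T (s * t) = T s * T t := by
    induction s with
    | zero => simp
    | add s s' hs hs' => simp only [add_mul, map_add, hs, hs']
    | tmul a b =>
      induction t with
      | zero => simp
      | add s s' hs hs' => simp only [mul_add, map_add, hs, hs']
      | tmul c d => simp [hT]
  induction s using SymmetricAlgebra.induction with
  | algebraMap r =>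
    have h : T 1 = 1 := by rw [Algebra.TensorProduct.one_def, hT, map_one]; rfl
    rw [Algebra.algebraMap_eq_smul_one, map_smul, Bialgebra.comul_one, h₁, h, symMap_smul,
      (symMap σ F).map_one, map_smul, Bialgebra.comul_one]
  | ι x => simp [hT]
  | mul s t hs ht => rw [Bialgebra.comul_mul, h₂, hs, ht, map_mul, Bialgebra.comul_mul]
  | add s t hs ht => simp only [map_add, hs, ht]

theorem symMap_counit (s : SymmetricAlgebra A L) :
    Coalgebra.counit (R := A') (symMap σ F s) = σ (Coalgebra.counit (R := A) s) := by
  induction s using SymmetricAlgebra.induction with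
  | algebraMap r => simp
  | ι x => simp
  | mul s t hs ht => simp [hs, ht]
  | add s t hs ht => simp only [map_add, hs, ht]

end Functoriality

section Sym

variable (A L : Type u) [CommRing A] [AddCommGroup L] [Module A L]

/-- The projection `Sym_A(L) → L` onto the component of degree one. -/
def symProj : SymmetricAlgebra A L →ₗ[A] L :=
  letI : Module Aᵐᵒᵖ L := Module.compHom L ((RingHom.id A).fromOpposite mul_comm)
  haveI : IsCentralScalar A L := ⟨fun _ _ ↦ rfl⟩
  TrivSqZeroExt.sndHom A L ∘ₗ
    (SymmetricAlgebra.lift (A := TrivSqZeroExt A L) (TrivSqZeroExt.inrHom A L)).toLinearMap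

theorem symProj_ι (x : L) : symProj A L (SymmetricAlgebra.ι A L x) = x := by
  simp [symProj]

theorem symProj_mul (s t : SymmetricAlgebra A L) : symProj A L (s * t) =
    Coalgebra.counit (R := A) s • symProj A L t + Coalgebra.counit (R := A) t • symProj A L s := by
  let : Module Aᵐᵒᵖ L := Module.compHom L ((RingHom.id A).fromOpposite mul_comm)
  have : IsCentralScalar A L := ⟨fun _ _ ↦ rfl⟩
  have h : (TrivSqZeroExt.fstHom A A L).comp (SymmetricAlgebra.lift (A := TrivSqZeroExt A L)
      (TrivSqZeroExt.inrHom A L)) = Bialgebra.counitAlgHom A (SymmetricAlgebra A L) := by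
    ext x
    simpa using (SymmetricAlgebra.algebraMapInv_ι x).symm
  have h' (s : SymmetricAlgebra A L) : TrivSqZeroExt.fst (SymmetricAlgebra.lift
      (A := TrivSqZeroExt A L) (TrivSqZeroExt.inrHom A L) s) = Coalgebra.counit (R := A) s :=
    DFunLike.congr_fun h s
  simp [symProj, h']

theorem symProj_one : symProj A L 1 = 0 := by
  simpa using symProj_mul A L 1 1

/-- The map `δ : Sym_A(L) → L ⊗ Sym_A(L)`, `X₁ ⋯ Xₙ ↦ ∑ᵢ Xᵢ ⊗ X₁ ⋯ X̂ᵢ ⋯ Xₙ` (the factor `Xᵢ` is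
omitted): the component of the coproduct whose first factor has degree one. -/
def symDelta : SymmetricAlgebra A L →ₗ[A] L ⊗[A] SymmetricAlgebra A L :=
  (symProj A L).rTensor (SymmetricAlgebra A L) ∘ₗ Coalgebra.comul

theorem symDelta_one : symDelta A L 1 = 0 := by
  simp [symDelta, Algebra.TensorProduct.one_def, symProj_one]

theorem symDelta_ι (x : L) : symDelta A L (SymmetricAlgebra.ι A L x) = x ⊗ₜ 1 := by
  simp [symDelta, symProj_one, symProj_ι]

theorem symDelta_mul (s t : SymmetricAlgebra A L) : symDelta A L (s * t) =
    (LinearMap.mulLeft A s).lTensor L (symDelta A L t) +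
    (LinearMap.mulLeft A t).lTensor L (symDelta A L s) := by
  have h (u v : SymmetricAlgebra A L ⊗[A] SymmetricAlgebra A L) :
      (symProj A L).rTensor (SymmetricAlgebra A L) (u * v) =
      (LinearMap.mulLeft A (TensorProduct.lid A _ (Coalgebra.counit.rTensor _ u))).lTensor L
        ((symProj A L).rTensor (SymmetricAlgebra A L) v) +
      (LinearMap.mulLeft A (TensorProduct.lid A _ (Coalgebra.counit.rTensor _ v))).lTensor L
        ((symProj A L).rTensor (SymmetricAlgebra A L) u) := by
    induction u with
    | zero => simp
    | add u u' hu hu' =>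
      have e (p q : SymmetricAlgebra A L) : LinearMap.mulLeft A (p + q) =
        LinearMap.mulLeft A p + LinearMap.mulLeft A q := by ext; simp [add_mul]
      simp only [add_mul, map_add, hu, hu', e, LinearMap.lTensor_add, LinearMap.add_apply]; abel
    | tmul a b =>
      induction v with
      | zero => simp
      | add u u' hu hu' =>
        have e (p q : SymmetricAlgebra A L) : LinearMap.mulLeft A (p + q) =
          LinearMap.mulLeft A p + LinearMap.mulLeft A q := by ext; simp [add_mul]
        simp only [mul_add, map_add, hu, hu', e, LinearMap.lTensor_add, LinearMap.add_apply]; abel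
      | tmul c d =>
        simp [symProj_mul, TensorProduct.add_tmul, TensorProduct.smul_tmul, mul_comm d b]
  have h' (s : SymmetricAlgebra A L) : TensorProduct.lid A _
      (Coalgebra.counit.rTensor (SymmetricAlgebra A L) (Coalgebra.comul (R := A) s)) = s := by
    rw [Coalgebra.rTensor_counit_comul]; simp
  simp only [symDelta, LinearMap.comp_apply, Bialgebra.comul_mul, h, h']

/-- The filtration of `Sym_A(L)` by degree: `F_p` is spanned over `A` by the products of at most `p`
elements of `L`. -/
def symFilt (p : ℕ) : Submodule A (SymmetricAlgebra A L) :=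
  Submodule.span A {s | ∃ l : List L, l.length ≤ p ∧ s = (l.map (SymmetricAlgebra.ι A L)).prod}

theorem exists_mem_symFilt (s : SymmetricAlgebra A L) : ∃ p, s ∈ symFilt A L p := by
  have mono {p q : ℕ} (h : p ≤ q) : symFilt A L p ≤ symFilt A L q :=
    Submodule.span_mono fun s ⟨l, hl, e⟩ ↦ ⟨l, hl.trans h, e⟩
  induction s using SymmetricAlgebra.induction with
  | algebraMap a =>
    refine ⟨0, ?_⟩
    rw [Algebra.algebraMap_eq_smul_one]
    exact Submodule.smul_mem _ _ (Submodule.subset_span ⟨[], by simp, by simp⟩)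
  | ι x => exact ⟨1, Submodule.subset_span ⟨[x], by simp, by simp⟩⟩
  | mul s t hs ht =>
    obtain ⟨p, hp⟩ := hs
    obtain ⟨q, hq⟩ := ht
    refine ⟨p + q, ?_⟩
    have := Submodule.mul_mem_mul hp hq
    rw [symFilt, symFilt, Submodule.span_mul_span] at this
    refine Submodule.span_mono ?_ this
    rintro _ ⟨_, ⟨l, hl, rfl⟩, _, ⟨l', hl', rfl⟩, rfl⟩
    exact ⟨l ++ l', by simp; omega, by simp⟩
  | add s t hs ht =>
    obtain ⟨p, hp⟩ := hs
    obtain ⟨q, hq⟩ := ht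
    exact ⟨max p q, add_mem (mono (le_max_left _ _) hp) (mono (le_max_right _ _) hq)⟩

theorem symDelta_prod_mem (l : List L) (p : ℕ) (hl : l.length ≤ p + 1) :
    symDelta A L (l.map (SymmetricAlgebra.ι A L)).prod ∈
      Submodule.span A {t | ∃ x, ∃ s ∈ symFilt A L p, t = x ⊗ₜ[A] s} := by
  induction l generalizing p with
  | nil => simp [symDelta_one]
  | cons x l ih =>
    have hl' : l.length ≤ p := by simpa using hl
    rw [List.map_cons, List.prod_cons, symDelta_mul, symDelta_ι]
    refine add_mem ?_ ?_
    · rcases p with _ | p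
      · obtain rfl : l = [] := by simpa using hl'
        simp [symDelta_one]
      · have := Submodule.mem_map_of_mem (f := (LinearMap.mulLeft A
          (SymmetricAlgebra.ι A L x)).lTensor L) (ih p hl')
        rw [Submodule.map_span] at this
        refine Submodule.span_mono ?_ this
        rintro _ ⟨_, ⟨y, s, hs, rfl⟩, rfl⟩
        refine ⟨y, SymmetricAlgebra.ι A L x * s, ?_, by simp⟩
        have := Submodule.mem_map_of_mem (f := LinearMap.mulLeft A (SymmetricAlgebra.ι A L x)) hs
        rw [symFilt, Submodule.map_span] at this
        refine Submodule.span_mono ?_ this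
        rintro _ ⟨_, ⟨l, hl, rfl⟩, rfl⟩
        exact ⟨x :: l, by simpa using hl, by simp⟩
    · exact Submodule.subset_span ⟨x, _, Submodule.subset_span ⟨l, hl', rfl⟩, by simp⟩

end Sym

section Jets

variable (K A L : Type u) [Field K] [CommRing A] [Algebra K A] [LieRing L] [LieAlgebra K L]
  [Module A L] [LieRingModule L A] [LieRinehartRing A L] [LieRinehartAlgebra K A L]

/-- The canonical filtration of `U(L, A)`: `F_p` is spanned over `A` by the products of at most `p`
elements of `L`. -/
def Env.filt (p : ℕ) : Submodule A (Env K A L) :=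
  Submodule.span A {D | ∃ l : List L, l.length ≤ p ∧ D = (l.map (Env.ofL K A L)).prod}

/-- The jet algebra `J(L, A) = Hom_A(U(L, A), A)`, with `U(L, A)` as a left `A`-module. -/
abbrev Jet : Type u := Env K A L →ₗ[A] A

variable {K A L} in
/-- Right multiplication by `E` on `U(L, A)`. -/
def Env.mulRight (E : Env K A L) : Env K A L →ₗ[A] Env K A L := LinearMap.mulRight A E

/-- The jet algebra with its second `A`-module structure `(a φ)(D) = φ(D a)`. -/
def Jet₂ : Type u := Jet K A L

instance : AddCommGroup (Jet₂ K A L) := inferInstanceAs (AddCommGroup (Env K A L →ₗ[A] A))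

variable {K A L}

/-- The identity map from `J(L, A)` to itself, with values in the second module structure. -/
def Jet₂.of : Jet K A L ≃+ Jet₂ K A L := AddEquiv.refl _

/-- Evaluation of a jet at `D ∈ U(L, A)`. -/
def Jet₂.eval (D : Env K A L) : Jet₂ K A L →+ A :=
  AddMonoidHom.mk' (fun φ ↦ Jet₂.of.symm φ D) (fun _ _ ↦ rfl)

theorem Jet₂.ext {φ ψ : Jet₂ K A L} (h : ∀ D, Jet₂.eval D φ = Jet₂.eval D ψ) : φ = ψ :=
  LinearMap.ext h

instance : SMul A (Jet₂ K A L) :=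
  ⟨fun a φ ↦ Jet₂.of (Jet₂.of.symm φ ∘ₗ Env.mulRight (Env.ofA K A L a))⟩

theorem Jet₂.eval_smul (D : Env K A L) (a : A) (φ : Jet₂ K A L) :
    Jet₂.eval D (a • φ) = Jet₂.eval (D * Env.ofA K A L a) φ := rfl

theorem Jet₂.eval_add (D E : Env K A L) (φ : Jet₂ K A L) :
    Jet₂.eval (D + E) φ = Jet₂.eval D φ + Jet₂.eval E φ := map_add (Jet₂.of.symm φ) D E

instance : Module A (Jet₂ K A L) where
  one_smul φ := Jet₂.ext fun D ↦ by simp [Jet₂.eval_smul]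
  mul_smul a b φ := Jet₂.ext fun D ↦ by
    simp only [Jet₂.eval_smul, mul_assoc, ← map_mul]
  smul_zero a := Jet₂.ext fun D ↦ by simp [Jet₂.eval_smul]
  smul_add a φ ψ := Jet₂.ext fun D ↦ by simp [Jet₂.eval_smul]
  add_smul a b φ := Jet₂.ext fun D ↦ by simp [Jet₂.eval_smul, mul_add, Jet₂.eval_add]
  zero_smul φ := Jet₂.ext fun D ↦ by
    rw [Jet₂.eval_smul, map_zero, mul_zero]; exact map_zero (Jet₂.of.symm φ)

/-- The flat connection `(∇⁽²⁾_X φ)(D) = φ(D X)` on the jet algebra. -/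
def Jet₂.nabla (x : L) : Jet₂ K A L →+ Jet₂ K A L :=
  AddMonoidHom.mk' (fun φ ↦ Jet₂.of (Jet₂.of.symm φ ∘ₗ Env.mulRight (Env.ofL K A L x)))
    (fun _ _ ↦ rfl)

theorem Jet₂.eval_nabla (D : Env K A L) (x : L) (φ : Jet₂ K A L) :
    Jet₂.eval D (Jet₂.nabla x φ) = Jet₂.eval (D * Env.ofL K A L x) φ := rfl

theorem Jet₂.nabla_add_left (x y : L) (φ : Jet₂ K A L) :
    Jet₂.nabla (x + y) φ = Jet₂.nabla x φ + Jet₂.nabla y φ :=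
  Jet₂.ext fun D ↦ by simp [Jet₂.eval_nabla, mul_add, Jet₂.eval_add]

theorem Jet₂.nabla_smul_left (a : A) (x : L) (φ : Jet₂ K A L) :
    Jet₂.nabla (a • x) φ = a • Jet₂.nabla x φ :=
  Jet₂.ext fun D ↦ by simp [Jet₂.eval_nabla, Jet₂.eval_smul, Env.ofL_smul, mul_assoc]

theorem Jet₂.nabla_smul (x : L) (a : A) (φ : Jet₂ K A L) :
    Jet₂.nabla x (a • φ) = a • Jet₂.nabla x φ + ⁅x, a⁆ • φ :=
  Jet₂.ext fun D ↦ by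
    simp [Jet₂.eval_nabla, Jet₂.eval_smul, mul_assoc, Env.ofL_mul_ofA, mul_add, Jet₂.eval_add,
      add_comm]

variable (A L) in
/-- An `L`-connection `∇` on the `A`-module `L`. -/
structure Connection where
  /-- The covariant derivative `∇_X Y`. -/
  nabla : L → L → L
  add_left (x y z : L) : nabla (x + y) z = nabla x z + nabla y z
  smul_left (a : A) (x z : L) : nabla (a • x) z = a • nabla x z
  add_right (x y z : L) : nabla x (y + z) = nabla x y + nabla x z
  leibniz (x : L) (a : A) (z : L) : nabla x (a • z) = a • nabla x z + ⁅x, a⁆ • z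

namespace Connection

variable (C : Connection A L)

/-- The ring homomorphism `A → Sym_A(L)[ε]`, `a ↦ a + ε X(a)`. -/
def symBase (x : L) : A →+* TrivSqZeroExt (SymmetricAlgebra A L) (SymmetricAlgebra A L) where
  toFun a := TrivSqZeroExt.inl (algebraMap A _ a) + TrivSqZeroExt.inr (algebraMap A _ ⁅x, a⁆)
  map_one' := by
    have : ⁅x, (1 : A)⁆ = 0 := by simpa using LieRinehartRing.leibniz_mul_right x (1 : A) 1
    rw [this, map_one, map_zero]; simp
  map_mul' a b := by
    ext
    · simp only [TrivSqZeroExt.fst_mul, TrivSqZeroExt.fst_add, TrivSqZeroExt.fst_inl,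
        TrivSqZeroExt.fst_inr, add_zero, map_mul]
    · simp only [TrivSqZeroExt.snd_mul, TrivSqZeroExt.snd_add, TrivSqZeroExt.snd_inl,
        TrivSqZeroExt.snd_inr, TrivSqZeroExt.fst_add, TrivSqZeroExt.fst_inl,
        TrivSqZeroExt.fst_inr, add_zero, zero_add, smul_eq_mul, op_smul_eq_mul,
        LieRinehartRing.leibniz_mul_right, map_add, map_mul]
  map_zero' := by rw [lie_zero, map_zero]; simp
  map_add' a b := by
    rw [lie_add, map_add, map_add, TrivSqZeroExt.inl_add, TrivSqZeroExt.inr_add, add_add_add_comm]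

/-- The dual numbers `Sym_A(L)[ε]` as an `A`-algebra through `a ↦ a + ε X(a)`. -/
def SymDual (_x : L) : Type u := TrivSqZeroExt (SymmetricAlgebra A L) (SymmetricAlgebra A L)

instance (x : L) : CommRing (SymDual (A := A) x) :=
  inferInstanceAs (CommRing (TrivSqZeroExt (SymmetricAlgebra A L) (SymmetricAlgebra A L)))

instance (x : L) : Algebra A (SymDual (A := A) x) := RingHom.toAlgebra (symBase x)

/-- The ring homomorphism `Sym_A(L) → Sym_A(L)[ε]`, `s ↦ s + ε ∇_X s`, which encodes the extension of
`∇_X` to a derivation. -/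
def symHom (x : L) :
    SymmetricAlgebra A L →+* TrivSqZeroExt (SymmetricAlgebra A L) (SymmetricAlgebra A L) :=
  (SymmetricAlgebra.lift (R := A)
    (A := SymDual x)
    { toFun := fun y ↦ (TrivSqZeroExt.inl (SymmetricAlgebra.ι A L y) +
        TrivSqZeroExt.inr (SymmetricAlgebra.ι A L (C.nabla x y)) :
          TrivSqZeroExt (SymmetricAlgebra A L) (SymmetricAlgebra A L))
      map_add' := fun y z ↦ by
        rw [C.add_right, map_add, map_add, TrivSqZeroExt.inl_add, TrivSqZeroExt.inr_add,
          add_add_add_comm]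
        rfl
      map_smul' := fun a y ↦ by
        refine Eq.trans ?_ (Algebra.smul_def (A := SymDual x) a _).symm
        rw [C.leibniz]
        change _ = symBase x a * _
        simp only [symBase, RingHom.coe_mk, MonoidHom.coe_mk, OneHom.coe_mk]
        ext
        · simp only [TrivSqZeroExt.fst_mul, TrivSqZeroExt.fst_add, TrivSqZeroExt.fst_inl,
            TrivSqZeroExt.fst_inr, add_zero, map_smul]
          exact Algebra.smul_def _ _
        · simp only [TrivSqZeroExt.snd_mul, TrivSqZeroExt.snd_add, TrivSqZeroExt.snd_inl,
            TrivSqZeroExt.snd_inr, TrivSqZeroExt.fst_add, TrivSqZeroExt.fst_inl,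
            TrivSqZeroExt.fst_inr, add_zero, zero_add, map_add, map_smul, smul_eq_mul,
            op_smul_eq_mul]
          rw [Algebra.smul_def, Algebra.smul_def] }).toRingHom

theorem symHom_algebraMap (x : L) (a : A) : C.symHom x (algebraMap A _ a) =
    TrivSqZeroExt.inl (algebraMap A _ a) + TrivSqZeroExt.inr (algebraMap A _ ⁅x, a⁆) := by
  unfold symHom
  exact AlgHom.commutes (SymmetricAlgebra.lift (R := A) (A := SymDual x) _) a

theorem symHom_ι (x y : L) : C.symHom x (SymmetricAlgebra.ι A L y) =
    TrivSqZeroExt.inl (SymmetricAlgebra.ι A L y) +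
      TrivSqZeroExt.inr (SymmetricAlgebra.ι A L (C.nabla x y)) := by
  unfold symHom
  exact SymmetricAlgebra.lift_ι_apply (A := SymDual x) _ y

theorem fst_symHom (x : L) (s : SymmetricAlgebra A L) : (C.symHom x s).fst = s := by
  induction s using SymmetricAlgebra.induction with
  | algebraMap a => simp [symHom_algebraMap]
  | ι y => simp [symHom_ι]
  | mul s t hs ht => simp [hs, ht]
  | add s t hs ht => simp [hs, ht]

/-- The derivation `∇_X` of `Sym_A(L)` that extends the action of `X` on `A` and `∇_X` on `L`. -/
def symNabla (x : L) : SymmetricAlgebra A L →+ SymmetricAlgebra A L :=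
  AddMonoidHom.mk' (fun s ↦ (C.symHom x s).snd) (fun s t ↦ by simp)

@[simp] theorem symNabla_algebraMap (x : L) (a : A) :
    C.symNabla x (algebraMap A _ a) = algebraMap A _ ⁅x, a⁆ := by
  change (C.symHom x _).snd = _
  rw [symHom_algebraMap]
  simp only [TrivSqZeroExt.snd_add, TrivSqZeroExt.snd_inl, TrivSqZeroExt.snd_inr, zero_add]

@[simp] theorem symNabla_ι (x y : L) :
    C.symNabla x (SymmetricAlgebra.ι A L y) = SymmetricAlgebra.ι A L (C.nabla x y) := by
  simp [symNabla, symHom_ι]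

theorem symNabla_mul (x : L) (s t : SymmetricAlgebra A L) :
    C.symNabla x (s * t) = s * C.symNabla x t + t * C.symNabla x s := by
  simp [symNabla, fst_symHom, mul_comm]

theorem symNabla_smul (x : L) (a : A) (s : SymmetricAlgebra A L) :
    C.symNabla x (a • s) = a • C.symNabla x s + ⁅x, a⁆ • s := by
  rw [Algebra.smul_def, symNabla_mul, symNabla_algebraMap, ← Algebra.smul_def, Algebra.smul_def ⁅x, a⁆,
    mul_comm s]

theorem symNabla_add_left (x y : L) (s : SymmetricAlgebra A L) :
    C.symNabla (x + y) s = C.symNabla x s + C.symNabla y s := by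
  induction s using SymmetricAlgebra.induction with
  | algebraMap a => simp
  | ι z => simp [C.add_left]
  | mul s t hs ht => simp only [symNabla_mul, hs, ht]; ring
  | add s t hs ht => simp only [map_add, hs, ht]; abel

theorem symNabla_smul_left (a : A) (x : L) (s : SymmetricAlgebra A L) :
    C.symNabla (a • x) s = a • C.symNabla x s := by
  induction s using SymmetricAlgebra.induction with
  | algebraMap b => simp [Algebra.smul_def]
  | ι z => simp [C.smul_left]
  | mul s t hs ht => simp only [symNabla_mul, hs, ht, smul_add, Algebra.mul_smul_comm]
  | add s t hs ht => simp only [map_add, hs, ht, smul_add]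

theorem symNabla_mem (x : L) (p : ℕ) (s : SymmetricAlgebra A L) (hs : s ∈ symFilt A L p) :
    C.symNabla x s ∈ symFilt A L p := by
  induction hs using Submodule.span_induction with
  | mem s h =>
    obtain ⟨l, hl, rfl⟩ := h
    induction l generalizing p with
    | nil =>
      have := C.symNabla_mul x 1 1
      simp only [one_mul, left_eq_add] at this
      simp [this]
    | cons y l ih =>
      rcases p with _ | p
      · simp at hl
      rw [List.map_cons, List.prod_cons, symNabla_mul, symNabla_ι]
      refine add_mem ?_ (Submodule.subset_span ⟨C.nabla x y :: l, by simpa using hl, ?_⟩)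
      · have := Submodule.mem_map_of_mem (f := LinearMap.mulLeft A (SymmetricAlgebra.ι A L y))
          (ih p (by simpa using hl))
        rw [symFilt, Submodule.map_span] at this
        refine Submodule.span_mono ?_ this
        rintro _ ⟨_, ⟨l, hl, rfl⟩, rfl⟩
        exact ⟨y :: l, by simpa using hl, by simp⟩
      · simp [mul_comm]
  | zero => simp
  | add s t _ _ hs ht => rw [map_add]; exact add_mem hs ht
  | smul a s h hs =>
    rw [symNabla_smul]
    exact add_mem (Submodule.smul_mem _ _ hs) (Submodule.smul_mem _ _ h)

/-- The covariant derivative `∇_X β` of `β : Sym_A(L) → J(L, A)` for the tensor product connection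
`∇⁽²⁾ ⊗ 1 + 1 ⊗ ∇`, that is `(∇_X β)(s) = ∇⁽²⁾_X (β(s)) - β(∇_X s)`; it is linear in `X` and `s`. -/
def jetNabla (β : SymmetricAlgebra A L →ₗ[A] Jet₂ K A L) :
    L →ₗ[A] SymmetricAlgebra A L →ₗ[A] Jet₂ K A L :=
  LinearMap.mk₂ A (fun x s ↦ Jet₂.nabla x (β s) - β (C.symNabla x s))
    (fun x y s ↦ by rw [Jet₂.nabla_add_left, symNabla_add_left, map_add]; abel)
    (fun a x s ↦ by rw [Jet₂.nabla_smul_left, symNabla_smul_left, map_smul, smul_sub])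
    (fun x s t ↦ by simp only [map_add]; abel)
    (fun x a s ↦ by
      rw [map_smul, Jet₂.nabla_smul, symNabla_smul, map_add, map_smul, map_smul, smul_sub]; abel)

/-- The operator `D` on `J(L, A) ⊗̂ Sym(L^∨) = Hom(Sym_A(L), J(L, A))` (second module structure on
the jets): `(D β)(X₁ ⋯ Xₙ) = ∑ᵢ (∇_{Xᵢ} β)(X₁ ⋯ X̂ᵢ ⋯ Xₙ)`. -/
def symD (β : SymmetricAlgebra A L →ₗ[A] Jet₂ K A L) : SymmetricAlgebra A L →ₗ[A] Jet₂ K A L :=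
  TensorProduct.lift (C.jetNabla β) ∘ₗ symDelta A L

/-- The element `φ ⊗ 1` of `J(L, A) ⊗̂ Sym(L^∨)`. -/
def _root_.LieRinehart.Jet₂.tmulOne (φ : Jet₂ K A L) : SymmetricAlgebra A L →ₗ[A] Jet₂ K A L :=
  LinearMap.toSpanSingleton A (Jet₂ K A L) φ ∘ₗ Coalgebra.counit

theorem symD_iterate_eq_zero (φ : Jet₂ K A L) (n p : ℕ) (h : p < n) (s : SymmetricAlgebra A L)
    (hs : s ∈ symFilt A L p) : (C.symD^[n]) φ.tmulOne s = 0 := by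
  induction n generalizing p s with
  | zero => omega
  | succ n ih =>
    rw [Function.iterate_succ_apply']
    induction hs using Submodule.span_induction with
    | zero => simp
    | add s t _ _ hs ht => rw [map_add, hs, ht, add_zero]
    | smul a s h hs => rw [map_smul, hs, smul_zero]
    | mem s h =>
      obtain ⟨l, hl, rfl⟩ := h
      rw [symD, LinearMap.comp_apply]
      rcases p with _ | p
      · obtain rfl : l = [] := by simpa using hl
        simp [symDelta_one]
      · have := symDelta_prod_mem A L l p hl
        generalize symDelta A L (l.map (SymmetricAlgebra.ι A L)).prod = t at this ⊢
        induction this using Submodule.span_induction with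
        | zero => simp
        | add s t _ _ hs ht => rw [map_add, hs, ht, add_zero]
        | smul a s h hs => rw [map_smul, hs, smul_zero]
        | mem s h =>
          obtain ⟨x, s, hs, rfl⟩ := h
          simp [jetNabla, ih p (by omega) s hs, ih p (by omega) _ (C.symNabla_mem x p s hs)]

theorem finite_support (φ : Jet₂ K A L) (s : SymmetricAlgebra A L) :
    (Function.support fun n : ℕ ↦ ((n.factorial : K)⁻¹) •
      Jet₂.eval 1 ((C.symD^[n]) φ.tmulOne s)).Finite := by
  obtain ⟨p, hp⟩ := exists_mem_symFilt A L s
  refine (Set.finite_Iic p).subset fun n hn ↦ ?_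
  by_contra h
  exact hn (by simp [C.symD_iterate_eq_zero φ n p (by simpa using h) s hp])

/-- The map `j_∇(φ) = ∑ₙ (1 / n!) (Dⁿ(φ ⊗ 1))(1)` from jets to the completed symmetric algebra of the
dual of `L`, the latter being the dual `Hom_A(Sym_A(L), A)` of the symmetric algebra. On each element
of `Sym_A(L)` the sum is finite. -/
def jPBW (φ : Jet K A L) : SymmetricAlgebra A L →ₗ[A] A where
  toFun s := ∑ᶠ n : ℕ, ((n.factorial : K)⁻¹) •
    Jet₂.eval 1 ((C.symD^[n]) (Jet₂.of φ).tmulOne s)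
  map_add' s t := by
    rw [← finsum_add_distrib (C.finite_support _ s) (C.finite_support _ t)]
    simp only [map_add, smul_add]
  map_smul' a s := by
    rw [RingHom.id_apply, smul_finsum' a (C.finite_support _ s)]
    refine finsum_congr fun n ↦ ?_
    rw [map_smul, Jet₂.eval_smul, one_mul, smul_comm]
    congr 1
    have := map_smul (Jet₂.of.symm ((C.symD^[n]) (Jet₂.of φ).tmulOne s)) a 1
    rwa [Env.smul_def, mul_one] at this

end Connection

end Jets

section Naturality

variable {K A L A' L' : Type u} [Field K]
  [CommRing A] [Algebra K A] [LieRing L] [LieAlgebra K L]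
  [Module A L] [LieRingModule L A] [LieRinehartRing A L] [LieRinehartAlgebra K A L]
  [CommRing A'] [Algebra K A'] [LieRing L'] [LieAlgebra K L']
  [Module A' L'] [LieRingModule L' A'] [LieRinehartRing A' L'] [LieRinehartAlgebra K A' L']
  (σ : A →ₐ[K] A') (F : LieRinehartAlgebra.Hom σ L L')

theorem Env.map_mem_filt (p : ℕ) (D : Env K A L) (hD : D ∈ Env.filt K A L p) :
    Env.map σ F D ∈ Env.filt K A' L' p := by
  induction hD using Submodule.span_induction with
  | zero => simp
  | add D E _ _ hD hE => rw [map_add]; exact add_mem hD hE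
  | smul a D _ hD => rw [Env.map_smul]; exact Submodule.smul_mem _ _ hD
  | mem D h =>
    obtain ⟨l, hl, rfl⟩ := h
    refine Submodule.subset_span ⟨l.map (fun x ↦ F x), by simpa using hl, ?_⟩
    rw [map_list_prod, List.map_map, List.map_map]
    congr 1
    exact List.map_congr_left fun x _ ↦ Env.map_ofL σ F x

theorem symMap_mem_filt (p : ℕ) (s : SymmetricAlgebra A L) (hs : s ∈ symFilt A L p) :
    symMap σ F s ∈ symFilt A' L' p := by
  induction hs using Submodule.span_induction with
  | zero => simp
  | add s t _ _ hs ht => rw [map_add]; exact add_mem hs ht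
  | smul a s _ hs => rw [symMap_smul]; exact Submodule.smul_mem _ _ hs
  | mem s h =>
    obtain ⟨l, hl, rfl⟩ := h
    refine Submodule.subset_span ⟨l.map (fun x ↦ F x), by simpa using hl, ?_⟩
    rw [map_list_prod, List.map_map, List.map_map]
    congr 1
    exact List.map_congr_left fun x _ ↦ symMap_ι σ F x

theorem symDelta_symMap (T : L ⊗[A] SymmetricAlgebra A L →+ L' ⊗[A'] SymmetricAlgebra A' L')
    (hT : ∀ x s, T (x ⊗ₜ s) = F x ⊗ₜ symMap σ F s) (s : SymmetricAlgebra A L) :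
    symDelta A' L' (symMap σ F s) = T (symDelta A L s) := by
  have h (s : SymmetricAlgebra A L) (t : L ⊗[A] SymmetricAlgebra A L) :
      T ((LinearMap.mulLeft A s).lTensor L t) =
        (LinearMap.mulLeft A' (symMap σ F s)).lTensor L' (T t) := by
    induction t with
    | zero => simp
    | tmul x t => simp [hT]
    | add t t' ht ht' => simp only [map_add, ht, ht']
  induction s using SymmetricAlgebra.induction with
  | algebraMap a =>
    rw [symMap_algebraMap, Algebra.algebraMap_eq_smul_one, Algebra.algebraMap_eq_smul_one, map_smul,
      map_smul, symDelta_one, symDelta_one, smul_zero, smul_zero, map_zero]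
  | ι x => rw [symMap_ι, symDelta_ι, symDelta_ι, hT, map_one]
  | mul s t hs ht => rw [map_mul, symDelta_mul, symDelta_mul, map_add, h, h, hs, ht]
  | add s t hs ht => simp only [map_add, hs, ht]

variable (C : Connection A L) (C' : Connection A' L')

theorem Connection.symNabla_symMap (hC : ∀ x y, F (C.nabla x y) = C'.nabla (F x) (F y)) (x : L) (s : SymmetricAlgebra A L) :
    C'.symNabla (F x) (symMap σ F s) = symMap σ F (C.symNabla x s) := by
  induction s using SymmetricAlgebra.induction with
  | algebraMap a => simp [F.apply_lie]
  | ι y => simp [hC]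
  | mul s t hs ht => simp only [map_mul, symNabla_mul, hs, ht, map_add]
  | add s t hs ht => simp only [map_add, hs, ht]

theorem Connection.symD_symMap (hC : ∀ x y, F (C.nabla x y) = C'.nabla (F x) (F y))
    (β : SymmetricAlgebra A L →ₗ[A] Jet₂ K A L) (β' : SymmetricAlgebra A' L' →ₗ[A'] Jet₂ K A' L')
    (hβ : ∀ s D, Jet₂.eval (Env.map σ F D) (β' (symMap σ F s)) = σ (Jet₂.eval D (β s)))
    (s : SymmetricAlgebra A L) (D : Env K A L) :
    Jet₂.eval (Env.map σ F D) (C'.symD β' (symMap σ F s)) = σ (Jet₂.eval D (C.symD β s)) := by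
  let T : L ⊗[A] SymmetricAlgebra A L →+ L' ⊗[A'] SymmetricAlgebra A' L' :=
    TensorProduct.liftAddHom
      (AddMonoidHom.mk' (fun x ↦ AddMonoidHom.mk' (fun s ↦ F x ⊗ₜ[A'] symMap σ F s) fun s t ↦ by
        rw [map_add, TensorProduct.tmul_add]) fun x y ↦ by
        ext s
        change F.toLieHom (x + y) ⊗ₜ[A'] _ = _
        rw [map_add, TensorProduct.add_tmul]; rfl)
      (fun a x s ↦ by
        change F (a • x) ⊗ₜ[A'] _ = _ ⊗ₜ[A'] symMap σ F (a • s)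
        rw [F.map_smul_apply, symMap_smul, TensorProduct.smul_tmul])
  have hT (x : L) (s : SymmetricAlgebra A L) : T (x ⊗ₜ s) = F x ⊗ₜ symMap σ F s := rfl
  rw [symD, symD, LinearMap.comp_apply, LinearMap.comp_apply, symDelta_symMap σ F T hT]
  induction symDelta A L s with
  | zero => simp
  | add t t' ht ht' => simp only [map_add, ht, ht']
  | tmul x s =>
    rw [hT, TensorProduct.lift.tmul, TensorProduct.lift.tmul]
    simp only [jetNabla, LinearMap.mk₂_apply, map_sub, Jet₂.eval_nabla, hβ,
      symNabla_symMap σ F C C' hC]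
    rw [← hβ s (D * Env.ofL K A L x), map_mul, Env.map_ofL]

theorem Connection.jPBW_symMap (hC : ∀ x y, F (C.nabla x y) = C'.nabla (F x) (F y))
    (φ : Jet K A L) (φ' : Jet K A' L') (hφ : ∀ D, φ' (Env.map σ F D) = σ (φ D))
    (s : SymmetricAlgebra A L) : C'.jPBW φ' (symMap σ F s) = σ (C.jPBW φ s) := by
  have h (n : ℕ) (s : SymmetricAlgebra A L) (D : Env K A L) :
      Jet₂.eval (Env.map σ F D) ((C'.symD^[n]) (Jet₂.of φ').tmulOne (symMap σ F s)) =
        σ (Jet₂.eval D ((C.symD^[n]) (Jet₂.of φ).tmulOne s)) := by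
    induction n generalizing s D with
    | zero =>
      simp only [Function.iterate_zero, id, Jet₂.tmulOne, LinearMap.comp_apply, symMap_counit,
        LinearMap.toSpanSingleton_apply, Jet₂.eval_smul, ← Env.map_ofA σ F, ← map_mul]
      exact hφ _
    | succ n ih =>
      rw [Function.iterate_succ_apply', Function.iterate_succ_apply']
      exact symD_symMap σ F C C' hC _ _ ih s D
  change ∑ᶠ n : ℕ, _ = σ (∑ᶠ n : ℕ, _)
  rw [map_finsum σ (C.finite_support _ s)]
  refine finsum_congr fun n ↦ ?_
  rw [map_smul, ← h n s 1, map_one]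

end Naturality

end LieRinehart

section Sheaves

open Opposite MonoidalCategory

/-- A structure of a sheaf of `K`-algebras on the structure sheaf of a ringed space. -/
class KRingedSpace (K : Type u) [Field K] (X : RingedSpace.{u, u}) where
  algebra (V : Opens X) : Algebra K (X.presheaf.obj (op V))
  map_algebraMap {V W : Opens X} (h : W ≤ V) (c : K) :
    X.presheaf.map (homOfLE h).op (algebraMap K (X.presheaf.obj (op V)) c) =
      algebraMap K (X.presheaf.obj (op W)) c

attribute [reducible, instance] KRingedSpace.algebra

/-- The restriction map of the structure sheaf, as a map of `K`-algebras. -/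
def KRingedSpace.res (K : Type u) [Field K] (X : RingedSpace.{u, u}) [KRingedSpace K X]
    {V W : Opens X} (h : W ≤ V) : X.presheaf.obj (op V) →ₐ[K] X.presheaf.obj (op W) :=
  { (X.presheaf.map (homOfLE h).op).hom with
    commutes' := KRingedSpace.map_algebraMap h }

/-- A Lie algebroid `𝓛` over a ringed space `(X, 𝓞)` over `K`: a sheaf of `𝓞`-modules together with
the structure of a Lie--Rinehart pair on `(𝓞(V), 𝓛(V))` for each open `V`, such that the restriction
maps are morphisms of Lie--Rinehart pairs. -/
structure LieAlgebroid (K : Type u) [Field K] (X : RingedSpace.{u, u}) [KRingedSpace K X] where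
  /-- The sections of `𝓛` over an open set. -/
  sec : Opens X → Type u
  [lieRing (V : Opens X) : LieRing (sec V)]
  [lieAlgebra (V : Opens X) : LieAlgebra K (sec V)]
  [module (V : Opens X) : Module (X.presheaf.obj (op V)) (sec V)]
  [lieRingModule (V : Opens X) : LieRingModule (sec V) (X.presheaf.obj (op V))]
  [lieRinehartRing (V : Opens X) : LieRinehartRing (X.presheaf.obj (op V)) (sec V)]
  [lieRinehartAlgebra (V : Opens X) : LieRinehartAlgebra K (X.presheaf.obj (op V)) (sec V)]
  /-- The restriction maps of `𝓛`. -/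
  res {V W : Opens X} (h : W ≤ V) :
    LieRinehartAlgebra.Hom (KRingedSpace.res K X h) (sec V) (sec W)
  res_refl {V : Opens X} (x : sec V) : res le_rfl x = x
  res_res {U V W : Opens X} (h : V ≤ U) (h' : W ≤ V) (x : sec U) :
    res h' (res h x) = res (h'.trans h) x
  /-- The gluing axiom. -/
  existsUnique_gluing {ι : Type u} (U : ι → Opens X) (s : ∀ i, sec (U i))
    (hs : ∀ i j, res (inf_le_left : U i ⊓ U j ≤ U i) (s i) =
      res (inf_le_right : U i ⊓ U j ≤ U j) (s j)) :
    ∃! t : sec (⨆ i, U i), ∀ i, res (le_iSup U i) t = s i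

namespace LieAlgebroid

attribute [instance] lieRing lieAlgebra module lieRingModule lieRinehartRing lieRinehartAlgebra

section Sheaves

variable (X : RingedSpace.{u, u})

/-- The category of presheaves of `𝓞`-modules. -/
abbrev PMod : Type (u + 1) := PresheafOfModules.{u} (X.presheaf ⋙ forget₂ CommRingCat RingCat)

/-- The structure sheaf as a sheaf of rings. -/
def ringSheaf : Sheaf (Opens.grothendieckTopology X) RingCat.{u} :=
  (sheafCompose (Opens.grothendieckTopology X) (forget₂ CommRingCat.{u} RingCat.{u})).obj X.sheaf

/-- The category of sheaves of `𝓞`-modules. -/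
abbrev SMod : Type (u + 1) := SheafOfModules.{u} (ringSheaf X)

/-- The sheafification functor. -/
def shf : PMod X ⥤ SMod X :=
  (PresheafOfModules.sheafification (𝟙 (ringSheaf X).obj) :
    PresheafOfModules.{u} (ringSheaf X).obj ⥤ SMod X)

/-- The presheaf of `𝓞`-modules underlying a sheaf of `𝓞`-modules. -/
def SMod.pre {X : RingedSpace.{u, u}} (M : SMod X) : PMod X := M.val

/-- The morphism of presheaves underlying a morphism of sheaves of `𝓞`-modules. -/
def SMod.preMap {X : RingedSpace.{u, u}} {M N : SMod X} (f : M ⟶ N) : SMod.pre M ⟶ SMod.pre N := f.val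

/-- Sheafification is left adjoint to the inclusion of sheaves into presheaves. -/
def shfAdj : shf X ⊣ (SheafOfModules.forget (ringSheaf X) : SMod X ⥤ PMod X) :=
  PresheafOfModules.sheafificationAdjunction (𝟙 (ringSheaf X).obj)

variable {X}

/-- The canonical morphism from a presheaf to its sheafification. -/
def toShf (P : PMod X) : P ⟶ SMod.pre ((shf X).obj P) :=
  (shfAdj X).unit.app P

/-- The tensor product of sheaves of `𝓞`-modules. -/
def tensor (M N : SMod X) : SMod X := (shf X).obj (SMod.pre M ⊗ SMod.pre N)

/-- The tensor product of morphisms of sheaves of `𝓞`-modules. -/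
def tensorMap {M M' N N' : SMod X} (f : M ⟶ M') (g : N ⟶ N') : tensor M N ⟶ tensor M' N' :=
  (shf X).map (SMod.preMap f ⊗ₘ SMod.preMap g)

/-- The comultiplication on the sheaf associated with a presheaf of coalgebras. -/
def shfComul {P : PMod X} (Δ : P ⟶ P ⊗ P) : (shf X).obj P ⟶ tensor ((shf X).obj P) ((shf X).obj P) :=
  (shf X).map (Δ ≫ (toShf P ⊗ₘ toShf P))

/-- The counit on the sheaf associated with a presheaf of coalgebras. -/
def shfCounit {P : PMod X} (ε : P ⟶ PresheafOfModules.unit _) :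
    (shf X).obj P ⟶ SheafOfModules.unit (ringSheaf X) :=
  ((shfAdj X).homEquiv P
    (SheafOfModules.unit (ringSheaf X))).symm ε

/-- Restriction of sections. -/
abbrev resₚ (P : PMod X) {V W : Opens X} (h : W ≤ V) (s : P.obj (op V)) : P.obj (op W) :=
  P.map (homOfLE h).op s

/-- The sections over `V` of the sheaf `Hom(P, 𝓞)`: the `𝓞`-linear maps from `P|_V` to `𝓞|_V`. -/
structure Functional (P : PMod X) (V : Opens X) where
  app (W : Opens X) (h : W ≤ V) : P.obj (op W) →ₗ[X.presheaf.obj (op W)] X.presheaf.obj (op W)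
  app_res {W W' : Opens X} (h : W ≤ V) (h' : W' ≤ W) (s : P.obj (op W)) :
    app W' (h'.trans h) (resₚ P h' s) = X.presheaf.map (homOfLE h').op (app W h s)

end Sheaves

section Constructor

variable {X : RingedSpace.{u, u}} (M : Opens X → Type u) [∀ V, AddCommGroup (M V)]
  [inst : ∀ V, Module (X.presheaf.obj (op V)) (M V)] (r : ∀ {V W : Opens X}, W ≤ V → M V →+ M W)
  (r_smul : ∀ {V W : Opens X} (h : W ≤ V) (a : X.presheaf.obj (op V)) (m : M V),
    r h (a • m) = X.presheaf.map (homOfLE h).op a • r h m)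
  (r_refl : ∀ {V : Opens X} (m : M V), r le_rfl m = m)
  (r_trans : ∀ {U V W : Opens X} (h : V ≤ U) (h' : W ≤ V) (m : M U),
    r (h'.trans h) m = r h' (r h m))

/-- The presheaf of `𝓞`-modules with given modules of sections and given restriction maps. -/
def mkPMod : PMod X where
  obj V := @ModuleCat.of (X.presheaf.obj V) _ (M V.unop) _ (inst V.unop)
  map {V W} f := ModuleCat.ofHom
    (Y := (ModuleCat.restrictScalars (X.presheaf.map f).hom).obj
      (@ModuleCat.of (X.presheaf.obj W) _ (M W.unop) _ (inst W.unop)))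
    { toFun := r f.unop.le
      map_add' := map_add _
      map_smul' := fun a m ↦ r_smul f.unop.le a m }
  map_id V := by ext m; exact r_refl m
  map_comp f g := by ext m; exact r_trans f.unop.le g.unop.le m


/-- A comultiplication on `mkPMod`, from comultiplications on the modules of sections. -/
def mkComul (Δ : ∀ V, M V →ₗ[X.presheaf.obj (op V)] M V ⊗[X.presheaf.obj (op V)] M V)
    (hΔ : ∀ {V W : Opens X} (h : W ≤ V)
      (T : M V ⊗[X.presheaf.obj (op V)] M V →+ M W ⊗[X.presheaf.obj (op W)] M W),
      (∀ m n, T (m ⊗ₜ n) = r h m ⊗ₜ r h n) → ∀ m, T (Δ V m) = Δ W (r h m)) :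
    mkPMod M r r_smul r_refl r_trans ⟶
      mkPMod M r r_smul r_refl r_trans ⊗ mkPMod M r r_smul r_refl r_trans where
  app V := ModuleCat.ofHom (X := @ModuleCat.of (X.presheaf.obj V) _ (M V.unop) _ (inst V.unop))
    (Y := @ModuleCat.of (X.presheaf.obj V) _ (M V.unop ⊗[X.presheaf.obj (op V.unop)] M V.unop) _ _)
     (Δ V.unop)
  naturality {V W} f := by
    ext m
    exact (hΔ f.unop.le (((mkPMod M r r_smul r_refl r_trans ⊗ mkPMod M r r_smul r_refl r_trans
      ).map f).hom.toAddMonoidHom) (fun m n ↦ rfl) m).symm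

/-- A counit on `mkPMod`, from counits on the modules of sections. -/
def mkCounit (ε : ∀ V, M V →ₗ[X.presheaf.obj (op V)] X.presheaf.obj (op V))
    (hε : ∀ {V W : Opens X} (h : W ≤ V) (m : M V),
      ε W (r h m) = X.presheaf.map (homOfLE h).op (ε V m)) :
    mkPMod M r r_smul r_refl r_trans ⟶ PresheafOfModules.unit _ where
  app V := ModuleCat.ofHom (X := @ModuleCat.of (X.presheaf.obj V) _ (M V.unop) _ (inst V.unop))
    (Y := @ModuleCat.of (X.presheaf.obj V) _ (X.presheaf.obj V) _ _) (ε V.unop)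
  naturality {V W} f := by
    ext m
    exact hε f.unop.le m

end Constructor

open LieRinehart

section Presheaves

variable {K : Type u} [Field K] {X : RingedSpace.{u, u}} [KRingedSpace K X]

theorem _root_.KRingedSpace.res_refl {V : Opens X} (a : X.presheaf.obj (op V)) :
    KRingedSpace.res K X (le_refl V) a = a :=
  congrArg (fun f ↦ f.hom a) (X.presheaf.map_id (op V))

theorem _root_.KRingedSpace.res_res {U V W : Opens X} (h : V ≤ U) (h' : W ≤ V)
    (a : X.presheaf.obj (op U)) :
    KRingedSpace.res K X h' (KRingedSpace.res K X h a) = KRingedSpace.res K X (h'.trans h) a :=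
  (congrArg (fun f ↦ f.hom a) (X.presheaf.map_comp (homOfLE h).op (homOfLE h').op)).symm

variable (L : LieAlgebroid K X)

theorem env_map_refl {V : Opens X} (D : Env K (X.presheaf.obj (op V)) (L.sec V)) :
    Env.map (KRingedSpace.res K X le_rfl) (L.res le_rfl) D = D :=
  DFunLike.congr_fun (g := AlgHom.id K _) (Env.algHom_ext
    (fun a ↦ by rw [Env.map_ofA, KRingedSpace.res_refl]; rfl)
    (fun x ↦ by rw [Env.map_ofL, L.res_refl]; rfl)) D

theorem env_map_trans {U V W : Opens X} (h : V ≤ U) (h' : W ≤ V)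
    (D : Env K (X.presheaf.obj (op U)) (L.sec U)) :
    Env.map (KRingedSpace.res K X (h'.trans h)) (L.res (h'.trans h)) D =
      Env.map (KRingedSpace.res K X h') (L.res h') (Env.map (KRingedSpace.res K X h) (L.res h) D) :=
  DFunLike.congr_fun (g := (Env.map (KRingedSpace.res K X h') (L.res h')).comp
    (Env.map (KRingedSpace.res K X h) (L.res h))) (Env.algHom_ext
    (fun a ↦ by
      rw [AlgHom.comp_apply, Env.map_ofA, Env.map_ofA, Env.map_ofA, KRingedSpace.res_res])
    (fun x ↦ by rw [AlgHom.comp_apply, Env.map_ofL, Env.map_ofL, Env.map_ofL, L.res_res])) D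

theorem symMap_refl {V : Opens X} (s : SymmetricAlgebra (X.presheaf.obj (op V)) (L.sec V)) :
    symMap (KRingedSpace.res K X le_rfl) (L.res le_rfl) s = s := by
  induction s using SymmetricAlgebra.induction with
  | algebraMap a => rw [symMap_algebraMap, KRingedSpace.res_refl]
  | ι x => rw [symMap_ι, L.res_refl]
  | mul s t hs ht => rw [map_mul, hs, ht]
  | add s t hs ht => rw [map_add, hs, ht]

theorem symMap_trans {U V W : Opens X} (h : V ≤ U) (h' : W ≤ V)
    (s : SymmetricAlgebra (X.presheaf.obj (op U)) (L.sec U)) :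
    symMap (KRingedSpace.res K X (h'.trans h)) (L.res (h'.trans h)) s =
      symMap (KRingedSpace.res K X h') (L.res h') (symMap (KRingedSpace.res K X h) (L.res h) s) := by
  induction s using SymmetricAlgebra.induction with
  | algebraMap a =>
    rw [symMap_algebraMap, symMap_algebraMap, symMap_algebraMap, KRingedSpace.res_res]
  | ι x => rw [symMap_ι, symMap_ι, symMap_ι, L.res_res]
  | mul s t hs ht => rw [map_mul, hs, ht, map_mul, map_mul]
  | add s t hs ht => rw [map_add, hs, ht, map_add, map_add]

/-- The presheaf `V ↦ U(𝓛(V), 𝓞(V))` of universal enveloping algebras, as left `𝓞`-modules. -/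
def envPresheaf : PMod X :=
  mkPMod (fun V ↦ Env K (X.presheaf.obj (op V)) (L.sec V))
    (fun h ↦ (Env.map (KRingedSpace.res K X h) (L.res h) : _ →+ _))
    (fun _ ↦ Env.map_smul _ _)
    L.env_map_refl L.env_map_trans

/-- The presheaf `V ↦ Sym(𝓛(V))` of symmetric algebras over `𝓞`. -/
def symPresheaf : PMod X :=
  mkPMod (fun V ↦ SymmetricAlgebra (X.presheaf.obj (op V)) (L.sec V))
    (fun h ↦ (symMap (KRingedSpace.res K X h) (L.res h) : _ →+ _))
    (fun _ ↦ symMap_smul _ _)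
    L.symMap_refl L.symMap_trans

/-- The coproduct of the algebras `U(𝓛(V), 𝓞(V))`. -/
def envComul : L.envPresheaf ⟶ L.envPresheaf ⊗ L.envPresheaf :=
  mkComul _ _ (fun _ ↦ Env.map_smul _ _) L.env_map_refl L.env_map_trans
    (fun _ ↦ Coalgebra.comul) fun h T hT D ↦ Env.map_comul _ (L.res h) T hT D

/-- The counit of the algebras `U(𝓛(V), 𝓞(V))`. -/
def envCounit : L.envPresheaf ⟶ PresheafOfModules.unit _ :=
  mkCounit _ _ (fun _ ↦ Env.map_smul _ _) L.env_map_refl L.env_map_trans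
    (fun _ ↦ Coalgebra.counit) fun h D ↦ Env.map_counit _ (L.res h) D

/-- The coproduct of the symmetric algebras `Sym(𝓛(V))`, with `Δ(X) = X ⊗ 1 + 1 ⊗ X`. -/
def symComul : L.symPresheaf ⟶ L.symPresheaf ⊗ L.symPresheaf :=
  mkComul _ _ (fun _ ↦ symMap_smul _ _) L.symMap_refl L.symMap_trans
    (fun _ ↦ Coalgebra.comul) fun h T hT s ↦ symMap_comul _ (L.res h) T hT s

/-- The counit of the symmetric algebras `Sym(𝓛(V))`. -/
def symCounit : L.symPresheaf ⟶ PresheafOfModules.unit _ :=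
  mkCounit _ _ (fun _ ↦ symMap_smul _ _) L.symMap_refl L.symMap_trans
    (fun _ ↦ Coalgebra.counit) fun h s ↦ symMap_counit _ (L.res h) s

/-- The sheaf `U(𝓛)`, the sheaf associated with `V ↦ U(𝓛(V), 𝓞(V))`. -/
def envSheaf : SMod X := (shf X).obj L.envPresheaf

/-- The sheaf `Sym(𝓛)`, the sheaf associated with `V ↦ Sym(𝓛(V))`. -/
def symSheaf : SMod X := (shf X).obj L.symPresheaf

/-- The section of `U(𝓛)` over `V` given by an element of `U(𝓛(V), 𝓞(V))`. -/
def toEnv (V : Opens X) :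
    Env K (X.presheaf.obj (op V)) (L.sec V) →ₗ[X.presheaf.obj (op V)] (SMod.pre L.envSheaf).obj (op V) :=
  ((toShf L.envPresheaf).app (op V)).hom

/-- The section of `Sym(𝓛)` over `V` given by an element of `Sym(𝓛(V))`. -/
def toSym (V : Opens X) : SymmetricAlgebra (X.presheaf.obj (op V)) (L.sec V)
    →ₗ[X.presheaf.obj (op V)] (SMod.pre L.symSheaf).obj (op V) :=
  ((toShf L.symPresheaf).app (op V)).hom

theorem toEnv_map {V W : Opens X} (h : W ≤ V) (D : Env K (X.presheaf.obj (op V)) (L.sec V)) :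
    L.toEnv W (Env.map (KRingedSpace.res K X h) (L.res h) D) =
      (SMod.pre L.envSheaf).map (homOfLE h).op (L.toEnv V D) :=
  PresheafOfModules.naturality_apply (toShf L.envPresheaf) (homOfLE h).op D

/-- `f` is a morphism of comonoids in the category of `𝓞`-modules. -/
def IsComonoidHom (f : L.symSheaf ⟶ L.envSheaf) : Prop :=
  f ≫ shfComul L.envComul = shfComul L.symComul ≫ tensorMap f f ∧
    f ≫ shfCounit L.envCounit = shfCounit L.symCounit

/-- `𝓛` is locally free of rank `r`: each point has a neighbourhood over which `𝓛` is isomorphic to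
`𝓞^r`. -/
def IsLocallyFree (r : ℕ) : Prop :=
  ∀ x : X, ∃ V : Opens X, x ∈ V ∧ ∃ e : Fin r → L.sec V, ∀ (W : Opens X) (h : W ≤ V),
    Function.Bijective fun a : Fin r → X.presheaf.obj (op W) ↦ ∑ i, a i • L.res h (e i)

/-- An `𝓛`-connection on `𝓛`. -/
structure SheafConnection where
  /-- The connection on sections over `V`. -/
  conn (V : Opens X) : Connection (X.presheaf.obj (op V)) (L.sec V)
  res_nabla {V W : Opens X} (h : W ≤ V) (x y : L.sec V) :
    L.res h ((conn V).nabla x y) = (conn W).nabla (L.res h x) (L.res h y)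

variable {L}

/-- The section of the sheaf of jets `𝓙(𝓛) = Hom(U(𝓛), 𝓞)` over `V` defines a jet of each of the
Lie--Rinehart pairs `(𝓛(W), 𝓞(W))` for `W ≤ V`. -/
def Functional.jet {V : Opens X} (φ : Functional (SMod.pre L.envSheaf) V) (W : Opens X) (h : W ≤ V) :
    Jet K (X.presheaf.obj (op W)) (L.sec W) :=
  φ.app W h ∘ₗ L.toEnv W

/-- The map `j_∇` from the sheaf of jets `𝓙(𝓛) = Hom(U(𝓛), 𝓞)` to the completed symmetric algebra
of the dual of `𝓛`, which is the sheaf `Hom(Sym(𝓛), 𝓞)`. -/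
def SheafConnection.j (C : L.SheafConnection) {V : Opens X} (φ : Functional (SMod.pre L.envSheaf) V) :
    Functional L.symPresheaf V where
  app W h := (C.conn W).jPBW (φ.jet W h)
  app_res {W W'} h h' s := Connection.jPBW_symMap (KRingedSpace.res K X h') (L.res h')
    (C.conn W) (C.conn W') (C.res_nabla h') _ _ (fun D ↦ by
      change φ.app W' _ (L.toEnv W' _) = _
      rw [L.toEnv_map]
      exact φ.app_res h h' _) s

/-- `f : Sym(𝓛) → U(𝓛)` is dual to `j_∇`: `φ(f(α)) = ⟨α, j_∇(φ)⟩` for all local sections `φ` of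
`𝓙(𝓛)` and `α` of `Sym(𝓛)`. It is enough to let `α` run through the elements of the symmetric algebras
`Sym(𝓛(V))`, since every section of the sheaf `Sym(𝓛)` is locally of this form, both sides are
compatible with restriction, and `𝓞` is a sheaf. -/
def SheafConnection.IsDual (C : L.SheafConnection) (f : L.symSheaf ⟶ L.envSheaf) : Prop :=
  ∀ (V : Opens X) (φ : Functional (SMod.pre L.envSheaf) V)
    (α : SymmetricAlgebra (X.presheaf.obj (op V)) (L.sec V)),
    φ.app V le_rfl ((SMod.preMap f).app (op V) (L.toSym V α)) = (C.j φ).app V le_rfl α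

end Presheaves

section Filtrations

variable {X : RingedSpace.{u, u}}

theorem resₚ_resₚ (P : PMod X) {U V W : Opens X} (h : V ≤ U) (h' : W ≤ V) (s : P.obj (op U)) :
    resₚ P h' (resₚ P h s) = resₚ P (h'.trans h) s :=
  (PresheafOfModules.map_comp_apply P (homOfLE h).op (homOfLE h').op s).symm

theorem resₚ_toShf (P : PMod X) {V W : Opens X} (h : W ≤ V) (s : P.obj (op V)) :
    resₚ _ h ((toShf P).app (op V) s) = (toShf P).app (op W) (resₚ P h s) :=
  (PresheafOfModules.naturality_apply (toShf P) (homOfLE h).op s).symm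

theorem resₚ_add (P : PMod X) {V W : Opens X} (h : W ≤ V) (s t : P.obj (op V)) :
    resₚ P h (s + t) = resₚ P h s + resₚ P h t :=
  map_add (P.map (homOfLE h).op).hom s t

/-- The sections over `V` of the subsheaf of the sheaf associated with `P` that is generated by the
submodules `F W` of the sections of `P`, assumed stable under restriction: the sections which are
locally given by elements of `F W`. -/
def shfSubmodule (P : PMod X)
    (F : ∀ V : Opens X, Submodule (X.presheaf.obj (op V)) (P.obj (op V)))
    (hF : ∀ {V W : Opens X} (h : W ≤ V), ∀ p ∈ F V, resₚ P h p ∈ F W) (V : Opens X) :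
    Submodule (X.presheaf.obj (op V)) ((SMod.pre ((shf X).obj P)).obj (op V)) where
  carrier := {s | ∀ x ∈ V, ∃ (W : Opens X) (h : W ≤ V), x ∈ W ∧
    ∃ p ∈ F W, resₚ _ h s = (toShf P).app (op W) p}
  zero_mem' x hx := ⟨V, le_rfl, hx, 0, zero_mem _, 
    (map_zero ((SMod.pre ((shf X).obj P)).map (homOfLE le_rfl).op).hom).trans
      (map_zero ((toShf P).app (op V)).hom).symm⟩
  add_mem' := by
    intro s t hs ht x hx
    obtain ⟨W, h, hxW, p, hp, e⟩ := hs x hx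
    obtain ⟨W', h', hxW', p', hp', e'⟩ := ht x hx
    refine ⟨W ⊓ W', inf_le_left.trans h, ⟨hxW, hxW'⟩,
      resₚ P inf_le_left p + resₚ P inf_le_right p', add_mem (hF _ _ hp) (hF _ _ hp'), ?_⟩
    have h₁ := congrArg (resₚ _ (inf_le_left : W ⊓ W' ≤ W)) e
    have h₂ := congrArg (resₚ _ (inf_le_right : W ⊓ W' ≤ W')) e'
    rw [resₚ_resₚ, resₚ_toShf] at h₁ h₂
    rw [resₚ_add, h₁, h₂]
    exact (map_add ((toShf P).app (op (W ⊓ W'))).hom _ _).symm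
  smul_mem' := by
    intro a s hs x hx
    obtain ⟨W, h, hxW, p, hp, e⟩ := hs x hx
    refine ⟨W, h, hxW, X.presheaf.map (homOfLE h).op a • p, Submodule.smul_mem _ _ hp, ?_⟩
    rw [resₚ, PresheafOfModules.map_smul]
    rw [resₚ] at e
    rw [e]
    exact (LinearMap.map_smul ((toShf P).app (op W)).hom _ p).symm

variable {K : Type u} [Field K] [KRingedSpace K X] (L : LieAlgebroid K X)

/-- The filtration of `U(𝓛)`: `F_p U(𝓛)` is the sheaf associated with
`V ↦ F_p U(𝓛(V), 𝓞(V))`. -/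
def envFilt (p : ℕ) (V : Opens X) :
    Submodule (X.presheaf.obj (op V)) ((SMod.pre L.envSheaf).obj (op V)) :=
  shfSubmodule L.envPresheaf (fun V ↦ Env.filt K (X.presheaf.obj (op V)) (L.sec V) p)
    (fun h D hD ↦ Env.map_mem_filt (KRingedSpace.res K X h) (L.res h) p D hD) V

/-- The filtration of `Sym(𝓛)`: `F_p Sym(𝓛)` is the sheaf associated with
`V ↦ F_p Sym(𝓛(V))`. -/
def symFilt (p : ℕ) (V : Opens X) :
    Submodule (X.presheaf.obj (op V)) ((SMod.pre L.symSheaf).obj (op V)) :=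
  shfSubmodule L.symPresheaf (fun V ↦ LieRinehart.symFilt (X.presheaf.obj (op V)) (L.sec V) p)
    (fun h s hs ↦ symMap_mem_filt (KRingedSpace.res K X h) (L.res h) p s hs) V

end Filtrations

section Graded

/-- The preceding step `F_{p-1}` of a filtration, with `F_{-1} = 0`. -/
def prevStep {A M : Type*} [CommRing A] [AddCommGroup M] [Module A M] (F : ℕ → Submodule A M) :
    ℕ → Submodule A M
  | 0 => ⊥
  | p + 1 => F p

/-- The graded quotient `F_p / F_{p-1}`. -/
abbrev Gr {A M : Type*} [CommRing A] [AddCommGroup M] [Module A M] (F : ℕ → Submodule A M) (p : ℕ) :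
    Type _ :=
  F p ⧸ (prevStep F p).submoduleOf (F p)

/-- The map on graded quotients induced by a linear map that preserves the filtrations. -/
def grMap {A M N : Type*} [CommRing A] [AddCommGroup M] [Module A M] [AddCommGroup N] [Module A N]
    {F : ℕ → Submodule A M} {G : ℕ → Submodule A N} (f : M →ₗ[A] N)
    (hf : ∀ p, ∀ m ∈ F p, f m ∈ G p) (p : ℕ) : Gr F p →ₗ[A] Gr G p :=
  Submodule.mapQ _ _ (f.restrict (hf p)) (by
    rintro ⟨m, hm⟩ h
    rcases p with _ | p
    · have h' : m = 0 := h
      subst h'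
      exact map_zero f
    · exact hf p m h)

variable {K : Type u} [Field K] {X : RingedSpace.{u, u}} [KRingedSpace K X] {L : LieAlgebroid K X}

/-- The map on sections over `V` given by a morphism `Sym(𝓛) → U(𝓛)`. -/
def onSections (f : L.symSheaf ⟶ L.envSheaf) (V : Opens X) :
    (SMod.pre L.symSheaf).obj (op V) →ₗ[X.presheaf.obj (op V)]
      (SMod.pre L.envSheaf).obj (op V) :=
  ((SMod.preMap f).app (op V)).hom

theorem toSym_mem {p : ℕ} {V : Opens X} {s : SymmetricAlgebra (X.presheaf.obj (op V)) (L.sec V)}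
    (hs : s ∈ LieRinehart.symFilt (X.presheaf.obj (op V)) (L.sec V) p) :
    L.toSym V s ∈ L.symFilt p V :=
  fun _ h ↦ ⟨V, le_rfl, h, s, hs,
    (resₚ_toShf L.symPresheaf le_rfl s).trans (congrArg _ (L.symMap_refl s))⟩

theorem toEnv_mem {p : ℕ} {V : Opens X} {D : Env K (X.presheaf.obj (op V)) (L.sec V)}
    (hD : D ∈ Env.filt K (X.presheaf.obj (op V)) (L.sec V) p) : L.toEnv V D ∈ L.envFilt p V :=
  fun _ h ↦ ⟨V, le_rfl, h, D, hD,
    (resₚ_toShf L.envPresheaf le_rfl D).trans (congrArg _ (L.env_map_refl D))⟩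

/-- The section `X₁ ⋯ X_p` of `F_p Sym(𝓛)`. -/
def symProd {p : ℕ} {V : Opens X} (x : Fin p → L.sec V) : L.symFilt p V :=
  ⟨L.toSym V (List.ofFn fun i ↦ SymmetricAlgebra.ι (X.presheaf.obj (op V)) (L.sec V) (x i)).prod,
    toSym_mem (Submodule.subset_span ⟨List.ofFn x, by simp, by rw [List.map_ofFn]; rfl⟩)⟩

/-- The section `1 / p! ∑_σ X_{σ(1)} ⋯ X_{σ(p)}` of `F_p U(𝓛)`. -/
def envSymmetrization {p : ℕ} {V : Opens X} (x : Fin p → L.sec V) : L.envFilt p V :=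
  ⟨L.toEnv V ((p.factorial : K)⁻¹ • ∑ σ : Equiv.Perm (Fin p),
      (List.ofFn fun i ↦ Env.ofL K (X.presheaf.obj (op V)) (L.sec V) (x (σ i))).prod),
    toEnv_mem (Submodule.smul_of_tower_mem _ _ (Submodule.sum_mem _ fun σ _ ↦
      Submodule.subset_span ⟨List.ofFn (x ∘ σ), by simp, by rw [List.map_ofFn]; rfl⟩))⟩

/-- `f` is an isomorphism of filtered `𝓞`-modules: `f` is an isomorphism of `𝓞`-modules, and both `f`
and its inverse preserve the filtrations. -/
def IsFilteredIso (f : L.symSheaf ⟶ L.envSheaf) : Prop :=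
  IsIso f ∧ ∀ (V : Opens X) (p : ℕ) (s : (SMod.pre L.symSheaf).obj (op V)),
    s ∈ L.symFilt p V ↔ onSections f V s ∈ L.envFilt p V

/-- The map `F_p Sym(𝓛) / F_{p-1} Sym(𝓛) → F_p U(𝓛) / F_{p-1} U(𝓛)` induced by `f`, on sections over
`V`. -/
def onGr {f : L.symSheaf ⟶ L.envSheaf} (hf : IsFilteredIso f) (p : ℕ) (V : Opens X) :
    Gr (fun q ↦ L.symFilt q V) p →ₗ[X.presheaf.obj (op V)] Gr (fun q ↦ L.envFilt q V) p :=
  grMap (onSections f V) (fun q s ↦ (hf.2 V q s).1) p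

end Graded

end LieAlgebroid

end Sheaves

end

/-! The operator `symD` on maps `Sym → J` only uses right multiplication inside the argument of a
jet. It is therefore the transpose of an operator `envD` on maps `p : Sym → U`, which sends `p` to
`X₁⋯Xₙ ↦ ∑ᵢ (Xᵢ · p(X₁⋯X̂ᵢ⋯Xₙ) - p(∇_{Xᵢ}(X₁⋯X̂ᵢ⋯Xₙ)))`. Hence `j_∇(φ) = φ ∘ pbw` with `pbw = ∑ₙ
(1/n!) envDⁿ(ε)` (`eval_symD_iterate`, `jPBW_apply`). In degree `n` only the `n`-th term survives,
and the factorials turn the series into the recursion `envD pbw = pbw ∘ Euler` (`envD_pbw_of_mem`,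
`envD_pbw`). In characteristic zero one may divide by the degree, so this recursion determines
`pbw`, and its properties follow by induction on the degree.

Counit and coproduct: `∇_X` on `Sym` and left multiplication by `X` on `U` are compatible with the
comonoid structures in the same way, and the Euler operator is a coderivation (`counit_pbw`,
`comul_pbw`). Leading term: the terms with `∇` have lower order and factors commute modulo lower
order, so `pbw` is the identity on leading terms (`pbw_prod_sub_mem`). Consequently `pbw` maps `F_p
Sym` onto `F_p U`, over any pair.

Injectivity is the Poincaré--Birkhoff--Witt theorem and is proved when `L` has a finite basis `e`.
One makes `U` act on `A ⊗ K[z]` so that `e_j` acts on `K[z]` as `z_j + t_j`, where `t_j` does not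
raise the degree. The `t_j` are found degree by degree from two radial conditions, `∑ᵢ eᵢ · ∂ᵢ s = n
s` and the vanishing of the curvature contracted with the radial direction. The Bianchi identity
then forces the whole curvature to vanish (`curv_inc`), so the action of `L` extends to `U`.
Applying `D` to `1` recovers the leading term of `D`, so `D ↦ D · 1` composed with `pbw` is a
triangular perturbation of an isomorphism (`symb_pbw_sub_mem`).

For sheaves, `pbw` commutes with restriction and is locally bijective, so sheafification makes it an
isomorphism. Uniqueness requires that local functionals separate the sections of `U(𝓛)`. Over a
frame the coefficient functionals separate those of `Sym(𝓛)`, and they are transported through the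
inverse of `pbw` (`eq_pbw_of_isDual`). -/

noncomputable section

namespace LieRinehart

/-! ### Grading, Euler operator and coproduct of the symmetric algebra -/

section SymDeg

variable (A L : Type u) [CommRing A] [AddCommGroup L] [Module A L]

/-- The component of degree `n` of `Sym_A(L)`. -/
def symDeg (n : ℕ) : Submodule A (SymmetricAlgebra A L) :=
  Submodule.span A {s | ∃ l : List L, l.length = n ∧ s = (l.map (SymmetricAlgebra.ι A L)).prod}

variable {A L}

theorem prod_mem_symDeg {n : ℕ} {l : List L} (hl : l.length = n) :
    (l.map (SymmetricAlgebra.ι A L)).prod ∈ symDeg A L n :=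
  Submodule.subset_span ⟨l, hl, rfl⟩

theorem prod_mem_symFilt {n : ℕ} {l : List L} (hl : l.length ≤ n) :
    (l.map (SymmetricAlgebra.ι A L)).prod ∈ symFilt A L n :=
  Submodule.subset_span ⟨l, hl, rfl⟩

theorem symFilt_mono {p q : ℕ} (h : p ≤ q) : symFilt A L p ≤ symFilt A L q :=
  Submodule.span_mono fun _ ⟨l, hl, e⟩ ↦ ⟨l, hl.trans h, e⟩

variable (A L) in
theorem iSup_symDeg : ⨆ n, symDeg A L n = ⊤ := by
  refine top_unique fun s _ ↦ ?_
  obtain ⟨p, hp⟩ := exists_mem_symFilt A L s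
  refine Submodule.span_le.2 ?_ hp
  rintro _ ⟨l, -, rfl⟩
  exact Submodule.mem_iSup_of_mem l.length (prod_mem_symDeg rfl)

theorem symDeg_induction {p : SymmetricAlgebra A L → Prop} (mem : ∀ n, ∀ s ∈ symDeg A L n, p s)
    (add : ∀ s t, p s → p t → p (s + t)) (s : SymmetricAlgebra A L) : p s :=
  Submodule.iSup_induction (symDeg A L) (motive := p) (by rw [iSup_symDeg]; trivial) mem
    (mem 0 0 (zero_mem _)) add

theorem mem_symDeg_zero {s : SymmetricAlgebra A L} (hs : s ∈ symDeg A L 0) :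
    ∃ a : A, s = a • 1 := by
  have h : symDeg A L 0 ≤ Submodule.span A {1} := by
    refine Submodule.span_mono ?_
    rintro _ ⟨l, hl, rfl⟩
    simp [List.length_eq_zero_iff.1 hl]
  obtain ⟨a, ha⟩ := Submodule.mem_span_singleton.1 (h hs)
  exact ⟨a, ha.symm⟩

theorem symDelta_prod (l : List L) : symDelta A L (l.map (SymmetricAlgebra.ι A L)).prod =
    ∑ i : Fin l.length, l[i] ⊗ₜ ((l.eraseIdx i).map (SymmetricAlgebra.ι A L)).prod := by
  induction l with
  | nil => simp [symDelta_one]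
  | cons x l ih =>
    rw [List.map_cons, List.prod_cons, symDelta_mul, symDelta_ι, ih]
    simp [Fin.sum_univ_succ, add_comm]

theorem perm_getElem_cons_eraseIdx (l : List L) (i : Fin l.length) :
    (l[i] :: l.eraseIdx i).Perm l := by
  exact List.getElem_cons_eraseIdx_perm i.2

/-- Removing one factor leads from degree `n + 1` to degree `n`. Together with `map_symDelta_congr`
this is the form in which operators factoring through `symDelta` are treated by induction on the
degree. -/
theorem map_symDelta_mem {M : Type*} [AddCommGroup M] [Module A M]
    (f : L ⊗[A] SymmetricAlgebra A L →ₗ[A] M) (N : Submodule A M) (n : ℕ)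
    (h : ∀ x, ∀ s ∈ symDeg A L n, f (x ⊗ₜ s) ∈ N) (s : SymmetricAlgebra A L)
    (hs : s ∈ symDeg A L (n + 1)) : f (symDelta A L s) ∈ N := by
  suffices H : symDeg A L (n + 1) ≤ N.comap (f ∘ₗ symDelta A L) from H hs
  refine Submodule.span_le.2 ?_
  rintro _ ⟨l, hl, rfl⟩
  change f (symDelta A L _) ∈ N
  rw [symDelta_prod, map_sum]
  refine Submodule.sum_mem _ fun i _ ↦ h _ _ (prod_mem_symDeg ?_)
  rw [List.length_eraseIdx_of_lt i.2]
  omega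

theorem map_symDelta_congr {M : Type*} [AddCommGroup M] [Module A M]
    (f g : L ⊗[A] SymmetricAlgebra A L →ₗ[A] M) (n : ℕ)
    (h : ∀ x, ∀ s ∈ symDeg A L n, f (x ⊗ₜ s) = g (x ⊗ₜ s)) (s : SymmetricAlgebra A L)
    (hs : s ∈ symDeg A L (n + 1)) : f (symDelta A L s) = g (symDelta A L s) := by
  have := map_symDelta_mem (f - g) ⊥ n (fun x s hs ↦ by simp [h x s hs]) s hs
  rwa [Submodule.mem_bot, LinearMap.sub_apply, sub_eq_zero] at this

variable (A L) in
/-- The Euler derivation of `Sym_A(L)`, multiplication by `n` in degree `n`. -/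
def symEuler : SymmetricAlgebra A L →ₗ[A] SymmetricAlgebra A L :=
  TensorProduct.lift ((LinearMap.mul A _) ∘ₗ SymmetricAlgebra.ι A L) ∘ₗ symDelta A L

/-- Each of the `n` summands puts back the factor that `symDelta` took out, so all of them equal the
given product. -/
theorem symEuler_of_mem {n : ℕ} {s : SymmetricAlgebra A L} (hs : s ∈ symDeg A L n) :
    symEuler A L s = n • s := by
  induction hs using Submodule.span_induction with
  | zero => simp
  | add s t _ _ hs ht => rw [map_add, hs, ht, smul_add]
  | smul a s _ hs => rw [map_smul, hs, smul_comm]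
  | mem s h =>
    obtain ⟨l, rfl, rfl⟩ := h
    rw [symEuler, LinearMap.comp_apply, symDelta_prod, map_sum]
    have (i : Fin l.length) : SymmetricAlgebra.ι A L l[i] *
        ((l.eraseIdx i).map (SymmetricAlgebra.ι A L)).prod =
        (l.map (SymmetricAlgebra.ι A L)).prod := by
      rw [← List.prod_cons, ← List.map_cons]
      exact ((perm_getElem_cons_eraseIdx l i).map _).prod_eq
    simp only [TensorProduct.lift.tmul, LinearMap.comp_apply, LinearMap.mul_apply', this]
    simp

theorem symEuler_mul (s t : SymmetricAlgebra A L) :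
    symEuler A L (s * t) = symEuler A L s * t + s * symEuler A L t := by
  have h (s : SymmetricAlgebra A L) (t : L ⊗[A] SymmetricAlgebra A L) :
      TensorProduct.lift ((LinearMap.mul A _) ∘ₗ SymmetricAlgebra.ι A L)
        ((LinearMap.mulLeft A s).lTensor L t) =
      s * TensorProduct.lift ((LinearMap.mul A _) ∘ₗ SymmetricAlgebra.ι A L) t := by
    induction t with
    | zero => simp
    | tmul x u => simp [mul_left_comm]
    | add u v hu hv => simp only [map_add, hu, hv, mul_add]
  simp only [symEuler, LinearMap.comp_apply, symDelta_mul, map_add, h]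
  ring

/-- The degree is additive under the coproduct: both sides are derivations along `comul` and they
agree on the generators. In `comul_pbw` this distributes the factor `n` of the recursion over the
two tensor factors. -/
theorem comul_symEuler (s : SymmetricAlgebra A L) :
    Coalgebra.comul (R := A) (symEuler A L s) =
      (symEuler A L).rTensor _ (Coalgebra.comul (R := A) s) +
      (symEuler A L).lTensor _ (Coalgebra.comul (R := A) s) := by
  have one : symEuler A L 1 = 0 := by simp [symEuler, symDelta_one]
  have iota (x : L) : symEuler A L (SymmetricAlgebra.ι A L x) = SymmetricAlgebra.ι A L x := by
    simp [symEuler, symDelta_ι]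
  have h₁ (u v : SymmetricAlgebra A L ⊗[A] SymmetricAlgebra A L) :
      (symEuler A L).rTensor _ (u * v) =
        (symEuler A L).rTensor _ u * v + u * (symEuler A L).rTensor _ v := by
    induction u with
    | zero => simp
    | add u u' hu hu' => simp only [add_mul, map_add, hu, hu']; abel
    | tmul a b =>
      induction v with
      | zero => simp
      | add u u' hu hu' => simp only [mul_add, map_add, hu, hu']; abel
      | tmul c d => simp [symEuler_mul, TensorProduct.add_tmul]
  have h₂ (u v : SymmetricAlgebra A L ⊗[A] SymmetricAlgebra A L) :
      (symEuler A L).lTensor _ (u * v) =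
        (symEuler A L).lTensor _ u * v + u * (symEuler A L).lTensor _ v := by
    induction u with
    | zero => simp
    | add u u' hu hu' => simp only [add_mul, map_add, hu, hu']; abel
    | tmul a b =>
      induction v with
      | zero => simp
      | add u u' hu hu' => simp only [mul_add, map_add, hu, hu']; abel
      | tmul c d => simp [symEuler_mul, TensorProduct.tmul_add]
  induction s using SymmetricAlgebra.induction with
  | algebraMap a =>
    simp [Algebra.algebraMap_eq_smul_one, one, Algebra.TensorProduct.one_def]
  | ι x => simp [iota, one]
  | mul s t hs ht =>
    simp only [symEuler_mul, map_add, Bialgebra.comul_mul, hs, ht, h₁, h₂]; ring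
  | add s t hs ht => simp only [map_add, hs, ht]; abel

theorem counit_of_mem_symDeg {n : ℕ} {s : SymmetricAlgebra A L} (hs : s ∈ symDeg A L (n + 1)) :
    Coalgebra.counit (R := A) s = 0 := by
  induction hs using Submodule.span_induction with
  | zero => simp
  | add s t _ _ hs ht => rw [map_add, hs, ht, add_zero]
  | smul a s _ hs => rw [map_smul, hs, smul_zero]
  | mem s h =>
    obtain ⟨l, hl, rfl⟩ := h
    rcases l with _ | ⟨x, l⟩
    · simp at hl
    · simp

/-- Coassociativity, in the component of `L ⊗ Sym ⊗ Sym`. -/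
theorem comul_symDelta (s : SymmetricAlgebra A L) :
    (Coalgebra.comul (R := A)).lTensor L (symDelta A L s) =
      TensorProduct.assoc A _ _ _ ((symDelta A L).rTensor _ (Coalgebra.comul (R := A) s)) := by
  have h (t : SymmetricAlgebra A L ⊗[A] (SymmetricAlgebra A L ⊗[A] SymmetricAlgebra A L)) :
      (symProj A L).rTensor _ t = TensorProduct.assoc A _ _ _
        (((symProj A L).rTensor (SymmetricAlgebra A L)).rTensor (SymmetricAlgebra A L)
          ((TensorProduct.assoc A _ _ _).symm t)) := by
    induction t with
    | zero => simp
    | add s t hs ht => simp only [map_add, ← hs, ← ht]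
    | tmul a t =>
      induction t with
      | zero => simp
      | add s t hs ht => simp only [TensorProduct.tmul_add, map_add, ← hs, ← ht]
      | tmul b c => simp
  have := congrArg ((symProj A L).rTensor _) (Coalgebra.coassoc_apply (R := A) s)
  rw [symDelta, LinearMap.rTensor_comp, LinearMap.comp_apply, LinearMap.comp_apply,
    ← LinearMap.comp_apply, LinearMap.lTensor_comp_rTensor, ← LinearMap.rTensor_comp_lTensor,
    LinearMap.comp_apply, ← this, h]
  simp

theorem comm_comul_sym (s : SymmetricAlgebra A L) :
    TensorProduct.comm A _ _ (Coalgebra.comul (R := A) s) = Coalgebra.comul (R := A) s :=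
  Coalgebra.comm_comul A s

end SymDeg

end LieRinehart

end

noncomputable section

namespace LieRinehart

/-! ### The filtration of the enveloping algebra -/

section EnvFilt

variable {K A L : Type u} [Field K] [CommRing A] [Algebra K A] [LieRing L] [LieAlgebra K L]
  [Module A L] [LieRingModule L A] [LieRinehartRing A L] [LieRinehartAlgebra K A L]

namespace Env

theorem ofL_mul_smul (x : L) (a : A) (D : Env K A L) :
    ofL K A L x * a • D = a • (ofL K A L x * D) + ⁅x, a⁆ • D := mulL_smul x a D

theorem prod_mem_filt {n : ℕ} {l : List L} (hl : l.length ≤ n) :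
    (l.map (ofL K A L)).prod ∈ filt K A L n :=
  Submodule.subset_span ⟨l, hl, rfl⟩

theorem filt_mono {p q : ℕ} (h : p ≤ q) : filt K A L p ≤ filt K A L q :=
  Submodule.span_mono fun _ ⟨l, hl, e⟩ ↦ ⟨l, hl.trans h, e⟩

/-- Moving `x` past a coefficient `a` costs the term `⁅x, a⁆ • D`, whose order is no larger than
that of `D`. -/
theorem ofL_mul_mem_filt (x : L) {n : ℕ} {D : Env K A L} (hD : D ∈ filt K A L n) :
    ofL K A L x * D ∈ filt K A L (n + 1) := by
  induction hD using Submodule.span_induction with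
  | zero => simp
  | add D E _ _ hD hE => rw [mul_add]; exact add_mem hD hE
  | smul a D h hD =>
    rw [ofL_mul_smul]
    exact add_mem (Submodule.smul_mem _ _ hD) (Submodule.smul_mem _ _ (filt_mono n.le_succ h))
  | mem D h =>
    obtain ⟨l, hl, rfl⟩ := h
    rw [← List.prod_cons, ← List.map_cons]
    exact prod_mem_filt (by simpa using hl)

open LieAlgebroid (prevStep)

theorem ofL_mul_mem_prevStep (x : L) {n : ℕ} {D : Env K A L}
    (hD : D ∈ prevStep (filt K A L) n) : ofL K A L x * D ∈ prevStep (filt K A L) (n + 1) := by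
  rcases n with _ | n
  · obtain rfl : D = 0 := hD
    simp
  · exact ofL_mul_mem_filt x hD

/-- Modulo lower order terms, the factors of a product of elements of `L` commute. -/
theorem prod_sub_prod_mem_prevStep {l l' : List L} (h : l.Perm l') :
    (l.map (ofL K A L)).prod - (l'.map (ofL K A L)).prod ∈
      prevStep (filt K A L) l.length := by
  induction h with
  | nil => simp
  | cons x _ ih =>
    simp only [List.map_cons, List.prod_cons, ← mul_sub, List.length_cons]
    exact ofL_mul_mem_prevStep x ih
  -- The two products differ by the product of one bracket with the common tail, which has one
  -- factor fewer; `prevStep` at `l.length + 2` is `filt` at `l.length + 1`.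
  | swap x y l =>
    simp only [List.map_cons, List.prod_cons, ← mul_assoc, ← sub_mul, ← ofL_lie, List.length_cons]
    exact ofL_mul_mem_filt _ (prod_mem_filt le_rfl)
  | trans h _ ih ih' =>
    rw [← h.length_eq] at ih'
    simpa using add_mem ih ih'

theorem iSup_filt (D : Env K A L) : ∃ n, D ∈ filt K A L n := by
  induction D using induction_left with
  | one => exact ⟨0, prod_mem_filt (l := []) (by simp)⟩
  | add D E hD hE =>
    obtain ⟨p, hp⟩ := hD
    obtain ⟨q, hq⟩ := hE
    exact ⟨max p q, add_mem (filt_mono (le_max_left _ _) hp) (filt_mono (le_max_right _ _) hq)⟩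
  | smul a D hD => exact hD.imp fun _ h ↦ Submodule.smul_mem _ _ h
  | mul x D hD =>
    obtain ⟨p, hp⟩ := hD
    exact ⟨p + 1, ofL_mul_mem_filt x hp⟩

end Env

end EnvFilt

/-! ### The transpose of `symD` and the recursion for the PBW map -/

namespace Connection

variable {K A L : Type u} [Field K] [CommRing A] [Algebra K A] [LieRing L] [LieAlgebra K L]
  [Module A L] [LieRingModule L A] [LieRinehartRing A L] [LieRinehartAlgebra K A L]

theorem symNabla_mem_symDeg (C : Connection A L) (x : L) {n : ℕ} {s : SymmetricAlgebra A L}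
    (hs : s ∈ symDeg A L n) : C.symNabla x s ∈ symDeg A L n := by
  induction hs using Submodule.span_induction with
  | zero => simp
  | add s t _ _ hs ht => rw [map_add]; exact add_mem hs ht
  | smul a s h hs =>
    rw [symNabla_smul]
    exact add_mem (Submodule.smul_mem _ _ hs) (Submodule.smul_mem _ _ h)
  | mem s h =>
    obtain ⟨l, rfl, rfl⟩ := h
    induction l with
    | nil =>
      have := C.symNabla_mul x 1 1
      simp only [one_mul, left_eq_add] at this
      simp [this]
    | cons y l ih =>
      rw [List.map_cons, List.prod_cons, symNabla_mul, symNabla_ι]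
      refine add_mem ?_ ?_
      · have := Submodule.mem_map_of_mem (f := LinearMap.mulLeft A (SymmetricAlgebra.ι A L y)) ih
        rw [symDeg, Submodule.map_span] at this
        refine Submodule.span_mono ?_ this
        rintro _ ⟨_, ⟨l, hl, rfl⟩, rfl⟩
        exact ⟨y :: l, by simpa using hl, by simp⟩
      · rw [mul_comm, ← List.prod_cons, ← List.map_cons]
        exact prod_mem_symDeg (by simp)

theorem counit_symNabla (C : Connection A L) (x : L) (s : SymmetricAlgebra A L) :
    Coalgebra.counit (R := A) (C.symNabla x s) = ⁅x, Coalgebra.counit (R := A) s⁆ := by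
  induction s using SymmetricAlgebra.induction with
  | algebraMap a => simp
  | ι y => simp
  | mul s t hs ht =>
    simp only [symNabla_mul, map_add, Bialgebra.counit_mul, hs, ht,
      LieRinehartRing.leibniz_mul_right, smul_eq_mul]
    ring
  | add s t hs ht => simp only [map_add, hs, ht, lie_add]

/-- The operator on maps `Sym_A(L) → U(L, A)` that is dual to `jetNabla`. -/
def envNabla (C : Connection A L) (p : SymmetricAlgebra A L →ₗ[A] Env K A L) :
    L →ₗ[A] SymmetricAlgebra A L →ₗ[A] Env K A L :=
  LinearMap.mk₂ A (fun x s ↦ Env.ofL K A L x * p s - p (C.symNabla x s))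
    (fun x y s ↦ by rw [map_add, add_mul, symNabla_add_left, map_add]; abel)
    (fun a x s ↦ by
      rw [Env.ofL_smul, symNabla_smul_left, map_smul, smul_sub, mul_assoc]; rfl)
    (fun x s t ↦ by simp only [map_add, mul_add]; abel)
    (fun x a s ↦ by
      rw [map_smul, Env.ofL_mul_smul, symNabla_smul, map_add, map_smul, map_smul, smul_sub]; abel)

theorem envNabla_apply (C : Connection A L) (p : SymmetricAlgebra A L →ₗ[A] Env K A L) (x : L)
    (s : SymmetricAlgebra A L) :
    C.envNabla p x s = Env.ofL K A L x * p s - p (C.symNabla x s) := rfl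

/-- The operator on maps `Sym_A(L) → U(L, A)` that is dual to `symD`. -/
def envD (C : Connection A L) (p : SymmetricAlgebra A L →ₗ[A] Env K A L) :
    SymmetricAlgebra A L →ₗ[A] Env K A L :=
  TensorProduct.lift (C.envNabla p) ∘ₗ symDelta A L

variable (K) in
/-- The terms of the series that defines the Poincaré--Birkhoff--Witt map, without denominators. -/
def pbwTerm (C : Connection A L) (n : ℕ) : SymmetricAlgebra A L →ₗ[A] Env K A L :=
  C.envD^[n] (LinearMap.toSpanSingleton A _ 1 ∘ₗ Coalgebra.counit)

theorem pbwTerm_zero (C : Connection A L) (s : SymmetricAlgebra A L) :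
    C.pbwTerm K 0 s = Coalgebra.counit (R := A) s • 1 := rfl

theorem pbwTerm_succ (C : Connection A L) (n : ℕ) :
    C.pbwTerm K (n + 1) = C.envD (C.pbwTerm K n) :=
  Function.iterate_succ_apply' _ _ _

/-- `∇⁽²⁾_X` and the second module structure both multiply the argument of a jet from the right, so
after `n` steps the argument `D` has been multiplied by an element of `U` that does not depend on
`φ`. The argument must be arbitrary, because the induction replaces `D` by `D X`. -/
theorem eval_symD_iterate (C : Connection A L) (φ : Jet K A L) (n : ℕ) (s : SymmetricAlgebra A L)
    (D : Env K A L) :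
    Jet₂.eval D ((C.symD^[n]) (Jet₂.of φ).tmulOne s) = φ (D * C.pbwTerm K n s) := by
  induction n generalizing s D with
  | zero =>
    simp only [Function.iterate_zero, id, Jet₂.tmulOne, LinearMap.comp_apply, pbwTerm_zero,
      LinearMap.toSpanSingleton_apply, Jet₂.eval_smul, Env.smul_def, mul_one]
    rfl
  | succ n ih =>
    rw [Function.iterate_succ_apply', pbwTerm_succ, symD, envD, LinearMap.comp_apply,
      LinearMap.comp_apply]
    induction symDelta A L s with
    | zero => simp
    | add t t' ht ht' => simp only [map_add, ht, ht', mul_add]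
    | tmul x s =>
      simp only [TensorProduct.lift.tmul, envNabla_apply, jetNabla, LinearMap.mk₂_apply, map_sub,
        Jet₂.eval_nabla, ih, mul_sub, mul_assoc]

/-- The counit lives in degree zero, and `envD` shifts the degree of the support by exactly one
because `∇_X` preserves the degree. -/
theorem pbwTerm_of_mem (C : Connection A L) {n k : ℕ} (h : n ≠ k) {s : SymmetricAlgebra A L}
    (hs : s ∈ symDeg A L n) : C.pbwTerm K k s = 0 := by
  induction k generalizing n s with
  | zero =>
    obtain ⟨n, rfl⟩ := Nat.exists_eq_succ_of_ne_zero h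
    rw [pbwTerm_zero, counit_of_mem_symDeg hs, zero_smul]
  | succ k ih =>
    rw [pbwTerm_succ]
    rcases n with _ | n
    · obtain ⟨a, rfl⟩ := mem_symDeg_zero hs
      simp [envD, symDelta_one]
    · refine map_symDelta_congr (TensorProduct.lift (C.envNabla (C.pbwTerm K k))) 0 n
        (fun x s hs ↦ ?_) s hs
      have h' : n ≠ k := by omega
      simp [envNabla_apply, ih h' hs, ih h' (C.symNabla_mem_symDeg x hs)]

theorem finite_support_pbwTerm (C : Connection A L) (s : SymmetricAlgebra A L) :
    (Function.support fun n : ℕ ↦ ((n.factorial : K)⁻¹) • C.pbwTerm K n s).Finite := by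
  induction s using symDeg_induction with
  | mem n s hs =>
    refine (Set.finite_singleton n).subset fun k hk ↦ ?_
    by_contra h
    exact hk (by simp [C.pbwTerm_of_mem (K := K) (Ne.symm h) hs])
  | add s t hs ht =>
    refine (hs.union ht).subset fun k hk ↦ ?_
    by_contra h
    simp only [Set.mem_union, Function.mem_support, not_or, not_not] at h
    exact hk (by simp only [map_add, smul_add, h.1, h.2, add_zero])

variable (K) in
/-- The Poincaré--Birkhoff--Witt map `Sym_A(L) → U(L, A)` of a connection. -/
def pbw (C : Connection A L) : SymmetricAlgebra A L →ₗ[A] Env K A L where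
  toFun s := ∑ᶠ n : ℕ, ((n.factorial : K)⁻¹) • C.pbwTerm K n s
  map_add' s t := by
    rw [← finsum_add_distrib (C.finite_support_pbwTerm s) (C.finite_support_pbwTerm t)]
    simp only [map_add, smul_add]
  map_smul' a s := by
    rw [RingHom.id_apply, smul_finsum' a (C.finite_support_pbwTerm s)]
    refine finsum_congr fun n ↦ ?_
    rw [map_smul, smul_comm]

theorem pbw_apply (C : Connection A L) (s : SymmetricAlgebra A L) :
    C.pbw K s = ∑ᶠ n : ℕ, ((n.factorial : K)⁻¹) • C.pbwTerm K n s := rfl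

/-- Evaluation at `D = 1` in `eval_symD_iterate`: the series for `j_∇` is `φ` applied to the series
for `pbw`. -/
theorem jPBW_apply (C : Connection A L) (φ : Jet K A L) (s : SymmetricAlgebra A L) :
    C.jPBW φ s = φ (C.pbw K s) := by
  rw [pbw_apply, map_finsum φ (C.finite_support_pbwTerm s)]
  refine finsum_congr fun n ↦ ?_
  rw [eval_symD_iterate, one_mul, LinearMap.map_smul_of_tower]

theorem pbw_of_mem (C : Connection A L) {n : ℕ} {s : SymmetricAlgebra A L}
    (hs : s ∈ symDeg A L n) : C.pbw K s = ((n.factorial : K)⁻¹) • C.pbwTerm K n s := by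
  rw [pbw_apply, finsum_eq_single _ n]
  intro k hk
  rw [C.pbwTerm_of_mem hk.symm hs, smul_zero]

theorem pbw_one (C : Connection A L) : C.pbw K 1 = 1 := by
  rw [C.pbw_of_mem (n := 0) (Submodule.subset_span ⟨[], by simp, by simp⟩), pbwTerm_zero]
  simp

/-- The recursion `n • pbw(X₁⋯Xₙ) = ∑ᵢ (Xᵢ · pbw(X₁⋯X̂ᵢ⋯Xₙ) - pbw(∇_{Xᵢ}(X₁⋯X̂ᵢ⋯Xₙ)))`. In degree `n
+ 1` the operator `envD` only sees `pbw` in degree `n`, where it is `1/n!` times a single term, and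
`1/n! = (n + 1)/(n + 1)!`. -/
theorem envD_pbw_of_mem [CharZero K] (C : Connection A L) {n : ℕ} {s : SymmetricAlgebra A L}
    (hs : s ∈ symDeg A L n) : C.envD (C.pbw K) s = n • C.pbw K s := by
  rcases n with _ | n
  · obtain ⟨a, rfl⟩ := mem_symDeg_zero hs
    simp [envD, symDelta_one]
  · have h : C.envD (C.pbw K) s = ((n.factorial : K)⁻¹) • C.pbwTerm K (n + 1) s := by
      rw [pbwTerm_succ]
      refine map_symDelta_congr (TensorProduct.lift (C.envNabla (C.pbw K)))
        (((n.factorial : K)⁻¹) • TensorProduct.lift (C.envNabla (C.pbwTerm K n))) n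
        (fun x s hs ↦ ?_) s hs
      simp only [TensorProduct.lift.tmul, LinearMap.smul_apply, envNabla_apply, C.pbw_of_mem hs,
        C.pbw_of_mem (C.symNabla_mem_symDeg x hs), smul_sub, mul_smul_comm]
    rw [h, C.pbw_of_mem hs, ← Nat.cast_smul_eq_nsmul K, smul_smul, Nat.factorial_succ]
    congr 1
    have : (n + 1 : K) ≠ 0 := by exact_mod_cast n.succ_ne_zero
    push_cast
    field_simp

/-- The recursion without reference to a degree, as an identity of linear maps that can be tensored
with another map. -/
theorem envD_pbw [CharZero K] (C : Connection A L) :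
    C.envD (C.pbw K) = C.pbw K ∘ₗ symEuler A L := by
  ext s
  induction s using symDeg_induction with
  | mem n s hs => rw [C.envD_pbw_of_mem hs, LinearMap.comp_apply, symEuler_of_mem hs, map_nsmul]
  | add s t hs ht => rw [map_add, map_add, hs, ht]

/-! ### Compatibility with counit and coproduct -/

theorem succ_smul_injective [CharZero K] {M : Type*} [AddCommGroup M] [Module K M] {n : ℕ}
    {D E : M} (h : (n + 1) • D = (n + 1) • E) : D = E := by
  rw [← Nat.cast_smul_eq_nsmul K, ← Nat.cast_smul_eq_nsmul K (n + 1) E] at h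
  exact smul_right_injective M (Nat.cast_ne_zero.2 n.succ_ne_zero) h

/-- In positive degree `ε` kills every summand of the recursion: `ε(X · pbw s)` and `ε(pbw(∇_X s))`
are both equal to the derivative `X(ε s)`, by induction and `counit_symNabla`. -/
theorem counit_pbw [CharZero K] (C : Connection A L) (s : SymmetricAlgebra A L) :
    Coalgebra.counit (R := A) (C.pbw K s) = Coalgebra.counit (R := A) s := by
  induction s using symDeg_induction with
  | add s t hs ht => simp only [map_add, hs, ht]
  | mem n s hs =>
    induction n generalizing s with
    | zero =>
      obtain ⟨a, rfl⟩ := mem_symDeg_zero hs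
      rw [map_smul, map_smul, map_smul, pbw_one]
      congr 1
      exact Env.counit_one.trans Bialgebra.counit_one.symm
    | succ n ih =>
      rw [counit_of_mem_symDeg hs]
      refine succ_smul_injective (K := K) (n := n) ?_
      rw [← map_nsmul, ← C.envD_pbw_of_mem hs, smul_zero]
      refine map_symDelta_congr (Coalgebra.counit (R := A) (A := Env K A L) ∘ₗ
        TensorProduct.lift (C.envNabla (C.pbw K))) 0 n
        (fun x s hs ↦ ?_) s hs
      rw [LinearMap.comp_apply, TensorProduct.lift.tmul, envNabla_apply, map_sub,
        ih _ (C.symNabla_mem_symDeg x hs), counit_symNabla, LinearMap.zero_apply, ← ih s hs]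
      exact sub_eq_zero.2 (Env.counit_ofL_mul x _)

/-- The extension of `∇_X` to `Sym_A(L) ⊗ Sym_A(L)`. -/
def symNabla₂ (C : Connection A L) (x : L) :
    SymmetricAlgebra A L ⊗[A] SymmetricAlgebra A L →+
      SymmetricAlgebra A L ⊗[A] SymmetricAlgebra A L :=
  TensorProduct.liftAddHom
    (AddMonoidHom.mk' (fun s ↦ AddMonoidHom.mk'
        (fun t ↦ C.symNabla x s ⊗ₜ[A] t + s ⊗ₜ[A] C.symNabla x t) (fun t t' ↦ by
        simp only [map_add, TensorProduct.tmul_add]; abel)) (fun s s' ↦ by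
        ext t
        simp only [map_add, TensorProduct.add_tmul, AddMonoidHom.mk'_apply, AddMonoidHom.add_apply]
        abel))
    (fun a s t ↦ by
      simp only [AddMonoidHom.mk'_apply, symNabla_smul, TensorProduct.add_tmul,
        TensorProduct.tmul_add, TensorProduct.smul_tmul]
      abel)

@[simp] theorem symNabla₂_tmul (C : Connection A L) (x : L) (s t : SymmetricAlgebra A L) :
    C.symNabla₂ x (s ⊗ₜ t) = C.symNabla x s ⊗ₜ t + s ⊗ₜ C.symNabla x t := rfl

theorem symNabla₂_mul (C : Connection A L) (x : L)
    (u v : SymmetricAlgebra A L ⊗[A] SymmetricAlgebra A L) :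
    C.symNabla₂ x (u * v) = u * C.symNabla₂ x v + v * C.symNabla₂ x u := by
  induction u with
  | zero => simp
  | add u u' hu hu' => simp only [add_mul, mul_add, map_add, hu, hu']; abel
  | tmul a b =>
    induction v with
    | zero => simp
    | add u u' hu hu' => simp only [add_mul, mul_add, map_add, hu, hu']; abel
    | tmul c d =>
      simp only [Algebra.TensorProduct.tmul_mul_tmul, symNabla₂_tmul, symNabla_mul, mul_add,
        TensorProduct.add_tmul, TensorProduct.tmul_add, mul_comm c a, mul_comm d b]
      abel

/-- Both sides obey the Leibniz rule along `comul`, and `∇_X` sends the primitive elements of `L` to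
elements of `L`, which are again primitive. -/
theorem comul_symNabla (C : Connection A L) (x : L) (s : SymmetricAlgebra A L) :
    Coalgebra.comul (R := A) (C.symNabla x s) = C.symNabla₂ x (Coalgebra.comul (R := A) s) := by
  have one : C.symNabla x 1 = 0 := by
    have := C.symNabla_mul x 1 1
    simp only [one_mul, left_eq_add] at this
    exact this
  induction s using SymmetricAlgebra.induction with
  | algebraMap a =>
    rw [symNabla_algebraMap, Algebra.algebraMap_eq_smul_one, Algebra.algebraMap_eq_smul_one,
      map_smul, map_smul, Bialgebra.comul_one, Algebra.TensorProduct.one_def,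
      TensorProduct.smul_tmul', TensorProduct.smul_tmul', symNabla₂_tmul, symNabla_smul, one]
    simp
  | ι y => simp [one]
  | mul s t hs ht =>
    simp only [symNabla_mul, map_add, Bialgebra.comul_mul, hs, ht, symNabla₂_mul]
  | add s t hs ht => simp only [map_add, hs, ht]

/-- Induction on the degree through the recursion. Since `Δ(X D) = (X ⊗ 1 + 1 ⊗ X) Δ(D)` and `Δ ∇_X
= ∇_X Δ`, the coproduct of the right hand side of the recursion is a sum of two parts, in which the
recursion operates on the left or on the right tensor factor. Coassociativity identifies the first
part with `(pbw ⊗ pbw)(Euler ⊗ 1)Δ`, cocommutativity the second with `(pbw ⊗ pbw)(1 ⊗ Euler)Δ`, and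
the Euler operator is a coderivation. -/
theorem comul_pbw [CharZero K] (C : Connection A L) (s : SymmetricAlgebra A L) :
    Coalgebra.comul (R := A) (C.pbw K s) =
      TensorProduct.map (C.pbw K) (C.pbw K) (Coalgebra.comul (R := A) s) := by
  -- On `x ⊗ (a ⊗ b)` the map `G₁` gives `(x · pbw a - pbw (∇_x a)) ⊗ pbw b`, and `G` adds the
  -- mirror image, with the bracketed expression formed from `b` in the right factor.
  let G₁ : L ⊗[A] (SymmetricAlgebra A L ⊗[A] SymmetricAlgebra A L) →ₗ[A]
      Env K A L ⊗[A] Env K A L :=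
    TensorProduct.map (TensorProduct.lift (C.envNabla (C.pbw K))) (C.pbw K) ∘ₗ
      (TensorProduct.assoc A _ _ _).symm.toLinearMap
  let G : L ⊗[A] (SymmetricAlgebra A L ⊗[A] SymmetricAlgebra A L) →ₗ[A]
      Env K A L ⊗[A] Env K A L :=
    G₁ + (TensorProduct.comm A _ _).toLinearMap ∘ₗ G₁ ∘ₗ
      (TensorProduct.comm A _ _).toLinearMap.lTensor L
  have hG (x : L) (t : SymmetricAlgebra A L ⊗[A] SymmetricAlgebra A L) :
      Env.mulL₂ x (TensorProduct.map (C.pbw K) (C.pbw K) t) -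
        TensorProduct.map (C.pbw K) (C.pbw K) (C.symNabla₂ x t) = G (x ⊗ₜ t) := by
    induction t with
    | zero => simp
    | add t t' ht ht' => simp only [map_add, TensorProduct.tmul_add, ← ht, ← ht']; abel
    | tmul a b =>
      simp only [TensorProduct.map_tmul, Env.mulL₂_tmul, symNabla₂_tmul, map_add, G, G₁,
        LinearMap.add_apply, LinearMap.comp_apply, LinearEquiv.coe_coe, LinearMap.lTensor_tmul,
        TensorProduct.comm_tmul, TensorProduct.assoc_symm_tmul, TensorProduct.lift.tmul,
        envNabla_apply, TensorProduct.sub_tmul, map_sub]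
      abel
  have h₁ (s : SymmetricAlgebra A L) : G₁ ((Coalgebra.comul (R := A)).lTensor L (symDelta A L s)) =
      TensorProduct.map (C.pbw K) (C.pbw K) ((symEuler A L).rTensor _
        (Coalgebra.comul (R := A) s)) := by
    simp only [G₁, LinearMap.comp_apply, comul_symDelta, LinearEquiv.coe_coe,
      LinearEquiv.symm_apply_apply]
    rw [LinearMap.map_rTensor, LinearMap.map_rTensor, ← C.envD_pbw]
    rfl
  -- By cocommutativity the flip inside the mirror term acts trivially, which reduces that term to
  -- `G₁` followed by a flip.
  have h₂ (s : SymmetricAlgebra A L) :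
      (TensorProduct.comm A _ _).toLinearMap.lTensor L
        ((Coalgebra.comul (R := A)).lTensor L (symDelta A L s)) =
      (Coalgebra.comul (R := A)).lTensor L (symDelta A L s) := by
    rw [← LinearMap.comp_apply, ← LinearMap.lTensor_comp]
    congr 2
    ext s
    exact comm_comul_sym s
  have h₃ (t : SymmetricAlgebra A L ⊗[A] SymmetricAlgebra A L) :
      TensorProduct.comm A _ _ (TensorProduct.map (C.pbw K) (C.pbw K)
        ((symEuler A L).rTensor _ t)) = TensorProduct.map (C.pbw K) (C.pbw K)
        ((symEuler A L).lTensor _ (TensorProduct.comm A _ _ t)) := by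
    induction t with
    | zero => simp
    | add t t' ht ht' => simp only [map_add, ht, ht']
    | tmul a b => simp
  have h₄ (s : SymmetricAlgebra A L) :
      G ((Coalgebra.comul (R := A)).lTensor L (symDelta A L s)) =
        TensorProduct.map (C.pbw K) (C.pbw K) (Coalgebra.comul (R := A) (symEuler A L s)) := by
    rw [comul_symEuler, map_add, ← h₁]
    simp only [G, LinearMap.add_apply, LinearMap.comp_apply, h₂, LinearEquiv.coe_coe]
    rw [h₁, h₃, comm_comul_sym]
  induction s using symDeg_induction with
  | add s t hs ht => simp only [map_add, hs, ht]
  | mem n s hs =>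
    induction n generalizing s with
    | zero =>
      obtain ⟨a, rfl⟩ := mem_symDeg_zero hs
      rw [map_smul, map_smul, map_smul, map_smul, pbw_one, Bialgebra.comul_one,
        Algebra.TensorProduct.one_def, TensorProduct.map_tmul, pbw_one]
      congr 1
      exact Env.comul_one
    | succ n ih =>
      refine succ_smul_injective (K := K) (n := n) ?_
      rw [← map_nsmul, ← C.envD_pbw_of_mem hs, ← map_nsmul, ← map_nsmul, ← symEuler_of_mem hs,
        ← h₄]
      refine map_symDelta_congr (Coalgebra.comul (R := A) (A := Env K A L) ∘ₗ
        TensorProduct.lift (C.envNabla (C.pbw K)))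
        (G ∘ₗ (Coalgebra.comul (R := A)).lTensor L) n (fun x s hs ↦ ?_) s hs
      rw [LinearMap.comp_apply, TensorProduct.lift.tmul, envNabla_apply, map_sub,
        ih _ (C.symNabla_mem_symDeg x hs), comul_symNabla, LinearMap.comp_apply,
        LinearMap.lTensor_tmul, ← hG, ← ih s hs]
      exact congrArg (· - _) (Env.comul_ofL_mul x _)

/-! ### Leading terms and surjectivity -/

section Leading

open LieAlgebroid (prevStep)

theorem pbw_mem_filt_of_mem_symDeg [CharZero K] (C : Connection A L) {n : ℕ}
    {s : SymmetricAlgebra A L} (hs : s ∈ symDeg A L n) : C.pbw K s ∈ Env.filt K A L n := by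
  induction n generalizing s with
  | zero =>
    obtain ⟨a, rfl⟩ := mem_symDeg_zero hs
    rw [map_smul, pbw_one]
    exact Submodule.smul_mem _ _ (Env.prod_mem_filt (l := []) (by simp))
  | succ n ih =>
    have h : (n + 1) • C.pbw K s ∈ Env.filt K A L (n + 1) := by
      rw [← C.envD_pbw_of_mem hs]
      refine map_symDelta_mem (TensorProduct.lift (C.envNabla (C.pbw K))) _ n
        (fun x s hs ↦ ?_) s hs
      exact sub_mem (Env.ofL_mul_mem_filt x (ih hs))
        (Env.filt_mono n.le_succ (ih (C.symNabla_mem_symDeg x hs)))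
    rw [← Nat.cast_smul_eq_nsmul K] at h
    have := Submodule.smul_of_tower_mem _ (((n + 1 : ℕ) : K)⁻¹) h
    rwa [smul_smul, inv_mul_cancel₀ (Nat.cast_ne_zero.2 n.succ_ne_zero), one_smul] at this

theorem pbw_mem_filt [CharZero K] (C : Connection A L) {n : ℕ}
    {s : SymmetricAlgebra A L} (hs : s ∈ symFilt A L n) : C.pbw K s ∈ Env.filt K A L n := by
  suffices H : symFilt A L n ≤ (Env.filt K A L n).comap (C.pbw K) from H hs
  refine Submodule.span_le.2 ?_
  rintro _ ⟨l, hl, rfl⟩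
  exact Env.filt_mono hl (C.pbw_mem_filt_of_mem_symDeg (prod_mem_symDeg rfl))

/-- In the recursion in degree `n + 1` the terms with `∇` have order at most `n`, and each of the `n
+ 1` products of `Xᵢ` with the remaining factors is a reordering of the whole product, hence equal
to it modulo lower order. Dividing by `n + 1` gives the leading term. -/
theorem pbw_prod_sub_mem [CharZero K] (C : Connection A L) {n : ℕ} {l : List L}
    (hl : l.length = n) :
    C.pbw K (l.map (SymmetricAlgebra.ι A L)).prod - (l.map (Env.ofL K A L)).prod ∈
      prevStep (Env.filt K A L) n := by
  induction n generalizing l with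
  | zero =>
    obtain rfl := List.length_eq_zero_iff.1 hl
    simp [pbw_one]
  | succ n ih =>
    -- One copy of the product is paired with each summand of the recursion.
    have hc : (n + 1) • (l.map (Env.ofL K A L)).prod =
        ∑ _i : Fin l.length, (l.map (Env.ofL K A L)).prod := by simp [hl]
    have h : (n + 1) • (C.pbw K (l.map (SymmetricAlgebra.ι A L)).prod -
        (l.map (Env.ofL K A L)).prod) ∈ prevStep (Env.filt K A L) (n + 1) := by
      rw [smul_sub, ← C.envD_pbw_of_mem (prod_mem_symDeg hl), envD, LinearMap.comp_apply,
        symDelta_prod, map_sum, hc, ← Finset.sum_sub_distrib]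
      refine Submodule.sum_mem _ fun i _ ↦ ?_
      have hi : (l.eraseIdx i).length = n := by
        rw [List.length_eraseIdx_of_lt i.2]; omega
      have e := Env.prod_sub_prod_mem_prevStep (K := K) (A := A) (perm_getElem_cons_eraseIdx l i)
      rw [List.length_cons, hi, List.map_cons, List.prod_cons] at e
      have e' := Env.ofL_mul_mem_prevStep l[i] (ih hi)
      have e'' := C.pbw_mem_filt_of_mem_symDeg (K := K)
        (C.symNabla_mem_symDeg l[i] (prod_mem_symDeg hi))
      rw [TensorProduct.lift.tmul, envNabla_apply]
      have := sub_mem (add_mem e e') (show _ ∈ prevStep (Env.filt K A L) (n + 1) from e'')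
      rw [mul_sub] at this
      convert this using 1
      abel
    rw [← Nat.cast_smul_eq_nsmul K] at h
    have := Submodule.smul_of_tower_mem _ (((n + 1 : ℕ) : K)⁻¹) h
    rwa [smul_smul, inv_mul_cancel₀ (Nat.cast_ne_zero.2 n.succ_ne_zero), one_smul] at this

/-- Subtracting from a product of elements of `L` the value of `pbw` on the corresponding monomial
leaves an element of lower order, to which the induction applies. The preimage has the same order,
which is what makes the inverse filtered. -/
theorem exists_pbw_eq [CharZero K] (C : Connection A L) {n : ℕ} {D : Env K A L}
    (hD : D ∈ Env.filt K A L n) : ∃ s ∈ symFilt A L n, C.pbw K s = D := by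
  suffices H : Env.filt K A L n ≤ (symFilt A L n).map (C.pbw K) from H hD
  clear hD
  induction n using Nat.strong_induction_on with
  | _ n ih =>
    refine Submodule.span_le.2 ?_
    rintro _ ⟨l, hl, rfl⟩
    have h := C.pbw_prod_sub_mem (K := K) (l := l) rfl
    have h' : prevStep (Env.filt K A L) l.length ≤ (symFilt A L n).map (C.pbw K) := by
      rcases hk : l.length with _ | k
      · exact bot_le
      · exact (ih k (by omega)).trans (Submodule.map_mono (symFilt_mono (by omega)))
    have := sub_mem (Submodule.mem_map_of_mem (f := C.pbw K) (prod_mem_symFilt hl)) (h' h)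
    rwa [sub_sub_cancel] at this

theorem pbw_surjective [CharZero K] (C : Connection A L) : Function.Surjective (C.pbw K) := by
  intro D
  obtain ⟨n, hn⟩ := Env.iSup_filt D
  obtain ⟨s, -, hs⟩ := C.exists_pbw_eq hn
  exact ⟨s, hs⟩

end Leading

end Connection

/-! ### Naturality of the PBW map -/

section Naturality

variable {K A L A' L' : Type u} [Field K]
  [CommRing A] [Algebra K A] [LieRing L] [LieAlgebra K L]
  [Module A L] [LieRingModule L A] [LieRinehartRing A L] [LieRinehartAlgebra K A L]
  [CommRing A'] [Algebra K A'] [LieRing L'] [LieAlgebra K L']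
  [Module A' L'] [LieRingModule L' A'] [LieRinehartRing A' L'] [LieRinehartAlgebra K A' L']
  (σ : A →ₐ[K] A') (F : LieRinehartAlgebra.Hom σ L L') (C : Connection A L) (C' : Connection A' L')

theorem Connection.pbwTerm_symMap (hC : ∀ x y, F (C.nabla x y) = C'.nabla (F x) (F y)) (n : ℕ)
    (s : SymmetricAlgebra A L) :
    C'.pbwTerm K n (symMap σ F s) = Env.map σ F (C.pbwTerm K n s) := by
  induction n generalizing s with
  | zero => rw [pbwTerm_zero, pbwTerm_zero, symMap_counit, Env.map_smul, map_one]
  | succ n ih =>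
    -- The map `F ⊗ symMap`, only additive because the tensor products are taken over different
    -- rings.
    let T : L ⊗[A] SymmetricAlgebra A L →+ L' ⊗[A'] SymmetricAlgebra A' L' :=
      TensorProduct.liftAddHom
        (AddMonoidHom.mk' (fun x ↦ AddMonoidHom.mk' (fun s ↦ F x ⊗ₜ[A'] symMap σ F s) fun s t ↦ by
          rw [map_add, TensorProduct.tmul_add]) fun x y ↦ by
          ext s
          change F.toLieHom (x + y) ⊗ₜ[A'] _ = _
          rw [map_add, TensorProduct.add_tmul]; rfl)
        (fun a x s ↦ by
          change F (a • x) ⊗ₜ[A'] _ = _ ⊗ₜ[A'] symMap σ F (a • s)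
          rw [F.map_smul_apply, symMap_smul, TensorProduct.smul_tmul])
    have hT (x : L) (s : SymmetricAlgebra A L) : T (x ⊗ₜ s) = F x ⊗ₜ symMap σ F s := rfl
    rw [pbwTerm_succ, pbwTerm_succ, envD, envD, LinearMap.comp_apply, LinearMap.comp_apply,
      symDelta_symMap σ F T hT]
    induction symDelta A L s with
    | zero => simp
    | add t t' ht ht' => simp only [map_add, ht, ht']
    | tmul x s =>
      rw [hT, TensorProduct.lift.tmul, TensorProduct.lift.tmul, envNabla_apply, envNabla_apply,
        symNabla_symMap σ F C C' hC, ih, ih, map_sub, map_mul, Env.map_ofL]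

theorem Connection.pbw_symMap (hC : ∀ x y, F (C.nabla x y) = C'.nabla (F x) (F y))
    (s : SymmetricAlgebra A L) : C'.pbw K (symMap σ F s) = Env.map σ F (C.pbw K s) := by
  rw [pbw_apply, pbw_apply, map_finsum (Env.map σ F) (C.finite_support_pbwTerm s)]
  refine finsum_congr fun n ↦ ?_
  rw [map_smul, pbwTerm_symMap σ F C C' hC]

end Naturality

end LieRinehart

end

noncomputable section

namespace LieRinehart

open MvPolynomial (monomial pderiv X)

/-! ### Partial derivatives of polynomials, for the model of the enveloping algebra -/

namespace PolyModel

section Poly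

variable {σ : Type u} {K : Type u} [Field K]

/-- The commutator of two derivations is a derivation, and this one vanishes on the variables. -/
theorem pderiv_comm (i j : σ) (s : MvPolynomial σ K) :
    pderiv i (pderiv j s) = pderiv j (pderiv i s) := by
  classical
  have h : ⁅(pderiv i : Derivation K (MvPolynomial σ K) (MvPolynomial σ K)),
      (pderiv j : Derivation K (MvPolynomial σ K) (MvPolynomial σ K))⁆ = 0 := by
    refine MvPolynomial.derivation_ext (fun k ↦ ?_)
    rw [Derivation.commutator_apply, MvPolynomial.pderiv_X, MvPolynomial.pderiv_X]
    simp [Pi.single_apply, apply_ite (pderiv (R := K) _)]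
  have := congrArg (fun D : Derivation K (MvPolynomial σ K) (MvPolynomial σ K) ↦ D s) h
  simpa [Derivation.commutator_apply, sub_eq_zero] using this

theorem pderiv_of_isHomogeneous_zero {s : MvPolynomial σ K} (hs : s.IsHomogeneous 0) (i : σ) :
    pderiv i s = 0 := by
  rw [MvPolynomial.totalDegree_eq_zero_iff_eq_C.1 (Nat.le_zero.1 hs.totalDegree_le),
    MvPolynomial.pderiv_C]

theorem isHomogeneous_X_mul {n : ℕ} {s : MvPolynomial σ K} (hs : s.IsHomogeneous n) (i : σ) :
    (X i * s).IsHomogeneous (n + 1) := by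
  rw [add_comm]
  exact (MvPolynomial.isHomogeneous_X K i).mul hs

theorem map_isHomogeneous_mem {M : Type*} [AddCommGroup M] [Module K M]
    (f : MvPolynomial σ K →ₗ[K] M) (N : Submodule K M) {n : ℕ}
    (h : ∀ m : σ →₀ ℕ, m.degree = n → f (monomial m 1) ∈ N) {s : MvPolynomial σ K}
    (hs : s.IsHomogeneous n) : f s ∈ N := by
  rw [s.as_sum, map_sum]
  refine Submodule.sum_mem _ fun m hm ↦ ?_
  rw [← mul_one (s.coeff m), ← smul_eq_mul, ← MvPolynomial.smul_monomial, map_smul]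
  exact N.smul_mem _ (h m (hs.degree_eq_sum_deg_support hm).symm)

theorem map_isHomogeneous_congr {M : Type*} [AddCommGroup M] [Module K M]
    (f g : MvPolynomial σ K →ₗ[K] M) {n : ℕ}
    (h : ∀ m : σ →₀ ℕ, m.degree = n → f (monomial m 1) = g (monomial m 1)) {s : MvPolynomial σ K}
    (hs : s.IsHomogeneous n) : f s = g s := by
  have := map_isHomogeneous_mem (f - g) ⊥ (fun m hm ↦ by simp [h m hm]) hs
  rwa [Submodule.mem_bot, LinearMap.sub_apply, sub_eq_zero] at this

end Poly

variable {σ : Type u} [Fintype σ] {K A L : Type u} [Field K] [CommRing A] [Algebra K A]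
  [LieRing L] [LieAlgebra K L]
  [Module A L] [LieRingModule L A] [LieRinehartRing A L] [LieRinehartAlgebra K A L]

/-! ### The model `A ⊗ K[z]` -/

section Model

variable (σ K A) in
/-- The polynomial algebra `A ⊗ K[z]`. -/
def Model : Type u := A ⊗[K] MvPolynomial σ K

instance : CommRing (Model σ K A) := inferInstanceAs (CommRing (A ⊗[K] MvPolynomial σ K))

instance : Algebra A (Model σ K A) := inferInstanceAs (Algebra A (A ⊗[K] MvPolynomial σ K))

instance : Algebra K (Model σ K A) := inferInstanceAs (Algebra K (A ⊗[K] MvPolynomial σ K))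

instance : IsScalarTower K A (Model σ K A) :=
  inferInstanceAs (IsScalarTower K A (A ⊗[K] MvPolynomial σ K))

/-- The inclusion of the polynomials with coefficients in `K`. -/
def inc : MvPolynomial σ K →ₐ[K] Model σ K A := Algebra.TensorProduct.includeRight

theorem smul_inc (a : A) (s : MvPolynomial σ K) :
    (a • inc s : Model σ K A) = (a ⊗ₜ[K] s : A ⊗[K] MvPolynomial σ K) :=
  (TensorProduct.smul_tmul' a (1 : A) s).trans (by rw [smul_eq_mul, mul_one])

theorem model_induction {p : Model σ K A → Prop} (smul : ∀ (a : A) s, p (a • inc s))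
    (add : ∀ f g, p f → p g → p (f + g)) (f : Model σ K A) : p f := by
  change A ⊗[K] MvPolynomial σ K at f
  induction f using TensorProduct.induction_on with
  | zero =>
    have := smul 0 0
    rwa [zero_smul] at this
  | tmul a s => exact smul_inc a s ▸ smul a s
  | add f g hf hg => exact add f g hf hg

variable (σ K A) in
/-- The action of `X` on the coefficients. -/
def der (x : L) : Model σ K A →ₗ[K] Model σ K A :=
  (LieModule.toEnd K L A x).rTensor (MvPolynomial σ K)

theorem der_smul_inc (x : L) (a : A) (s : MvPolynomial σ K) :
    der σ K A x (a • inc s) = ⁅x, a⁆ • inc s := by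
  rw [smul_inc, smul_inc]; rfl

/-- The `A`-linear extension of a map on `K[z]`. -/
def extend (w : MvPolynomial σ K →ₗ[K] Model σ K A) : Model σ K A →ₗ[A] Model σ K A :=
  LinearMap.liftBaseChange A w

theorem extend_smul_inc (w : MvPolynomial σ K →ₗ[K] Model σ K A) (a : A) (s : MvPolynomial σ K) :
    extend w (a • inc s) = a • w s := by
  rw [smul_inc]; rfl

end Model

section Filtration

variable (σ K A) in
/-- The filtration by degree of `A ⊗ K[z]`. -/
def filt (n : ℕ) : Submodule A (Model σ K A) :=
  Submodule.span A {f | ∃ k ≤ n, ∃ s : MvPolynomial σ K, s.IsHomogeneous k ∧ f = inc s}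

theorem inc_mem_filt {k n : ℕ} (h : k ≤ n) {s : MvPolynomial σ K} (hs : s.IsHomogeneous k) :
    (inc s : Model σ K A) ∈ filt σ K A n :=
  Submodule.subset_span ⟨k, h, s, hs, rfl⟩

theorem filt_mono {p q : ℕ} (h : p ≤ q) : filt σ K A p ≤ filt σ K A q :=
  Submodule.span_mono fun _ ⟨k, hk, e⟩ ↦ ⟨k, hk.trans h, e⟩

end Filtration

/-! ### Connections on the model, curvature and the Bianchi identity -/

section Action

variable (W : L →ₗ[A] MvPolynomial σ K →ₗ[K] Model σ K A)

/-- The operator `∇_X + W(X)` on `A ⊗ K[z]`, where `∇` is the trivial connection. -/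
def act (x : L) : Model σ K A →ₗ[K] Model σ K A :=
  der σ K A x + (extend (W x)).restrictScalars K

theorem act_smul_inc (x : L) (a : A) (s : MvPolynomial σ K) :
    act W x (a • inc s) = ⁅x, a⁆ • inc s + a • W x s :=
  congrArg₂ (· + ·) (der_smul_inc x a s) (extend_smul_inc (W x) a s)

theorem lie_one (x : L) : ⁅x, (1 : A)⁆ = 0 := by
  simpa using LieRinehartRing.leibniz_mul_right x (1 : A) 1

theorem act_inc (x : L) (s : MvPolynomial σ K) : act W x (inc s) = W x s := by
  have := act_smul_inc W x 1 s
  rwa [lie_one, one_smul, zero_smul, zero_add, one_smul] at this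

theorem act_smul (x : L) (a : A) (f : Model σ K A) :
    act W x (a • f) = ⁅x, a⁆ • f + a • act W x f := by
  induction f using model_induction with
  | smul b s =>
    rw [smul_smul, act_smul_inc, act_smul_inc, LieRinehartRing.leibniz_mul_right, add_smul,
      smul_add, smul_smul, smul_smul, smul_smul, smul_eq_mul]
    abel
  | add f g hf hg => simp only [smul_add, map_add, hf, hg]; abel

theorem act_add_left (x y : L) (f : Model σ K A) :
    act W (x + y) f = act W x f + act W y f := by
  induction f using model_induction with
  | smul b s =>
    rw [act_smul_inc, act_smul_inc, act_smul_inc, add_lie, add_smul, map_add,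
      LinearMap.add_apply, smul_add]
    abel
  | add f g hf hg => simp only [map_add, hf, hg]; abel

theorem act_smul_left (a : A) (x : L) (f : Model σ K A) :
    act W (a • x) f = a • act W x f := by
  induction f using model_induction with
  | smul b s =>
    rw [act_smul_inc, act_smul_inc, LieRinehartRing.lie_smul_eq_mul, map_smul,
      LinearMap.smul_apply, smul_add, mul_smul, smul_comm a b]
  | add f g hf hg => simp only [map_add, hf, hg, smul_add]

/-- The curvature of the connection `act W`. -/
def curv (x y : L) (f : Model σ K A) : Model σ K A :=
  act W x (act W y f) - act W y (act W x f) - act W ⁅x, y⁆ f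

theorem curv_add (x y : L) (f g : Model σ K A) :
    curv W x y (f + g) = curv W x y f + curv W x y g := by
  simp only [curv, map_add]; abel

/-- Tensoriality: the first derivatives of `a` cancel by antisymmetry and the second ones because
the anchor respects brackets. -/
theorem curv_smul (x y : L) (a : A) (f : Model σ K A) :
    curv W x y (a • f) = a • curv W x y f := by
  have h : ⁅⁅x, y⁆, a⁆ • f = ⁅x, ⁅y, a⁆⁆ • f - ⁅y, ⁅x, a⁆⁆ • f := by rw [lie_lie, sub_smul]
  simp only [curv, act_smul, map_add, h, smul_sub]; abel

theorem curv_skew (x y : L) (f : Model σ K A) : curv W x y f = -curv W y x f := by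
  have h : act W (⁅x, y⁆ + ⁅y, x⁆) f = 0 := by
    rw [← lie_skew y x, add_neg_cancel]
    simpa using act_smul_left W (0 : A) (0 : L) f
  rw [act_add_left] at h
  rw [curv, curv, eq_neg_of_add_eq_zero_left h]
  abel

/-- The curvature as a linear map in the second vector. -/
def curvHom (x : L) (f : Model σ K A) : L →ₗ[A] Model σ K A where
  toFun y := curv W x y f
  map_add' y z := by
    simp only [curv, lie_add, act_add_left, map_add]; abel
  map_smul' a y := by
    simp only [curv, act_smul_left, act_smul, LieRinehartRing.leibniz_smul_right, act_add_left,
      RingHom.id_apply, smul_sub]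
    abel

/-- The curvature as an `A`-linear operator. -/
def curvEnd (x y : L) : Model σ K A →ₗ[A] Model σ K A where
  toFun := curv W x y
  map_add' := curv_add W x y
  map_smul' := curv_smul W x y

theorem curv_eq_zero_of_basis (e : Module.Basis σ A L) {f : Model σ K A}
    (h : ∀ i j, curv W (e i) (e j) f = 0) (x y : L) : curv W x y f = 0 := by
  have h₁ (i : σ) : curvHom W (e i) f = 0 := e.ext fun j ↦ h i j
  have h₂ : curvHom W y f = 0 := e.ext fun i ↦ by
    change curv W y (e i) f = 0
    rw [curv_skew, neg_eq_zero]
    exact LinearMap.congr_fun (h₁ i) y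
  rw [curv_skew, neg_eq_zero]
  exact LinearMap.congr_fun h₂ x

/-- After expansion all terms cancel except the action of the Jacobi sum of `x`, `y`, `z`, which is
zero. -/
theorem bianchi (x y z : L) (f : Model σ K A) :
    (act W x (curv W y z f) - curv W y z (act W x f)) +
    (act W y (curv W z x f) - curv W z x (act W y f)) +
    (act W z (curv W x y f) - curv W x y (act W z f)) +
    (curv W x ⁅y, z⁆ f + curv W y ⁅z, x⁆ f + curv W z ⁅x, y⁆ f) = 0 := by
  have h : act W ⁅x, ⁅y, z⁆⁆ f + act W ⁅y, ⁅z, x⁆⁆ f + act W ⁅z, ⁅x, y⁆⁆ f = 0 := by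
    rw [← act_add_left, ← act_add_left, lie_jacobi]
    simpa using act_smul_left W (0 : A) (0 : L) f
  rw [← neg_eq_zero, ← h]
  simp only [curv, map_sub]
  abel

end Action

/-! ### Construction of the lower order terms -/

section Recursion

variable (e : Module.Basis σ A L)

/-- Multiplication by `z_j`, as a map from `K[z]` to `A ⊗ K[z]`. -/
def mulX (j : σ) : MvPolynomial σ K →ₗ[K] Model σ K A :=
  inc.toLinearMap ∘ₗ LinearMap.mulLeft K (X j)

variable (t : σ → MvPolynomial σ K →ₗ[K] Model σ K A)

/-- The linear map with the values `z_j + t_j` on the basis. -/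
def total : L →ₗ[A] MvPolynomial σ K →ₗ[K] Model σ K A :=
  e.constr A fun j ↦ mulX j + t j

theorem total_basis (j : σ) (s : MvPolynomial σ K) :
    total e t (e j) s = inc (X j * s) + t j s := by
  rw [total, Module.Basis.constr_basis]; rfl

/-- The right hand side of the recursion for the lower order terms `t_j`. -/
def recur (j : σ) : MvPolynomial σ K →ₗ[K] Model σ K A :=
  ∑ i, (act (total e t) (e i) ∘ₗ t j + total e t ⁅e j, e i⁆) ∘ₗ (pderiv i).toLinearMap

theorem recur_apply (j : σ) (s : MvPolynomial σ K) :
    recur e t j s = ∑ i, (act (total e t) (e i) (t j (pderiv i s)) +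
      total e t ⁅e j, e i⁆ (pderiv i s)) := by
  simp [recur]

/-- The lower order terms `t_j` preserve the degree filtration in degree `n`. -/
def PresAt (n : ℕ) : Prop := ∀ j (s : MvPolynomial σ K), s.IsHomogeneous n → t j s ∈ filt σ K A n

variable {t} in
theorem total_mem {n : ℕ} (ht : PresAt t n) (x : L) {s : MvPolynomial σ K}
    (hs : s.IsHomogeneous n) : total e t x s ∈ filt σ K A (n + 1) := by
  rw [← e.sum_repr x, map_sum, LinearMap.sum_apply]
  refine Submodule.sum_mem _ fun j _ ↦ ?_
  rw [map_smul, LinearMap.smul_apply, total_basis]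
  exact Submodule.smul_mem _ _ (add_mem (inc_mem_filt le_rfl (isHomogeneous_X_mul hs j))
    (filt_mono n.le_succ (ht j s hs)))

variable {t} in
theorem act_mem {n : ℕ} (ht : ∀ k ≤ n, PresAt t k) (x : L) {f : Model σ K A}
    (hf : f ∈ filt σ K A n) : act (total e t) x f ∈ filt σ K A (n + 1) := by
  induction hf using Submodule.span_induction with
  | zero => simp
  | add f g _ _ hf hg => rw [map_add]; exact add_mem hf hg
  | smul a f h hf =>
    rw [act_smul]
    exact add_mem (Submodule.smul_mem _ _ (filt_mono n.le_succ h)) (Submodule.smul_mem _ _ hf)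
  | mem f h =>
    obtain ⟨k, hk, s, hs, rfl⟩ := h
    rw [act_inc]
    exact filt_mono (by omega) (total_mem e (ht k hk) x hs)

variable {t} in
theorem recur_mem {n : ℕ} (ht : ∀ k < n, PresAt t k) (j : σ) {s : MvPolynomial σ K}
    (hs : s.IsHomogeneous n) : recur e t j s ∈ filt σ K A n := by
  rw [recur_apply]
  refine Submodule.sum_mem _ fun i _ ↦ ?_
  rcases n with _ | n
  · simp [pderiv_of_isHomogeneous_zero hs i]
  · have h : (pderiv i s).IsHomogeneous n := hs.pderiv
    exact add_mem (act_mem e (fun k hk ↦ ht k (by omega)) _ (ht n n.lt_succ_self _ _ h))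
      (total_mem e (ht n n.lt_succ_self) _ h)

section Congr

variable {t} {t' : σ → MvPolynomial σ K →ₗ[K] Model σ K A}

theorem total_congr {n : ℕ} (h : ∀ j (s : MvPolynomial σ K), s.IsHomogeneous n → t j s = t' j s)
    (x : L) {s : MvPolynomial σ K} (hs : s.IsHomogeneous n) : total e t x s = total e t' x s := by
  rw [← e.sum_repr x, map_sum, LinearMap.sum_apply, map_sum, LinearMap.sum_apply]
  refine Finset.sum_congr rfl fun j _ ↦ ?_
  rw [map_smul, LinearMap.smul_apply, total_basis, map_smul, LinearMap.smul_apply, total_basis,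
    h j s hs]

theorem act_congr {n : ℕ}
    (h : ∀ k ≤ n, ∀ j (s : MvPolynomial σ K), s.IsHomogeneous k → t j s = t' j s)
    (x : L) {f : Model σ K A} (hf : f ∈ filt σ K A n) :
    act (total e t) x f = act (total e t') x f := by
  induction hf using Submodule.span_induction with
  | zero => simp
  | add f g _ _ hf hg => rw [map_add, map_add, hf, hg]
  | smul a f _ hf => rw [act_smul, act_smul, hf]
  | mem f h' =>
    obtain ⟨k, hk, s, hs, rfl⟩ := h'
    rw [act_inc, act_inc, total_congr e (h k hk) x hs]

/-- The right hand side in degree `n` depends on `t` in degrees below `n` only: `∂ᵢ` lowers the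
degree first. The assumption `PresAt` is needed because `t` is applied again, inside `act`, to the
values `t_j(∂ᵢ s)`, whose degree must stay below `n`. -/
theorem recur_congr {n : ℕ} (ht : ∀ k < n, PresAt t k)
    (h : ∀ k < n, ∀ j (s : MvPolynomial σ K), s.IsHomogeneous k → t j s = t' j s)
    (j : σ) {s : MvPolynomial σ K} (hs : s.IsHomogeneous n) :
    recur e t j s = recur e t' j s := by
  rw [recur_apply, recur_apply]
  refine Finset.sum_congr rfl fun i _ ↦ ?_
  rcases n with _ | n
  · simp [pderiv_of_isHomogeneous_zero hs i]
  · have h' : (pderiv i s).IsHomogeneous n := hs.pderiv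
    rw [total_congr e (h n n.lt_succ_self) _ h', ← h n n.lt_succ_self j _ h',
      act_congr e (fun k hk ↦ h k (by omega)) _ (ht n n.lt_succ_self _ _ h')]

end Congr

/-- The lower order terms `t_j`, in degrees less than `n`. -/
def approx : ℕ → σ → MvPolynomial σ K →ₗ[K] Model σ K A
  | 0, _ => 0
  | n + 1, j => (MvPolynomial.basisMonomials σ K).constr K fun m ↦
      -- Stage `n + 1` settles the monomials of degree `n` and changes nothing else, so a value
      -- stays fixed once it has been settled. The divisor `n + 1` is the coefficient of `t_j(s)` in
      -- the radial contraction of the curvature, see `sum_curv_pderiv`.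
      if m.degree = n then ((n + 1 : ℕ) : K)⁻¹ • recur e (approx n) j (monomial m 1)
      else approx n j (monomial m 1)

/-- The lower order terms `t_j`. -/
def lower (j : σ) : MvPolynomial σ K →ₗ[K] Model σ K A :=
  (MvPolynomial.basisMonomials σ K).constr K fun m ↦ approx e (m.degree + 1) j (monomial m 1)

theorem constr_monomial (F : (σ →₀ ℕ) → Model σ K A) (m : σ →₀ ℕ) :
    (MvPolynomial.basisMonomials σ K).constr K F (monomial m 1) = F m := by
  have h : monomial m (1 : K) = MvPolynomial.basisMonomials σ K m := by
    rw [MvPolynomial.coe_basisMonomials]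
  rw [h, Module.Basis.constr_basis]

theorem lower_monomial (j : σ) (m : σ →₀ ℕ) :
    lower (K := K) e j (monomial m 1) = approx e (m.degree + 1) j (monomial m 1) :=
  constr_monomial _ m

theorem approx_succ_monomial (n : ℕ) (j : σ) (m : σ →₀ ℕ) :
    approx (K := K) e (n + 1) j (monomial m 1) =
      if m.degree = n then ((n + 1 : ℕ) : K)⁻¹ • recur e (approx e n) j (monomial m 1)
      else approx e n j (monomial m 1) :=
  constr_monomial _ m

theorem approx_eq_lower {n k : ℕ} (h : k < n) (j : σ) {s : MvPolynomial σ K}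
    (hs : s.IsHomogeneous k) : approx e n j s = lower e j s := by
  refine map_isHomogeneous_congr _ _ (fun m hm ↦ ?_) hs
  rw [lower_monomial, hm]
  induction n with
  | zero => omega
  | succ n ih =>
    rcases Nat.lt_succ_iff_lt_or_eq.1 h with h' | rfl
    · rw [approx_succ_monomial, if_neg (by omega), ih h']
    · rfl

theorem presAt_approx (n k : ℕ) : PresAt (approx (K := K) e n) k := by
  induction n generalizing k with
  | zero => intro j s _; exact zero_mem _
  | succ n ih =>
    intro j s hs
    refine map_isHomogeneous_mem _ ((filt σ K A k).restrictScalars K) (fun m hm ↦ ?_) hs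
    have h : (monomial m (1 : K)).IsHomogeneous k := MvPolynomial.isHomogeneous_monomial _ hm
    rw [approx_succ_monomial]
    split_ifs with h'
    · exact Submodule.smul_mem _ _ (recur_mem e (fun k _ ↦ ih k) j h)
    · exact ih k j _ h

theorem presAt_lower (k : ℕ) : PresAt (lower (K := K) e) k := by
  intro j s hs
  rw [← approx_eq_lower e k.lt_succ_self j hs]
  exact presAt_approx e _ _ j s hs

/-- In degree `n` the operator `recur` only sees degrees below `n`, where `approx e n` already
agrees with `lower e`. The recursive definition thus becomes an equation for `lower` alone. -/
theorem recur_lower [CharZero K] (j : σ) {n : ℕ} {s : MvPolynomial σ K} (hs : s.IsHomogeneous n) :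
    recur e (lower e) j s = (n + 1) • lower e j s := by
  refine map_isHomogeneous_congr _ ((n + 1) • lower e j) (fun m hm ↦ ?_) hs
  have h : (monomial m (1 : K)).IsHomogeneous n := MvPolynomial.isHomogeneous_monomial _ hm
  rw [LinearMap.smul_apply, lower_monomial, hm, approx_succ_monomial, if_pos hm,
    ← Nat.cast_smul_eq_nsmul K, smul_smul, mul_inv_cancel₀ (Nat.cast_ne_zero.2 n.succ_ne_zero),
    one_smul]
  exact (recur_congr e (fun k _ ↦ presAt_approx e n k)
    (fun k hk j s hs ↦ approx_eq_lower e hk j hs) j h).symm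

end Recursion

/-! ### Flatness of the constructed connection -/

section Flatness

variable (e : Module.Basis σ A L) [CharZero K]

theorem recur_lower_pderiv (j i : σ) {n : ℕ} {s : MvPolynomial σ K} (hs : s.IsHomogeneous n) :
    recur e (lower e) j (pderiv i s) = n • lower e j (pderiv i s) := by
  rcases n with _ | n
  · simp [pderiv_of_isHomogeneous_zero hs]
  · exact recur_lower e j hs.pderiv

/-- The lower order terms satisfy the radial gauge condition. -/
theorem sum_lower_pderiv (n : ℕ) {s : MvPolynomial σ K} (hs : s.IsHomogeneous n) :
    ∑ j, lower e j (pderiv j s) = 0 := by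
  induction n generalizing s with
  | zero => simp [pderiv_of_isHomogeneous_zero hs]
  | succ n ih =>
    -- The bracket is antisymmetric in `i`, `j` and the second derivative symmetric, so the double
    -- sum equals its own negative.
    have h₁ : ∑ j, ∑ i, total e (lower e) ⁅e j, e i⁆ (pderiv i (pderiv j s)) = 0 := by
      refine Connection.succ_smul_injective (K := K) (n := 1) ?_
      rw [smul_zero, add_smul, one_smul]
      nth_rw 2 [Finset.sum_comm]
      rw [← Finset.sum_add_distrib]
      refine Finset.sum_eq_zero fun j _ ↦ ?_
      rw [← Finset.sum_add_distrib]
      refine Finset.sum_eq_zero fun i _ ↦ ?_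
      rw [pderiv_comm j i, ← lie_skew, map_neg, LinearMap.neg_apply, neg_add_cancel]
    -- After exchanging the derivatives, the inner sum is the gauge condition for `∂ᵢ s`, of degree
    -- one less.
    have h₂ : ∑ j, ∑ i, act (total e (lower e)) (e i) (lower e j (pderiv i (pderiv j s))) = 0 := by
      rw [Finset.sum_comm]
      refine Finset.sum_eq_zero fun i _ ↦ ?_
      simp only [pderiv_comm i, ← map_sum]
      rw [ih hs.pderiv, map_zero]
    refine Connection.succ_smul_injective (K := K) (n := n) ?_
    rw [smul_zero, Finset.smul_sum]
    simp only [← recur_lower_pderiv e _ _ hs, recur_apply, Finset.sum_add_distrib, h₁, h₂, add_zero]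

/-- Euler's identity for the model action, since the gauge condition removes the `t_i`. It copies
the recursion `envD_pbw_of_mem` for a connection with `∇ eᵢ = 0`: the model imitates left
multiplication on `U` read through the PBW map of such a connection. -/
theorem sum_total_pderiv {n : ℕ} {s : MvPolynomial σ K} (hs : s.IsHomogeneous n) :
    ∑ i, total e (lower e) (e i) (pderiv i s) = n • (inc s : Model σ K A) := by
  simp only [total_basis, Finset.sum_add_distrib, sum_lower_pderiv e n hs, add_zero,
    ← map_sum, hs.sum_X_mul_pderiv, map_nsmul]

/-- Euler's identity for `z_j s`, with `∂ᵢ(z_j s) = δᵢⱼ s + z_j ∂ᵢ s`. -/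
theorem sum_total_X_mul_pderiv (j : σ) {n : ℕ} {s : MvPolynomial σ K} (hs : s.IsHomogeneous n) :
    ∑ i, total e (lower e) (e i) (X j * pderiv i s) =
      (n + 1) • (inc (X j * s) : Model σ K A) - total e (lower e) (e j) s := by
  classical
  rw [← sum_total_pderiv e (isHomogeneous_X_mul hs j), eq_sub_iff_add_eq]
  simp only [MvPolynomial.pderiv_mul, MvPolynomial.pderiv_X, map_add, Finset.sum_add_distrib]
  rw [add_comm]
  congr 1
  rw [Finset.sum_eq_single j (fun i _ hi ↦ by simp [hi]) (by simp)]
  simp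

/-- This is the equation that `recur` was designed to solve. Expanding the curvature and applying
Euler's identity to `s` and to `z_j s`, the terms in `z_j s` cancel and what remains is `(n + 1)
t_j(s) - recur`. -/
theorem sum_curv_pderiv (j : σ) {n : ℕ} {s : MvPolynomial σ K} (hs : s.IsHomogeneous n) :
    ∑ i, curv (total e (lower e)) (e j) (e i) (inc (pderiv i s)) = 0 := by
  have h := recur_lower e j hs
  rw [recur_apply, Finset.sum_add_distrib] at h
  simp only [curv, Finset.sum_sub_distrib, act_inc, ← map_sum]
  rw [sum_total_pderiv e hs, map_nsmul, act_inc]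
  simp only [total_basis e _ j, map_add, Finset.sum_add_distrib, act_inc]
  rw [sum_total_X_mul_pderiv e j hs, total_basis, sub_sub, add_assoc, h]
  simp only [smul_add, add_smul, one_smul]
  abel

theorem curv_of_mem_filt {n : ℕ}
    (h : ∀ k ≤ n, ∀ i j, ∀ s : MvPolynomial σ K, s.IsHomogeneous k →
      curv (total e (lower e)) (e i) (e j) (inc s) = 0) (x y : L)
    {f : Model σ K A} (hf : f ∈ filt σ K A n) :
    curv (total e (lower e)) x y f = 0 := by
  suffices H : filt σ K A n ≤ LinearMap.ker (curvEnd (total e (lower e)) x y) from H hf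
  refine Submodule.span_le.2 ?_
  rintro _ ⟨k, hk, s, hs, rfl⟩
  exact curv_eq_zero_of_basis _ e (fun i j ↦ h k hk i j s hs) x y

/-- Induction on the degree: the Bianchi identity for `eᵢ, e_j, e_k` is applied to `∂ᵢ s` and summed
over `i`. The curvature vanishes on lower degrees, so only the terms survive in which it is applied
after the action; by the two radial conditions each of these sums is a multiple of the curvature of
`e_j, e_k` on `s`, and the multiples do not cancel. -/
theorem curv_inc (n : ℕ) (j k : σ) {s : MvPolynomial σ K} (hs : s.IsHomogeneous n) :
    curv (total e (lower e)) (e j) (e k) (inc s) = 0 := by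
  classical
  induction n using Nat.strong_induction_on generalizing j k s with
  | _ n ih =>
    set W := total (K := K) e (lower e) with hW
    have zero (x y : L) : curv W x y 0 = 0 := by simp [curv]
    have kill (x y : L) (i : σ) : curv W x y (inc (pderiv i s)) = 0 := by
      rcases n with _ | n
      · rw [pderiv_of_isHomogeneous_zero hs, map_zero, zero]
      · exact curv_of_mem_filt e (fun k hk i j s hs ↦ ih k (by omega) i j hs) x y
          (inc_mem_filt le_rfl hs.pderiv)
    have kill' (x y : L) (i j : σ) : curv W x y (lower e j (pderiv i s)) = 0 := by
      rcases n with _ | n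
      · rw [pderiv_of_isHomogeneous_zero hs, map_zero, zero]
      · exact curv_of_mem_filt e (fun k hk i j s hs ↦ ih k (by omega) i j hs) x y
          (presAt_lower e n j _ hs.pderiv)
    -- Euler's identity under the curvature, which is linear over `A`.
    have sum_act (x y : L) : ∑ i, curv W x y (act W (e i) (inc (pderiv i s))) =
        n • curv W x y (inc s) := by
      have h := sum_total_pderiv e hs
      simp only [act_inc]
      exact (map_sum (curvEnd W x y) _ _).symm.trans ((congrArg _ h).trans
        (map_nsmul (curvEnd W x y) n _))
    -- The radial condition for `z_j s`: the term `δᵢⱼ s` of the product rule gives the right hand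
    -- side, and replacing `z_j` by the action of `e_j` only adds `t_j(∂ᵢ s)`, which the curvature
    -- kills by induction.
    have sum_act' (j k : σ) : ∑ i, curv W (e k) (e i) (act W (e j) (inc (pderiv i s))) =
        -curv W (e k) (e j) (inc s) := by
      have h := sum_curv_pderiv e k (isHomogeneous_X_mul hs j)
      simp only [MvPolynomial.pderiv_mul, MvPolynomial.pderiv_X, map_add, curv_add,
        Finset.sum_add_distrib] at h
      rw [Finset.sum_eq_single j (fun i _ hi ↦ by simp [hi, curv]) (by simp),
        Pi.single_eq_same, one_mul, ← hW] at h
      rw [← eq_neg_of_add_eq_zero_right h]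
      refine Finset.sum_congr rfl fun i _ ↦ ?_
      rw [act_inc, hW, total_basis, curv_add, ← hW, kill', add_zero]
    have h := Finset.sum_congr rfl fun i (_ : i ∈ Finset.univ) ↦
      bianchi W (e i) (e j) (e k) (inc (pderiv i s))
    simp only [kill, map_zero, zero_sub, add_zero, Finset.sum_add_distrib, Finset.sum_neg_distrib,
      sum_act, sum_act', Finset.sum_const_zero] at h
    simp only [curv_skew W (e _) (e j), Finset.sum_neg_distrib, sum_act'] at h
    -- The total multiple is `n + 2`: `n` from Euler's identity and one from each of the two other
    -- cyclic terms.
    refine Connection.succ_smul_injective (K := K) (n := n + 1) ?_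
    rw [smul_zero, ← neg_eq_zero, ← h]
    simp only [add_smul, one_smul, neg_neg]
    abel

theorem curv_eq_zero (x y : L) (f : Model σ K A) :
    curv (total e (lower e)) x y f = 0 := by
  refine curv_eq_zero_of_basis _ e (fun i j ↦ ?_) x y
  induction f using model_induction with
  | add f g hf hg => rw [curv_add, hf, hg, add_zero]
  | smul a s =>
    rw [curv_smul, ← MvPolynomial.sum_homogeneousComponent s, map_sum]
    have h : curv (total e (lower e)) (e i) (e j) (∑ k ∈ Finset.range (s.totalDegree + 1),
        inc (MvPolynomial.homogeneousComponent k s)) = 0 := by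
      refine (map_sum (curvEnd (total e (lower e)) (e i) (e j)) _ _).trans
        (Finset.sum_eq_zero fun k _ ↦ ?_)
      exact curv_inc e k i j (MvPolynomial.homogeneousComponent_isHomogeneous k s)
    rw [h, smul_zero]

end Flatness

/-! ### The symbol map and injectivity -/

section Symbol

variable (e : Module.Basis σ A L) [CharZero K]

/-- The action of `U(L, A)` on `A ⊗ K[z]`. -/
def rep : Env K A L →ₐ[K] Module.End K (Model σ K A) :=
  Env.lift (Algebra.lsmul K K (Model σ K A))
    (AddMonoidHom.mk' (act (total e (lower e))) fun x y ↦
      LinearMap.ext (act_add_left _ x y))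
    (fun x y ↦ LinearMap.ext fun f ↦ by
      have := curv_eq_zero e x y f
      rw [curv, sub_eq_zero] at this
      exact this.symm)
    (fun a x ↦ LinearMap.ext fun f ↦ act_smul_left (total e (lower e)) a x f)
    (fun a x ↦ LinearMap.ext fun f ↦ act_smul (total e (lower e)) x a f)

/-- The map `D ↦ D · 1` from `U(L, A)` to `A ⊗ K[z]`. -/
def symb : Env K A L →ₗ[A] Model σ K A where
  toFun D := rep e D (inc 1)
  map_add' D E := by simp
  map_smul' a D := by simp [Env.smul_def, rep]

theorem symb_one : symb (K := K) e 1 = 1 := by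
  change rep e 1 _ = _
  rw [map_one, map_one]; rfl

theorem symb_ofL_mul (x : L) (D : Env K A L) :
    symb e (Env.ofL K A L x * D) = act (total e (lower e)) x (symb e D) := by
  simp [symb, rep]

open LieAlgebroid (prevStep)

theorem one_mem_filt : (1 : Model σ K A) ∈ filt σ K A 0 := by
  rw [← map_one inc]
  exact inc_mem_filt le_rfl (MvPolynomial.isHomogeneous_one σ K)

theorem symb_mem_filt {n : ℕ} {D : Env K A L} (hD : D ∈ Env.filt K A L n) :
    symb e D ∈ filt σ K A n := by
  suffices H : Env.filt K A L n ≤ (filt σ K A n).comap (symb e) from H hD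
  refine Submodule.span_le.2 ?_
  rintro _ ⟨l, hl, rfl⟩
  change symb e (l.map (Env.ofL K A L)).prod ∈ filt σ K A n
  clear hD
  induction l generalizing n with
  | nil =>
    exact filt_mono n.zero_le
      (by simpa [symb_one] using one_mem_filt (σ := σ) (K := K) (A := A))
  | cons x l ih =>
    rcases n with _ | n
    · simp at hl
    rw [List.map_cons, List.prod_cons, symb_ofL_mul]
    exact act_mem e (fun k _ ↦ presAt_lower e k) x (ih (by simpa using hl))

/-- The map `L → A ⊗ K[z]` that sends the basis to the variables. -/
def linPart : L →ₗ[A] Model σ K A :=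
  e.constr A fun j ↦ inc (X j)

/-- Differentiating coefficients and applying the `t_j` do not raise the degree, so to leading order
`x` acts by multiplication with its linear form. -/
theorem act_sub_mul_mem (x : L) {n : ℕ} {f : Model σ K A} (hf : f ∈ filt σ K A n) :
    act (total e (lower e)) x f - linPart e x * f ∈ filt σ K A n := by
  induction hf using Submodule.span_induction with
  | zero => simp
  | add f g _ _ hf hg =>
    rw [map_add, mul_add, add_sub_add_comm]; exact add_mem hf hg
  | smul a f h hf =>
    rw [act_smul, mul_smul_comm, add_sub_assoc, ← smul_sub]
    exact add_mem (Submodule.smul_mem _ _ h) (Submodule.smul_mem _ _ hf)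
  | mem f h =>
    obtain ⟨k, hk, s, hs, rfl⟩ := h
    rw [act_inc]
    have : (LinearMap.applyₗ s ∘ₗ (total e (lower e)).restrictScalars K -
      LinearMap.mulRight K (inc s) ∘ₗ (linPart e).restrictScalars K) x ∈ filt σ K A n := by
      rw [← e.sum_repr x, map_sum]
      refine Submodule.sum_mem _ fun j _ ↦ ?_
      simp only [LinearMap.sub_apply, LinearMap.comp_apply, LinearMap.coe_restrictScalars,
        LinearMap.applyₗ_apply_apply, LinearMap.mulRight_apply, map_smul, LinearMap.smul_apply,
        smul_mul_assoc, ← smul_sub]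
      refine Submodule.smul_mem _ _ ?_
      rw [total_basis, linPart, Module.Basis.constr_basis, ← map_mul, add_sub_cancel_left]
      exact filt_mono hk (presAt_lower e k j s hs)
    exact this

theorem linPart_mul_mem (x : L) {n : ℕ} {f : Model σ K A}
    (hf : f ∈ prevStep (filt σ K A) n) : linPart e x * f ∈ prevStep (filt σ K A) (n + 1) := by
  rcases n with _ | n
  · obtain rfl : f = 0 := hf
    simp
  · have h₁ := act_sub_mul_mem e x hf
    have h₂ := act_mem e (fun k _ ↦ presAt_lower (K := K) e k) x hf
    have := sub_mem h₂ (filt_mono n.le_succ h₁)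
    rwa [sub_sub_cancel] at this

/-- The counterpart of `pbw_prod_sub_mem`: applying a product to `1` gives the commutative product
of the linear forms, up to lower degree. -/
theorem symb_prod_sub_mem (l : List L) :
    symb e (l.map (Env.ofL K A L)).prod - (l.map (linPart e)).prod ∈
      prevStep (filt σ K A) l.length := by
  induction l with
  | nil => simp [symb_one]
  | cons x l ih =>
    rw [List.map_cons, List.prod_cons, List.map_cons, List.prod_cons, symb_ofL_mul]
    have h₁ := linPart_mul_mem e x ih
    have h₂ := act_sub_mul_mem e x (symb_mem_filt e (Env.prod_mem_filt (K := K) (A := A)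
      (le_refl l.length)))
    have h₃ := add_mem h₁ (show _ ∈ prevStep (filt σ K A) (l.length + 1) from h₂)
    rwa [mul_sub, sub_add_sub_cancel'] at h₃

/-- The isomorphism of the symmetric algebra with `A ⊗ K[z]` given by a basis. -/
def symEquiv : SymmetricAlgebra A L ≃ₐ[A] Model σ K A :=
  (SymmetricAlgebra.equivMvPolynomial e).trans (MvPolynomial.algebraTensorAlgEquiv K A).symm

theorem symEquiv_ι (x : L) : symEquiv (K := K) e (SymmetricAlgebra.ι A L x) = linPart e x := by
  suffices H : (symEquiv (K := K) e).toLinearMap ∘ₗ SymmetricAlgebra.ι A L = linPart e from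
    LinearMap.congr_fun H x
  refine e.ext fun j ↦ ?_
  rw [linPart, Module.Basis.constr_basis]
  change (MvPolynomial.algebraTensorAlgEquiv K A).symm (SymmetricAlgebra.equivMvPolynomial e
    (SymmetricAlgebra.ι A L (e j))) = _
  rw [SymmetricAlgebra.equivMvPolynomial_ι_apply, MvPolynomial.algebraTensorAlgEquiv_symm_X]
  rfl

/-- Each monomial in the `z_j` is a product of images of basis vectors. This carries a bound on the
degree in the model back to `Sym`. -/
theorem filt_le_map_symFilt (n : ℕ) :
    filt σ K A n ≤ (symFilt A L n).map (symEquiv e).toLinearMap := by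
  have mono (m : σ →₀ ℕ) : ∃ l : List L, l.length = m.degree ∧
      (l.map (linPart e)).prod = (inc (monomial m (1 : K)) : Model σ K A) := by
    classical
    obtain ⟨u, rfl⟩ := Multiset.toFinsupp.surjective m
    induction u using Multiset.induction with
    | empty => exact ⟨[], by simp, by simp⟩
    | cons i u ih =>
      obtain ⟨l, hl, hl'⟩ := ih
      refine ⟨e i :: l, ?_, ?_⟩
      · rw [List.length_cons, hl, ← Multiset.singleton_add, map_add, map_add]
        simp [add_comm]
      · rw [List.map_cons, List.prod_cons, hl', linPart, Module.Basis.constr_basis,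
          ← map_mul, ← Multiset.singleton_add, map_add,
          Multiset.toFinsupp_singleton, MvPolynomial.X, MvPolynomial.monomial_mul, one_mul]
  refine Submodule.span_le.2 ?_
  rintro _ ⟨k, hk, s, hs, rfl⟩
  refine map_isHomogeneous_mem (inc.toLinearMap)
    (((symFilt A L n).map (symEquiv e).toLinearMap).restrictScalars K) (fun m hm ↦ ?_) hs
  obtain ⟨l, hl, h⟩ := mono m
  refine ⟨_, prod_mem_symFilt (l := l) (by omega), ?_⟩
  rw [AlgHom.toLinearMap_apply, ← h]
  change symEquiv e _ = _
  rw [map_list_prod, List.map_map]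
  congr 1
  exact List.map_congr_left fun x _ ↦ symEquiv_ι e x

/-- `pbw` and `symb` both preserve leading terms, so their composite differs from the isomorphism
`symEquiv` by an operator that strictly lowers the filtration. -/
theorem symb_pbw_sub_mem (C : Connection A L) {n : ℕ} {s : SymmetricAlgebra A L}
    (hs : s ∈ symFilt A L n) :
    symb e (C.pbw K s) - symEquiv e s ∈ prevStep (filt σ K A) n := by
  suffices H : symFilt A L n ≤ (prevStep (filt σ K A) n).comap
    (symb e ∘ₗ C.pbw K - (symEquiv e).toLinearMap) from H hs
  refine Submodule.span_le.2 ?_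
  rintro _ ⟨l, hl, rfl⟩
  change symb e (C.pbw K (l.map (SymmetricAlgebra.ι A L)).prod) -
    symEquiv e (l.map (SymmetricAlgebra.ι A L)).prod ∈ prevStep (filt σ K A) n
  have mono {p q : ℕ} (h : p ≤ q) : prevStep (filt σ K A) p ≤ prevStep (filt σ K A) q := by
    rcases p with _ | p
    · exact bot_le
    · obtain ⟨q, rfl⟩ := Nat.exists_eq_succ_of_ne_zero (by omega : q ≠ 0)
      exact filt_mono (by omega)
  have h₁ := mono hl (symb_prod_sub_mem (K := K) e l)
  have h₂ : symb e (C.pbw K (l.map (SymmetricAlgebra.ι A L)).prod -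
      (l.map (Env.ofL K A L)).prod) ∈ prevStep (filt σ K A) n := by
    refine mono hl ?_
    have := C.pbw_prod_sub_mem (K := K) (l := l) rfl
    generalize l.length = k at this ⊢
    rcases k with _ | k
    · rw [show _ = (0 : Env K A L) from this, map_zero]
      exact zero_mem _
    · exact symb_mem_filt e this
  have h₃ : (l.map (linPart e)).prod = symEquiv (K := K) e
      (l.map (SymmetricAlgebra.ι A L)).prod := by
    rw [map_list_prod, List.map_map]
    congr 1
    exact List.map_congr_left fun x _ ↦ (symEquiv_ι e x).symm
  rw [map_sub] at h₂
  rw [← h₃]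
  convert add_mem h₂ h₁ using 1
  abel

end Symbol

end PolyModel

/-- The Poincaré--Birkhoff--Witt theorem for Lie--Rinehart pairs, injectivity. -/
theorem Connection.pbw_injective {σ : Type u} [Fintype σ] {K A L : Type u} [Field K] [CharZero K]
    [CommRing A] [Algebra K A] [LieRing L] [LieAlgebra K L] [Module A L] [LieRingModule L A]
    [LieRinehartRing A L] [LieRinehartAlgebra K A L] (e : Module.Basis σ A L)
    (C : Connection A L) : Function.Injective (C.pbw K) := by
  rw [injective_iff_map_eq_zero]
  intro s h
  obtain ⟨n, hn⟩ := exists_mem_symFilt A L s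
  -- For `s` in the kernel, `symEquiv s` is minus the error term in `symb_pbw_sub_mem`. A kernel
  -- element of order `n` therefore has order `n - 1`, and the descent ends in `F_{-1} = 0`.
  induction n with
  | zero =>
    have := PolyModel.symb_pbw_sub_mem (K := K) e C hn
    rw [h, map_zero, zero_sub] at this
    have := neg_eq_zero.1 (show _ = (0 : _) from this)
    simpa using this
  | succ n ih =>
    have := PolyModel.symb_pbw_sub_mem (K := K) e C hn
    rw [h, map_zero, zero_sub] at this
    obtain ⟨u, hu, e'⟩ := PolyModel.filt_le_map_symFilt e n ((neg_mem_iff).1 this)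
    exact ih ((PolyModel.symEquiv (K := K) e).injective e' ▸ hu)

end LieRinehart

end

noncomputable section

open Opposite MonoidalCategory

namespace LieAlgebroid

/-! ### Local nature of sections and morphisms of associated sheaves -/

section Local

variable {X : RingedSpace.{u, u}}

theorem exists_resₚ_eq_toShf (P : PMod X) {V : Opens X}
    (s : (SMod.pre ((shf X).obj P)).obj (op V)) {x : X} (hx : x ∈ V) :
    ∃ (W : Opens X) (h : W ≤ V), x ∈ W ∧ ∃ p : P.obj (op W),
      resₚ _ h s = (toShf P).app (op W) p := by
  have : Presheaf.IsLocallySurjective (Opens.grothendieckTopology X)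
      (CategoryTheory.toSheafify (Opens.grothendieckTopology X) P.presheaf) := inferInstance
  obtain ⟨W, i, ⟨p, hp⟩, hxW⟩ := this.imageSieve_mem (U := V) s x hx
  exact ⟨W, i.le, hxW, p, hp.symm⟩

theorem exists_resₚ_eq_of_toShf_eq (P : PMod X) {V : Opens X} {p q : P.obj (op V)}
    (h : (toShf P).app (op V) p = (toShf P).app (op V) q) {x : X} (hx : x ∈ V) :
    ∃ (W : Opens X) (h : W ≤ V), x ∈ W ∧ resₚ P h p = resₚ P h q := by
  have : Presheaf.IsLocallyInjective (Opens.grothendieckTopology X)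
      (CategoryTheory.toSheafify (Opens.grothendieckTopology X) P.presheaf) := inferInstance
  obtain ⟨W, i, hi, hxW⟩ := this.equalizerSieve_mem (X := op V) p q h x hx
  exact ⟨W, i.le, hxW, hi⟩

theorem SMod.section_ext (M : SMod X) {V : Opens X} {s t : (SMod.pre M).obj (op V)}
    (h : ∀ x ∈ V, ∃ (W : Opens X) (h : W ≤ V), x ∈ W ∧ resₚ _ h s = resₚ _ h t) : s = t := by
  refine M.isSheaf.isSeparated V (Presheaf.equalizerSieve (F := M.val.presheaf) (X := op V) s t)
    (fun x hx ↦ ?_) s t fun W i (hi : (SMod.pre M).map i.op s = (SMod.pre M).map i.op t) ↦ hi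
  obtain ⟨W, i, hxW, e⟩ := h x hx
  exact ⟨W, homOfLE i, e, hxW⟩

theorem structureSheaf_ext {V : Opens X} {a b : X.presheaf.obj (op V)}
    (h : ∀ x ∈ V, ∃ (W : Opens X) (h : W ≤ V), x ∈ W ∧
      X.presheaf.map (homOfLE h).op a = X.presheaf.map (homOfLE h).op b) : a = b :=
  SMod.section_ext (SheafOfModules.unit (ringSheaf X)) h

theorem shf_map_toShf {P Q : PMod X} (g : P ⟶ Q) (V : Opens X) (p : P.obj (op V)) :
    (SMod.preMap ((shf X).map g)).app (op V) ((toShf P).app (op V) p) =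
      (toShf Q).app (op V) (g.app (op V) p) := by
  have := (shfAdj X).unit.naturality g
  exact congrArg (fun k ↦ (k.app (op V)).hom p) this.symm

theorem shf_hom_ext {P : PMod X} {M : SMod X} {f g : (shf X).obj P ⟶ M}
    (h : ∀ (V : Opens X) (p : P.obj (op V)), (SMod.preMap f).app (op V) ((toShf P).app (op V) p) =
      (SMod.preMap g).app (op V) ((toShf P).app (op V) p)) : f = g := by
  apply ((shfAdj X).homEquiv P M).injective
  ext V p
  exact h V.unop p

/-- Sheafification inverts locally bijective morphisms of abelian presheaves, and the passage from
sheaves of modules to sheaves of abelian groups reflects isomorphisms. -/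
theorem isIso_shf_map {P Q : PMod X} (g : P ⟶ Q)
    (inj : ∀ (V : Opens X) (p q : P.obj (op V)), g.app (op V) p = g.app (op V) q → ∀ x ∈ V,
      ∃ (W : Opens X) (h : W ≤ V), x ∈ W ∧ resₚ P h p = resₚ P h q)
    (surj : ∀ (V : Opens X) (q : Q.obj (op V)), ∀ x ∈ V,
      ∃ (W : Opens X) (h : W ≤ V), x ∈ W ∧ ∃ p, g.app (op W) p = resₚ Q h q) :
    IsIso ((shf X).map g) := by
  let g' := (PresheafOfModules.toPresheaf _).map g
  have h₁ : Presheaf.IsLocallyInjective (Opens.grothendieckTopology X) g' := by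
    constructor
    intro V p q h x hx
    obtain ⟨W, i, hxW, e⟩ := inj V.unop p q h x hx
    exact ⟨W, homOfLE i, e, hxW⟩
  have h₂ : Presheaf.IsLocallySurjective (Opens.grothendieckTopology X) g' := by
    constructor
    intro V q x hx
    obtain ⟨W, i, hxW, p, e⟩ := surj V q x hx
    exact ⟨W, homOfLE i, ⟨p, e⟩, hxW⟩
  have h₃ := (Opens.grothendieckTopology X).W_of_isLocallyBijective g'
  have h₄ := ((Opens.grothendieckTopology X).W_iff g').1 h₃
  -- The abelian sheaf underlying the sheafified module map is, by definition, the sheafification of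
  -- `g'`.
  have h₅ : IsIso ((SheafOfModules.toSheaf (ringSheaf X)).map ((shf X).map g)) := h₄
  exact isIso_of_reflects_iso _ (SheafOfModules.toSheaf (ringSheaf X))

end Local

/-! ### Extension of functionals to the associated sheaf -/

section Extension

variable {X : RingedSpace.{u, u}} {P : PMod X} {V : Opens X} (φ : Functional P V)

namespace Functional

/-- Two representatives of one section need only agree locally on the overlap, but their values lie
in the sheaf `𝓞`, where local equality suffices. This is the gluing condition in `exists_isValue`.
-/
theorem map_app_eq_map_app {W W₁ W₂ : Opens X} (h : W ≤ V) (h₁ : W₁ ≤ W) (h₂ : W₂ ≤ W)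
    {s : (SMod.pre ((shf X).obj P)).obj (op W)} {p : P.obj (op W₁)} {q : P.obj (op W₂)}
    (hp : resₚ _ h₁ s = (toShf P).app (op W₁) p) (hq : resₚ _ h₂ s = (toShf P).app (op W₂) q) :
    X.presheaf.map (homOfLE (inf_le_left : W₁ ⊓ W₂ ≤ W₁)).op (φ.app W₁ (h₁.trans h) p) =
      X.presheaf.map (homOfLE (inf_le_right : W₁ ⊓ W₂ ≤ W₂)).op (φ.app W₂ (h₂.trans h) q) := by
  rw [← φ.app_res, ← φ.app_res]
  refine structureSheaf_ext fun x hx ↦ ?_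
  obtain ⟨W', h', hxW, e⟩ := exists_resₚ_eq_of_toShf_eq P
    (p := resₚ P (inf_le_left : W₁ ⊓ W₂ ≤ W₁) p) (q := resₚ P (inf_le_right : W₁ ⊓ W₂ ≤ W₂) q) (by
      rw [← resₚ_toShf, ← resₚ_toShf, ← hp, ← hq, resₚ_resₚ, resₚ_resₚ]) hx
  refine ⟨W', h', hxW, ?_⟩
  rw [← φ.app_res, ← φ.app_res, e]

/-- `a` is the value at `s` of the extension of `φ` to the associated sheaf. -/
def IsValue {W : Opens X} (h : W ≤ V) (s : (SMod.pre ((shf X).obj P)).obj (op W))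
    (a : X.presheaf.obj (op W)) : Prop :=
  ∀ x ∈ W, ∃ (W' : Opens X) (h' : W' ≤ W), x ∈ W' ∧ ∃ p : P.obj (op W'),
    resₚ _ h' s = (toShf P).app (op W') p ∧
      X.presheaf.map (homOfLE h').op a = φ.app W' (h'.trans h) p

variable {φ}

theorem IsValue.unique {W : Opens X} {h : W ≤ V} {s : (SMod.pre ((shf X).obj P)).obj (op W)}
    {a b : X.presheaf.obj (op W)} (ha : φ.IsValue h s a) (hb : φ.IsValue h s b) : a = b := by
  refine structureSheaf_ext fun x hx ↦ ?_
  obtain ⟨W₁, h₁, hx₁, p, hp, e₁⟩ := ha x hx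
  obtain ⟨W₂, h₂, hx₂, q, hq, e₂⟩ := hb x hx
  refine ⟨W₁ ⊓ W₂, inf_le_left.trans h₁, ⟨hx₁, hx₂⟩, ?_⟩
  have := φ.map_app_eq_map_app h h₁ h₂ hp hq
  rw [← e₁, ← e₂] at this
  simp only [← ConcreteCategory.comp_apply, ← X.presheaf.map_comp] at this
  exact this

theorem IsValue.res {W W' : Opens X} {h : W ≤ V} (h' : W' ≤ W)
    {s : (SMod.pre ((shf X).obj P)).obj (op W)} {a : X.presheaf.obj (op W)}
    (ha : φ.IsValue h s a) :
    φ.IsValue (h'.trans h) (resₚ _ h' s) (X.presheaf.map (homOfLE h').op a) := by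
  intro x hx
  obtain ⟨W₁, h₁, hx₁, p, hp, e₁⟩ := ha x (h' hx)
  refine ⟨W₁ ⊓ W', inf_le_right, ⟨hx₁, hx⟩, resₚ P inf_le_left p, ?_, ?_⟩
  · rw [← resₚ_toShf, ← hp, resₚ_resₚ, resₚ_resₚ]
  · rw [φ.app_res (h₁.trans h) inf_le_left, ← e₁]
    simp only [← ConcreteCategory.comp_apply, ← X.presheaf.map_comp]
    rfl

theorem IsValue.add {W : Opens X} {h : W ≤ V} {s t : (SMod.pre ((shf X).obj P)).obj (op W)}
    {a b : X.presheaf.obj (op W)} (ha : φ.IsValue h s a) (hb : φ.IsValue h t b) :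
    φ.IsValue h (s + t) (a + b) := by
  intro x hx
  obtain ⟨W₁, h₁, hx₁, p, hp, e₁⟩ := ha x hx
  obtain ⟨W₂, h₂, hx₂, q, hq, e₂⟩ := hb x hx
  refine ⟨W₁ ⊓ W₂, inf_le_left.trans h₁, ⟨hx₁, hx₂⟩,
    resₚ P inf_le_left p + resₚ P inf_le_right q, ?_, ?_⟩
  · rw [map_add, ← resₚ_toShf, ← resₚ_toShf, ← hp, ← hq, resₚ_resₚ, resₚ_resₚ]
    exact resₚ_add _ _ _ _
  · rw [map_add, map_add, φ.app_res (h₁.trans h) inf_le_left, φ.app_res (h₂.trans h) inf_le_right,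
      ← e₁, ← e₂]
    simp only [← ConcreteCategory.comp_apply, ← X.presheaf.map_comp]
    rfl

theorem IsValue.smul {W : Opens X} {h : W ≤ V} {s : (SMod.pre ((shf X).obj P)).obj (op W)}
    {a : X.presheaf.obj (op W)} (b : X.presheaf.obj (op W)) (ha : φ.IsValue h s a) :
    φ.IsValue h (b • s) (b * a) := by
  intro x hx
  obtain ⟨W₁, h₁, hx₁, p, hp, e₁⟩ := ha x hx
  refine ⟨W₁, h₁, hx₁, X.presheaf.map (homOfLE h₁).op b • p, ?_, ?_⟩
  · rw [resₚ, PresheafOfModules.map_smul]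
    rw [resₚ] at hp
    rw [hp]
    exact (LinearMap.map_smul ((toShf P).app (op W₁)).hom _ p).symm
  · rw [map_mul, e₁, map_smul, smul_eq_mul]

variable (φ)

theorem isValue_toShf {W : Opens X} (h : W ≤ V) (p : P.obj (op W)) :
    φ.IsValue h ((toShf P).app (op W) p) (φ.app W h p) :=
  fun _ hx ↦ ⟨W, le_rfl, hx, resₚ P le_rfl p, resₚ_toShf P le_rfl p, (φ.app_res h le_rfl p).symm⟩

theorem exists_isValue {W : Opens X} (h : W ≤ V) (s : (SMod.pre ((shf X).obj P)).obj (op W)) :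
    ∃ a, φ.IsValue h s a := by
  -- The cover is indexed by all representatives of `s` on open subsets of `W`, so that no choice of
  -- a representative at each point is needed.
  let ι : Type u := Σ W' : Opens X, {p : P.obj (op W') // ∃ h' : W' ≤ W,
    resₚ _ h' s = (toShf P).app (op W') p}
  have hι (i : ι) : i.1 ≤ W := i.2.2.choose
  obtain ⟨a, ha, -⟩ := TopCat.Sheaf.existsUnique_gluing' X.sheaf (fun i : ι ↦ i.1) W
    (fun i ↦ homOfLE (hι i)) (fun x hx ↦ by
      obtain ⟨W', h', hxW, p, hp⟩ := exists_resₚ_eq_toShf P s hx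
      exact Opens.mem_iSup.2 ⟨⟨W', p, h', hp⟩, hxW⟩)
    (fun i ↦ φ.app i.1 ((hι i).trans h) i.2.1)
    (fun i j ↦ φ.map_app_eq_map_app h (hι i) (hι j) i.2.2.choose_spec j.2.2.choose_spec)
  refine ⟨a, fun x hx ↦ ?_⟩
  obtain ⟨W', h', hxW, p, hp⟩ := exists_resₚ_eq_toShf P s hx
  exact ⟨W', h', hxW, p, hp, ha ⟨W', p, h', hp⟩⟩

/-- The extension of a functional to the associated sheaf. -/
def extend : Functional (SMod.pre ((shf X).obj P)) V where
  app _ h :=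
    { toFun s := (φ.exists_isValue h s).choose
      map_add' s t := (φ.exists_isValue h (s + t)).choose_spec.unique
        ((φ.exists_isValue h s).choose_spec.add (φ.exists_isValue h t).choose_spec)
      map_smul' b s := (φ.exists_isValue h (b • s)).choose_spec.unique
        ((φ.exists_isValue h s).choose_spec.smul b) }
  app_res h h' s := (φ.exists_isValue _ _).choose_spec.unique
    ((φ.exists_isValue h s).choose_spec.res h')

theorem extend_toShf {W : Opens X} (h : W ≤ V) (p : P.obj (op W)) :
    φ.extend.app W h ((toShf P).app (op W) p) = φ.app W h p :=
  (φ.exists_isValue h _).choose_spec.unique (φ.isValue_toShf h p)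

variable {Q : PMod X}

/-- The composition of a functional with a morphism. -/
def comp (ψ : Functional Q V) (g : P ⟶ Q) : Functional P V where
  app W h := ψ.app W h ∘ₗ (g.app (op W)).hom
  app_res h h' s := by
    rw [LinearMap.comp_apply, LinearMap.comp_apply, ← ψ.app_res h h']
    exact congrArg _ (PresheafOfModules.naturality_apply g (homOfLE h').op s)

end Functional

end Extension

end LieAlgebroid

end

noncomputable section

open Opposite MonoidalCategory

namespace LieRinehart

/-! ### Coordinates on `Sym(𝓛)` over a frame -/

section SymMap

variable {K A L A' L' : Type u} [Field K]
  [CommRing A] [Algebra K A] [LieRing L] [LieAlgebra K L]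
  [Module A L] [LieRingModule L A] [LieRinehartRing A L] [LieRinehartAlgebra K A L]
  [CommRing A'] [Algebra K A'] [LieRing L'] [LieAlgebra K L']
  [Module A' L'] [LieRingModule L' A'] [LieRinehartRing A' L'] [LieRinehartAlgebra K A' L']
  (σ : A →ₐ[K] A') (F : LieRinehartAlgebra.Hom σ L L')

/-- Polynomial coordinates with respect to compatible bases commute with restriction; this makes
`IsFrame.coeff` a functional. -/
theorem equivMvPolynomial_symMap {κ : Type*} [Finite κ] (b : Module.Basis κ A L)
    (b' : Module.Basis κ A' L') (h : ∀ i, F (b i) = b' i) (s : SymmetricAlgebra A L) :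
    SymmetricAlgebra.equivMvPolynomial b' (symMap σ F s) =
      MvPolynomial.map (σ : A →+* A') (SymmetricAlgebra.equivMvPolynomial b s) := by
  obtain ⟨p, rfl⟩ := (SymmetricAlgebra.equivMvPolynomial b).symm.surjective s
  rw [AlgEquiv.apply_symm_apply]
  induction p using MvPolynomial.induction_on with
  | C a =>
    rw [← MvPolynomial.algebraMap_eq, AlgEquiv.commutes, symMap_algebraMap, AlgEquiv.commutes,
      MvPolynomial.algebraMap_eq, MvPolynomial.algebraMap_eq, MvPolynomial.map_C]
    rfl
  | add p q hp hq => simp only [map_add, hp, hq]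
  | mul_X p i hp =>
    have : (SymmetricAlgebra.equivMvPolynomial b).symm (MvPolynomial.X i) =
        SymmetricAlgebra.ι A L (b i) := by
      simp [SymmetricAlgebra.equivMvPolynomial]
    rw [map_mul, map_mul, map_mul, map_mul, hp, this, symMap_ι, h, MvPolynomial.map_X]
    congr 1
    simp [SymmetricAlgebra.equivMvPolynomial]

end SymMap

end LieRinehart

namespace LieAlgebroid

open LieRinehart

variable {K : Type u} [Field K] {X : RingedSpace.{u, u}} [KRingedSpace K X]

section Frame

variable (L : LieAlgebroid K X)

/-- A frame of `𝓛` over `V`. -/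
def IsFrame {r : ℕ} {V : Opens X} (e : Fin r → L.sec V) : Prop :=
  ∀ (W : Opens X) (h : W ≤ V),
    Function.Bijective fun a : Fin r → X.presheaf.obj (op W) ↦ ∑ i, a i • L.res h (e i)

variable {L} {r : ℕ} {V : Opens X} {e : Fin r → L.sec V} (he : L.IsFrame e)
include he

namespace IsFrame

/-- The basis of the sections over `W ≤ V` given by a frame over `V`. -/
def basis {W : Opens X} (h : W ≤ V) :
    Module.Basis (Fin r) (X.presheaf.obj (op W)) (L.sec W) :=
  .ofEquivFun (LinearEquiv.ofBijective
    (Fintype.linearCombination (X.presheaf.obj (op W)) fun i ↦ L.res h (e i)) (he W h)).symm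

theorem basis_apply {W : Opens X} (h : W ≤ V) (i : Fin r) : he.basis h i = L.res h (e i) := by
  rw [basis, Module.Basis.coe_ofEquivFun]
  exact (Fintype.linearCombination_apply_single _ _ i 1).trans (one_smul _ _)

theorem mono {W : Opens X} (h : W ≤ V) : L.IsFrame fun i ↦ L.res h (e i) := by
  intro W' h'
  simpa only [L.res_res] using he W' (h'.trans h)

/-- The coefficients of the elements of the symmetric algebras with respect to a frame. -/
def coeff (m : Fin r →₀ ℕ) : Functional L.symPresheaf V where
  app W h := MvPolynomial.lcoeff _ m ∘ₗ
    (SymmetricAlgebra.equivMvPolynomial (he.basis h)).toLinearMap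
  app_res {W W'} h h' s := by
    exact (congrArg (MvPolynomial.coeff m) (equivMvPolynomial_symMap (KRingedSpace.res K X h')
      (L.res h') (he.basis h) (he.basis (h'.trans h)) (fun i ↦ by
        rw [he.basis_apply, he.basis_apply, L.res_res]) s)).trans (MvPolynomial.coeff_map _ _ _)

theorem eq_zero_of_coeff {W : Opens X} (h : W ≤ V)
    (s : SymmetricAlgebra (X.presheaf.obj (op W)) (L.sec W))
    (hs : ∀ m, (he.coeff m).app W h s = 0) : s = 0 := by
  apply (SymmetricAlgebra.equivMvPolynomial (he.basis h)).injective
  rw [map_zero]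
  ext m
  exact hs m

/-- A section of `Sym(𝓛)` is locally a polynomial in the frame, and a polynomial is determined by
its coefficients. The functionals are defined on the presheaf, so their extensions to the sheaf are
used. -/
theorem section_eq {s t : (SMod.pre L.symSheaf).obj (op V)}
    (h : ∀ m, (he.coeff m).extend.app V le_rfl s = (he.coeff m).extend.app V le_rfl t) :
    s = t := by
  rw [← sub_eq_zero]
  refine SMod.section_ext _ fun x hx ↦ ?_
  obtain ⟨W, hW, hxW, p, hp⟩ := exists_resₚ_eq_toShf L.symPresheaf (s - t) hx
  refine ⟨W, hW, hxW, hp.trans ?_⟩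
  have : p = 0 := he.eq_zero_of_coeff hW p fun m ↦ by
    have h₀ := (map_sub ((he.coeff m).extend.app V le_rfl) s t).trans (sub_eq_zero.2 (h m))
    have h₁ := ((he.coeff m).extend.app_res le_rfl hW (s - t)).trans
      ((congrArg (X.presheaf.map (homOfLE hW).op) h₀).trans (map_zero _))
    exact ((he.coeff m).extend_toShf hW p).symm.trans
      ((congrArg ((he.coeff m).extend.app W _) hp.symm).trans h₁)
  rw [this]
  exact (map_zero ((toShf L.symPresheaf).app (op W)).hom).trans
    (map_zero ((SMod.pre L.symSheaf).map (homOfLE hW).op).hom).symm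

end IsFrame

end Frame

variable {L : LieAlgebroid K X}

theorem IsLocallyFree.exists_isFrame {r : ℕ} (hL : L.IsLocallyFree r) {V : Opens X} {x : X}
    (hx : x ∈ V) : ∃ (W : Opens X) (_ : W ≤ V) (e : Fin r → L.sec W), x ∈ W ∧ L.IsFrame e := by
  obtain ⟨U, hxU, e, he : L.IsFrame e⟩ := hL x
  exact ⟨V ⊓ U, inf_le_left, _, ⟨hx, hxU⟩, he.mono inf_le_right⟩

variable [CharZero K] (C : L.SheafConnection)

/-! ### The sheaf morphism dual to `j_∇` -/

namespace SheafConnection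

/-- The Poincaré--Birkhoff--Witt maps of the Lie--Rinehart pairs `(𝓞(V), 𝓛(V))`. -/
def pbwPresheaf : L.symPresheaf ⟶ L.envPresheaf where
  app V := ModuleCat.ofHom (R := X.presheaf.obj (op V.unop)) ((C.conn V.unop).pbw K)
  naturality {V W} f := by
    ext s
    exact Connection.pbw_symMap (KRingedSpace.res K X f.unop.le) (L.res f.unop.le) (C.conn V.unop)
      (C.conn W.unop) (C.res_nabla f.unop.le) s

/-- The Poincaré--Birkhoff--Witt map `j_∇^*`. -/
def pbw : L.symSheaf ⟶ L.envSheaf := (shf X).map C.pbwPresheaf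

theorem pbw_toSym (V : Opens X) (s : SymmetricAlgebra (X.presheaf.obj (op V)) (L.sec V)) :
    (SMod.preMap C.pbw).app (op V) (L.toSym V s) = L.toEnv V ((C.conn V).pbw K s) :=
  shf_map_toShf C.pbwPresheaf V s

theorem isDual_pbw : C.IsDual C.pbw := by
  intro V φ s
  rw [pbw_toSym]
  exact ((C.conn V).jPBW_apply (φ.jet V le_rfl) s).symm

end SheafConnection

end LieAlgebroid

end

noncomputable section

open Opposite MonoidalCategory

namespace LieRinehart

/-! ### Isomorphism, uniqueness, comonoid structure and graded map -/

open LieAlgebroid (prevStep)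

/-- All `p!` orderings of the factors have the same leading term as `pbw`, hence so does their
average. -/
theorem Connection.pbw_prod_sub_symmetrization_mem {K A L : Type u} [Field K] [CharZero K]
    [CommRing A] [Algebra K A] [LieRing L] [LieAlgebra K L] [Module A L] [LieRingModule L A]
    [LieRinehartRing A L] [LieRinehartAlgebra K A L] (C : Connection A L) {p : ℕ} (x : Fin p → L) :
    C.pbw K (List.ofFn fun i ↦ SymmetricAlgebra.ι A L (x i)).prod -
      (p.factorial : K)⁻¹ • ∑ σ : Equiv.Perm (Fin p),
        (List.ofFn fun i ↦ Env.ofL K A L (x (σ i))).prod ∈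
      prevStep (Env.filt K A L) p := by
  have h : C.pbw K (List.ofFn fun i ↦ SymmetricAlgebra.ι A L (x i)).prod =
      (p.factorial : K)⁻¹ • ∑ _σ : Equiv.Perm (Fin p),
        C.pbw K (List.ofFn fun i ↦ SymmetricAlgebra.ι A L (x i)).prod := by
    rw [Finset.sum_const, Finset.card_univ, Fintype.card_perm, Fintype.card_fin,
      ← Nat.cast_smul_eq_nsmul K, inv_smul_smul₀ (Nat.cast_ne_zero.2 p.factorial_ne_zero)]
  rw [h, ← smul_sub, ← Finset.sum_sub_distrib]
  refine Submodule.smul_of_tower_mem _ _ (Submodule.sum_mem _ fun σ _ ↦ ?_)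
  have h₁ := C.pbw_prod_sub_mem (K := K) (l := List.ofFn x) List.length_ofFn
  have h₂ := Env.prod_sub_prod_mem_prevStep (K := K) (A := A) (σ.ofFn_comp_perm x).symm
  rw [List.length_ofFn] at h₂
  simp only [List.map_ofFn] at h₁ h₂
  have h₃ := add_mem h₁ h₂
  rw [sub_add_sub_cancel] at h₃
  exact h₃

end LieRinehart

namespace LieAlgebroid

open LieRinehart

variable {K : Type u} [Field K] [CharZero K] {X : RingedSpace.{u, u}} [KRingedSpace K X]
  {L : LieAlgebroid K X}

theorem IsFrame.pbw_injective {r : ℕ} {V : Opens X} {e : Fin r → L.sec V} (he : L.IsFrame e)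
    (C : Connection (X.presheaf.obj (op V)) (L.sec V)) : Function.Injective (C.pbw K) :=
  -- The polynomial model takes its index type in universe `u`, hence the lift of `Fin r`.
  Connection.pbw_injective ((he.basis le_rfl).reindex Equiv.ulift.{u}.symm) C

namespace SheafConnection

variable (C : L.SheafConnection) {r : ℕ} (hL : L.IsLocallyFree r)
include hL

/-- Injectivity uses a frame and so is obtained after restriction to a smaller neighbourhood;
surjectivity holds over every open set. -/
theorem isIso_pbw : IsIso C.pbw := by
  refine isIso_shf_map C.pbwPresheaf (fun V p q h x hx ↦ ?_) (fun V q x hx ↦ ?_)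
  · obtain ⟨W, h', e, hxW, he⟩ := hL.exists_isFrame hx
    refine ⟨W, h', hxW, he.pbw_injective (C.conn W) ?_⟩
    have := congrArg (resₚ L.envPresheaf h') h
    exact (PresheafOfModules.naturality_apply C.pbwPresheaf (homOfLE h').op p).trans
      (this.trans (PresheafOfModules.naturality_apply C.pbwPresheaf (homOfLE h').op q).symm)
  · obtain ⟨s, hs⟩ := (C.conn V).pbw_surjective (K := K) q
    exact ⟨V, le_rfl, hx, s, hs.trans (L.env_map_refl q).symm⟩

theorem onSections_pbw_injective (V : Opens X) : Function.Injective (onSections C.pbw V) := by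
  have := C.isIso_pbw hL
  intro s t h
  have h' := congrArg ((SMod.preMap (inv C.pbw)).app (op V)) h
  have H (u) : (SMod.preMap (inv C.pbw)).app (op V) (onSections C.pbw V u) = u :=
    congrArg (fun k : L.symSheaf ⟶ L.symSheaf ↦ (SMod.preMap k).app (op V) u)
      (IsIso.hom_inv_id C.pbw)
  rwa [H, H] at h'

theorem isFilteredIso_pbw : IsFilteredIso C.pbw := by
  refine ⟨C.isIso_pbw hL, fun V p s ↦ ⟨fun hs x hx ↦ ?_, fun hs x hx ↦ ?_⟩⟩
  · obtain ⟨W, h, hxW, u, hu, e⟩ := hs x hx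
    refine ⟨W, h, hxW, (C.conn W).pbw K u, (C.conn W).pbw_mem_filt hu, ?_⟩
    have := PresheafOfModules.naturality_apply (SMod.preMap C.pbw) (homOfLE h).op s
    exact this.symm.trans ((congrArg ((SMod.preMap C.pbw).app (op W)) e).trans (C.pbw_toSym W u))
  · obtain ⟨W, h, hxW, D, hD, e⟩ := hs x hx
    -- The preimage `u` of the local representative has order at most `p`, and injectivity on
    -- sections identifies it with the restriction of `s`.
    obtain ⟨u, hu, rfl⟩ := (C.conn W).exists_pbw_eq hD
    refine ⟨W, h, hxW, u, hu, C.onSections_pbw_injective hL W ?_⟩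
    refine Eq.trans ?_ (e.trans (C.pbw_toSym W u).symm)
    exact PresheafOfModules.naturality_apply (SMod.preMap C.pbw) (homOfLE h).op s

/-- Over a frame, the coefficient functionals composed with the inverse of `pbw` are sections of the
sheaf of jets that separate the sections of `U(𝓛)`. Duality prescribes their values on `g(α)` and on
`pbw(α)` by the same formula. -/
theorem eq_pbw_of_isDual {g : L.symSheaf ⟶ L.envSheaf} (hg : C.IsDual g) : g = C.pbw := by
  have := C.isIso_pbw hL
  obtain ⟨f, hf⟩ : ∃ f : L.envSheaf ⟶ L.symSheaf, f ≫ C.pbw = 𝟙 _ :=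
    ⟨inv C.pbw, IsIso.inv_hom_id C.pbw⟩
  refine shf_hom_ext fun V p ↦ ?_
  refine SMod.section_ext _ fun x hx ↦ ?_
  obtain ⟨W, h, e, hxW, he⟩ := hL.exists_isFrame hx
  refine ⟨W, h, hxW, ?_⟩
  have res (k : L.symSheaf ⟶ L.envSheaf) :
      resₚ _ h ((SMod.preMap k).app (op V) (L.toSym V p)) =
        (SMod.preMap k).app (op W) (L.toSym W (resₚ L.symPresheaf h p)) :=
    (PresheafOfModules.naturality_apply (SMod.preMap k) (homOfLE h).op _).symm.trans
      (congrArg ((SMod.preMap k).app (op W)) (resₚ_toShf L.symPresheaf h p))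
  refine (res g).trans (Eq.trans ?_ (res C.pbw).symm)
  have H (u) : (SMod.preMap C.pbw).app (op W) ((SMod.preMap f).app (op W) u) = u :=
    congrArg (fun k : L.envSheaf ⟶ L.envSheaf ↦ (SMod.preMap k).app (op W) u) hf
  refine (H _).symm.trans (Eq.trans (congrArg _ (he.section_eq fun m ↦ ?_)) (H _))
  exact (hg W ((he.coeff m).extend.comp (SMod.preMap f)) _).trans
    (C.isDual_pbw W ((he.coeff m).extend.comp (SMod.preMap f)) _).symm

end SheafConnection

namespace SheafConnection

variable (C : L.SheafConnection)

/-- The identities hold for the presheaves by `comul_pbw` and `counit_pbw`; functoriality of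
sheafification and naturality of its unit and adjunction carry them over. -/
theorem isComonoidHom_pbw : L.IsComonoidHom C.pbw := by
  have h₁ : C.pbwPresheaf ≫ L.envComul = L.symComul ≫ (C.pbwPresheaf ⊗ₘ C.pbwPresheaf) := by
    ext V s
    exact (C.conn V.unop).comul_pbw s
  have h₂ : C.pbwPresheaf ≫ L.envCounit = L.symCounit := by
    ext V s
    exact (C.conn V.unop).counit_pbw s
  have h₃ : toShf L.symPresheaf ≫ SMod.preMap C.pbw = C.pbwPresheaf ≫ toShf L.envPresheaf :=
    ((shfAdj X).unit.naturality C.pbwPresheaf).symm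
  constructor
  · have h₄ : C.pbwPresheaf ≫ L.envComul ≫ (toShf L.envPresheaf ⊗ₘ toShf L.envPresheaf) =
        (L.symComul ≫ (toShf L.symPresheaf ⊗ₘ toShf L.symPresheaf)) ≫
          (SMod.preMap C.pbw ⊗ₘ SMod.preMap C.pbw) := by
      rw [reassoc_of% h₁, Category.assoc, tensorHom_comp_tensorHom, tensorHom_comp_tensorHom, h₃]
      rfl
    exact ((shf X).map_comp _ _).symm.trans ((congrArg (shf X).map h₄).trans ((shf X).map_comp _ _))
  · rw [shfCounit, shfCounit, ← h₂]
    exact ((shfAdj X).homEquiv_naturality_left_symm _ _).symm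

theorem toEnv_mem_prevStep {p : ℕ} {V : Opens X}
    {D : Env K (X.presheaf.obj (op V)) (L.sec V)}
    (hD : D ∈ prevStep (Env.filt K (X.presheaf.obj (op V)) (L.sec V)) p) :
    L.toEnv V D ∈ prevStep (fun q ↦ L.envFilt q V) p := by
  rcases p with _ | p
  · rw [show D = 0 from hD, map_zero]
    exact zero_mem _
  · exact toEnv_mem hD

theorem onGr_pbw (hf : IsFilteredIso C.pbw) (p : ℕ) (V : Opens X) (x : Fin p → L.sec V) :
    onGr hf p V (Submodule.Quotient.mk (symProd x)) =
      Submodule.Quotient.mk (envSymmetrization x) := by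
  refine (Submodule.Quotient.eq _).2 ?_
  change (SMod.preMap C.pbw).app (op V) (L.toSym V _) - L.toEnv V _ ∈
    prevStep (fun q ↦ L.envFilt q V) p
  rw [pbw_toSym, ← map_sub]
  exact toEnv_mem_prevStep ((C.conn V).pbw_prod_sub_symmetrization_mem x)

end SheafConnection

end LieAlgebroid

end

theorem mainTheorem5 {K : Type u} [Field K] [CharZero K] {X : RingedSpace.{u, u}}
    [KRingedSpace K X] (L : LieAlgebroid K X) (r : ℕ) (hL : L.IsLocallyFree r)
    (C : L.SheafConnection) :
    ∃ f : L.symSheaf ⟶ L.envSheaf,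
      (∀ g : L.symSheaf ⟶ L.envSheaf, C.IsDual g ↔ g = f) ∧
      L.IsComonoidHom f ∧
      ∃ hf : LieAlgebroid.IsFilteredIso f,
        ∀ (p : ℕ) (V : Opens X) (x : Fin p → L.sec V),
          LieAlgebroid.onGr hf p V (Submodule.Quotient.mk (LieAlgebroid.symProd x)) =
            Submodule.Quotient.mk (LieAlgebroid.envSymmetrization x) :=
  ⟨C.pbw, fun _ ↦ ⟨C.eq_pbw_of_isDual hL, fun h ↦ h ▸ C.isDual_pbw⟩, C.isComonoidHom_pbw,
    C.isFilteredIso_pbw hL, C.onGr_pbw (C.isFilteredIso_pbw hL)⟩
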